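/- Let $G$ be a compact semisimple Lie group (realized, as always possible, as a compact group of units of a finite-dimensional real associative algebra, so that $\mathrm{Ad}(g)X=gXg^{-1}$ and brackets are commutators) whose Lie algebra is a Hermitian symmetric Lie algebra $\mathfrak g=\mathfrak m\oplus\mathfrak h$, $\mathfrak m\neq0$: $[\mathfrak h,\mathfrak h]\subseteq\mathfrak h$, $[\mathfrak h,\mathfrak m]\subseteq\mathfrak m$, $[\mathfrak m,\mathfrak m]\subseteq\mathfrak h$, and there is $A\in\mathfrak h$ with centralizer $\mathfrak h$ in $\mathfrak g$ such that $J=\mathrm{ad}(A)$ satisfies $J^2=-1$ on $\mathfrak m$. Let $H\subset G$ be the stabilizer of $A$, let $\langle\cdot,\cdot\rangle$ be the Killing form of $\mathfrak g$, and put $\chi=-\langle A,A\rangle>0$. For an $\mathfrak m$-valued variable $u$ with jets $(u,u_x,u_{xx},\dots)$ let $D$ be the total derivative on smooth functions of finitely many jet variables, and let $D^{-1}f$ be the differential function $p$ with $Dp=f$ and $p=0$ at the zero jet (zero constant of integration). Put $\mathcal H_u=D-\mathrm{ad}(u)D^{-1}\mathrm{ad}(u)$, $\mathcal R_u=\mathcal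 H_uJ^{-1}$, $\mathcal R_u^*=J^{-1}\mathcal H_u$, $\mathcal J_u=J\mathcal H_uJ^{-1}$. All functions of $(x,t)$ or $(s,t)$ below are smooth, with space variable in $\mathbb R$ (periodic functions being a special case) and with time in an open interval. The merged hierarchy on $q(x,t)\in\mathfrak m$ consists of the flows $\chi^{-1}q_t=\mathcal R_q^n(Jq)$, and the isospectral hierarchy on $Q(s,t)\in\mathfrak m$ of the flows $Q_t=\mathcal R_Q^n(JQ)$, $n=0,1,2,\dots$ (the "$+n$ flows"). Put $\kappa=\chi^{n/2-1}$ and let $q$ and $Q$ be related by $$x=\chi^{1/2}s,\qquad q(x,\kappa t)=-\chi^{-1/2}Q(s,t).$$ 1. For every $n$, $\mathcal R_u^n(Ju)$ is a well-defined $\mathfrak m$-valued differential function, and $[u,J^{-1}\mathcal R_u^n(Ju)]$ has a unique primitive with zero constant of integration. $Q$ solves the $+n$ isospectral flow if and only if $U_t-V_s+[U,V]=0$ for all $\lambda\in\mathbb R$, where $U=\lambda A+Q$, $V=\lambda^nA+\sum_{k=0}^{n-1}\lambda^k(V^{(k)}_{\mathfrak m}+V^{(k)}_{\mathfrak h})$,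 $V^{(k)}_{\mathfrak m}=(\mathcal R_Q^*)^{n-1-k}(Q)$, $V^{(k)}_{\mathfrak h}=D^{-1}[Q,V^{(k)}_{\mathfrak m}]$. 2. For every $n$, $q$ solves the $+n$ flow of the merged hierarchy on a time interval $I$ if and only if $Q$ solves the $+n$ isospectral flow on $\{t:\kappa t\in I\}$. 3. The $+2$ flows on $q$ and on $Q$ are the NLS systems $$\chi^{-1}q_t=-Jq_{xx}+\tfrac12[q,[q,Jq]],\qquad Q_t=-JQ_{ss}+\tfrac12[Q,[Q,JQ]],$$ and the $+3$ flows are the mKdV systems $$\chi^{-1}q_t=-q_{xxx}+[q,[q,q_x]]+\tfrac12[Jq,[Jq,q]]_x,\qquad Q_t=-Q_{sss}+[Q,[Q,Q_s]]+\tfrac12[JQ,[JQ,Q]]_s .$$ These systems are invariant under $\mathrm{Ad}(H)$. 4. Let $n\ge2$ and let $Q$ solve the $+n$ isospectral flow. The $+n$ flow on $q$ determines the quantities $h^\perp=-\mathcal R_q^{n-2}(Jq)$, $h_\perp=\chi^{1/2}J^{-1}h^\perp$, $h_\parallel=\chi^{1/2}D^{-1}[q,Jh^\perp]$, $w_\perp=\chi\mathcal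 J_q(h^\perp)$, $w_\parallel=-D^{-1}[q,w_\perp]$. Then $V^{(1)}_{\mathfrak m}=\kappa h_\perp$, $V^{(1)}_{\mathfrak h}=\kappa h_\parallel$, $V^{(0)}_{\mathfrak m}=-\kappa w_\perp$, $V^{(0)}_{\mathfrak h}=-\kappa w_\parallel$ at corresponding points $(s,t)$ and $(x,\kappa t)$. A curve flow $\gamma(x,t)$ in the affine symmetric space $(G\ltimes\mathfrak g)/G$, identified with the Euclidean space $(\mathfrak g,-\langle\cdot,\cdot\rangle)$, is called a non-stretching curve flow determined by the $+n$ flow on $q$, with frame $\psi(x,t)\in G$, if $x$ is its arclength and $$\mathrm{Ad}(\psi^{-1})\gamma_x=\chi^{-1/2}A,\quad \psi^{-1}\psi_x=q,\quad \mathrm{Ad}(\psi^{-1})\gamma_t=h_\perp+h_\parallel,\quad \psi^{-1}\psi_t=w_\perp+w_\parallel,$$ where $q$ solves the $+n$ flow. Let $\varphi(s,t,\lambda)\in G$ ($\lambda\in\mathbb R$) be any smooth solution of $\varphi_s=U\varphi$, $\varphi_t=V\varphi$, and let $\Gamma(s,t)=\varphi^{-1}\varphi_\lambda|_{\lambda=0}$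 be its Sym–Pohlmeyer curve. Then $\gamma(x,\kappa t)=\Gamma(s,t)$ lies in $\mathfrak g$ and is a non-stretching curve flow determined by the $+n$ flow on $q$, with frame $\psi(x,\kappa t)=\varphi(s,t,0)^{-1}$. Conversely, every non-stretching curve flow determined by the $+n$ flow on $q$ is of the form $\gamma(x,\kappa t)=g\,\Gamma(s,t)\,g^{-1}+a$ with constant $g\in G$, $a\in\mathfrak g$. -/

import Mathlib

open scoped ContDiff

attribute [local instance] LieRing.ofAssociativeRing

noncomputable section

/-- A Hermitian symmetric Lie algebra `(𝔤 = 𝔪 ⊕ 𝔥, A)` together with a compact semisimple Lie group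
`G` with Lie algebra `𝔤`. As compact Lie groups are linear, `G` is taken to be a compact group of
units of a finite-dimensional real associative algebra `𝔸` (for instance a matrix algebra), so that
`Ad(g) X = g X g⁻¹` and the Lie bracket is the commutator. The symmetric space is assumed to have
positive dimension (`𝔪 ≠ 0`). -/
structure HermitianSymmetric (𝔸 : Type*) [NormedRing 𝔸] [NormedAlgebra ℝ 𝔸] where
  /-- the compact group -/
  G : Subgroup 𝔸ˣ
  isCompact_G : IsCompact (G : Set 𝔸ˣ)
  /-- the Lie algebra of `G` -/
  𝔤 : LieSubalgebra ℝ 𝔸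
  mem_𝔤_iff : ∀ X : 𝔸, X ∈ 𝔤 ↔ ∀ r : ℝ, ∃ g ∈ G, (g : 𝔸) = NormedSpace.exp (r • X)
  isSemisimple : LieAlgebra.IsSemisimple ℝ 𝔤
  /-- the isotropy subalgebra -/
  𝔥 : Submodule ℝ 𝔸
  /-- the complementary subspace -/
  𝔪 : Submodule ℝ 𝔸
  sup_eq : 𝔥 ⊔ 𝔪 = 𝔤.toSubmodule
  disjoint : Disjoint 𝔥 𝔪
  lie_𝔥_𝔥 : ∀ X ∈ 𝔥, ∀ Y ∈ 𝔥, ⁅X, Y⁆ ∈ 𝔥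
  lie_𝔥_𝔪 : ∀ X ∈ 𝔥, ∀ Y ∈ 𝔪, ⁅X, Y⁆ ∈ 𝔪
  lie_𝔪_𝔪 : ∀ X ∈ 𝔪, ∀ Y ∈ 𝔪, ⁅X, Y⁆ ∈ 𝔥
  /-- the element defining the complex structure `J = ad(A)` on `𝔪` -/
  A : 𝔸
  A_mem : A ∈ 𝔥
  centralizer_A : ∀ X ∈ 𝔤, ⁅A, X⁆ = 0 ↔ X ∈ 𝔥
  ad_A_sq : ∀ X ∈ 𝔪, ⁅A, ⁅A, X⁆⁆ = -X
  𝔪_ne_bot : 𝔪 ≠ ⊥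

namespace HermitianSymmetric

variable {𝔸 : Type*} [NormedRing 𝔸] [NormedAlgebra ℝ 𝔸] (S : HermitianSymmetric 𝔸)

theorem A_mem_𝔤 : S.A ∈ S.𝔤 := by
  have h : S.A ∈ S.𝔤.toSubmodule := S.sup_eq ▸ Submodule.mem_sup_left S.A_mem
  exact h

/-- The constant `χ = -⟨A, A⟩`, the squared norm of `A` with respect to minus the Killing form. -/
def χ : ℝ := -(killingForm ℝ S.𝔤 ⟨S.A, S.A_mem_𝔤⟩ ⟨S.A, S.A_mem_𝔤⟩)

/-- The stabilizer group `H` of `A` in `G`. -/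
def H : Subgroup 𝔸ˣ where
  carrier := {g | g ∈ S.G ∧ (g : 𝔸) * S.A = S.A * (g : 𝔸)}
  one_mem' := ⟨S.G.one_mem, by simp⟩
  mul_mem' := by
    rintro a b ⟨ha, ha'⟩ ⟨hb, hb'⟩
    refine ⟨S.G.mul_mem ha hb, ?_⟩
    rw [Units.val_mul, mul_assoc, hb', ← mul_assoc, ha', mul_assoc]
  inv_mem' := by
    rintro a ⟨ha, ha'⟩
    exact ⟨S.G.inv_mem ha, (Units.inv_mul_eq_iff_eq_mul a).mpr
      (by rw [← mul_assoc, ha', mul_assoc, Units.mul_inv, mul_one])⟩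

/-! ### Differential functions on the jet space of `𝔪`-valued functions -/

/-- Jets `(u, u_x, u_xx, …)` of `𝔪`-valued functions of one variable. -/
abbrev Jet : Type _ := ℕ → S.𝔪

/-- The jet at `x` of a function `f`. -/
def jet (f : ℝ → S.𝔪) (x : ℝ) : S.Jet := fun k => iteratedDeriv k f x

/-- `F` is a smooth function of finitely many of the jet variables. -/
def IsDifferential (F : S.Jet → 𝔸) : Prop :=
  ∃ (N : ℕ) (f : (Fin N → S.𝔪) → 𝔸), ContDiff ℝ ∞ f ∧ ∀ u, F u = f (fun i => u i)

/-- The total derivative `D F = ∑ₖ ∂F/∂uₖ · uₖ₊₁`, as the derivative of `F` at `u` in the direction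
of the shifted jet. -/
def D (F : S.Jet → 𝔸) : S.Jet → 𝔸 := fun u =>
  deriv (fun ε : ℝ => F (fun k => u k + ε • u (k + 1))) 0

/-- `p` is the formal primitive of `f`: a differential function with `D p = f` and with zero
constant of integration. -/
def IsPrimitive (p f : S.Jet → 𝔸) : Prop :=
  S.IsDifferential p ∧ S.D p = f ∧ p 0 = 0

open Classical in
/-- The formal inverse `D⁻¹` of the total derivative (with the value `0` on functions which are not
total derivatives). -/
def Dinv (f : S.Jet → 𝔸) : S.Jet → 𝔸 :=
  if h : ∃ p, S.IsPrimitive p f then h.choose else 0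

/-! ### The operators, with `J = ad(A)`, and `J⁻¹ = -J` on `𝔪` -/

/-- `J = ad(A)`. -/
def J (F : S.Jet → 𝔸) : S.Jet → 𝔸 := fun u => ⁅S.A, F u⁆

/-- `J⁻¹ = -ad(A)` (inverse to `J` on `𝔪`-valued functions). -/
def Jinv (F : S.Jet → 𝔸) : S.Jet → 𝔸 := fun u => -⁅S.A, F u⁆

/-- The jet variable `u` itself. -/
def var : S.Jet → 𝔸 := fun u => (u 0 : 𝔸)

/-- `ad(u)`. -/
def adVar (F : S.Jet → 𝔸) : S.Jet → 𝔸 := fun u => ⁅(u 0 : 𝔸), F u⁆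

/-- The operator `ℋ = D - ad(u) D⁻¹ ad(u)`. -/
def Hop (F : S.Jet → 𝔸) : S.Jet → 𝔸 := S.D F - S.adVar (S.Dinv (S.adVar F))

/-- The operator `𝒥 = J ℋ J⁻¹`. -/
def Jop (F : S.Jet → 𝔸) : S.Jet → 𝔸 := S.J (S.Hop (S.Jinv F))

/-- The recursion operator `ℛ = ℋ J⁻¹`. -/
def Rop (F : S.Jet → 𝔸) : S.Jet → 𝔸 := S.Hop (S.Jinv F)

/-- The adjoint recursion operator `ℛ* = J⁻¹ ℋ`. -/
def RopAdj (F : S.Jet → 𝔸) : S.Jet → 𝔸 := S.Jinv (S.Hop F)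

/-- `ℛⁿ(J u)`. -/
def hier (n : ℕ) : S.Jet → 𝔸 := S.Rop^[n] (S.J S.var)

/-! ### The flows; `I` is an open interval of times -/

/-- `q(x,t) ∈ 𝔪` is smooth for `x ∈ ℝ`, `t ∈ I`. -/
def SmoothOn (I : Set ℝ) (q : ℝ → ℝ → S.𝔪) : Prop :=
  ContDiffOn ℝ ∞ (fun p : ℝ × ℝ => q p.1 p.2) (Set.univ ×ˢ I)

/-- `q` is a smooth solution of the `+n` flow `χ⁻¹ q_t = ℛⁿ(J q)` of the merged hierarchy. -/
def MergedFlow (n : ℕ) (I : Set ℝ) (q : ℝ → ℝ → S.𝔪) : Prop :=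
  S.SmoothOn I q ∧ ∀ x, ∀ t ∈ I,
    S.χ⁻¹ • (deriv (fun τ => q x τ) t : 𝔸) = S.hier n (S.jet (fun y => q y t) x)

/-- `Q` is a smooth solution of the `+n` isospectral flow `Q_t = ℛⁿ(J Q)`. -/
def IsospectralFlow (n : ℕ) (I : Set ℝ) (Q : ℝ → ℝ → S.𝔪) : Prop :=
  S.SmoothOn I Q ∧ ∀ s, ∀ t ∈ I,
    (deriv (fun τ => Q s τ) t : 𝔸) = S.hier n (S.jet (fun y => Q y t) s)

/-- `c⁻¹ q_t = -J q_xx + ½ [q, [q, J q]]`. -/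
def NLS (c : ℝ) (I : Set ℝ) (q : ℝ → ℝ → S.𝔪) : Prop :=
  S.SmoothOn I q ∧ ∀ x, ∀ t ∈ I,
    c⁻¹ • (deriv (fun τ => q x τ) t : 𝔸) =
      -⁅S.A, (iteratedDeriv 2 (fun y => q y t) x : 𝔸)⁆
        + (1 / 2 : ℝ) • ⁅(q x t : 𝔸), ⁅(q x t : 𝔸), ⁅S.A, (q x t : 𝔸)⁆⁆⁆

/-- `c⁻¹ q_t = -q_xxx + [q, [q, q_x]] + ½ [J q, [J q, q]]_x`. -/
def MKdV (c : ℝ) (I : Set ℝ) (q : ℝ → ℝ → S.𝔪) : Prop :=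
  S.SmoothOn I q ∧ ∀ x, ∀ t ∈ I,
    c⁻¹ • (deriv (fun τ => q x τ) t : 𝔸) =
      -(iteratedDeriv 3 (fun y => q y t) x : 𝔸)
        + ⁅(q x t : 𝔸), ⁅(q x t : 𝔸), (deriv (fun y => q y t) x : 𝔸)⁆⁆
        + (1 / 2 : ℝ) • deriv (fun y =>
            ⁅⁅S.A, (q y t : 𝔸)⁆, ⁅⁅S.A, (q y t : 𝔸)⁆, (q y t : 𝔸)⁆⁆) x

/-! ### The Lax pair `U = λ A + Q`, `V = ∑ λᵏ V⁽ᵏ⁾` of the `+n` isospectral flow -/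

/-- The `𝔪`-part of `V⁽ᵏ⁾` for `k < n`, namely `(ℛ*)ⁿ⁻¹⁻ᵏ(Q)`. -/
def laxVm (n k : ℕ) : S.Jet → 𝔸 := S.RopAdj^[n - 1 - k] S.var

/-- The `𝔥`-part of `V⁽ᵏ⁾` for `k < n`, determined by `D V_𝔥 = [Q, V_𝔪]` with zero constant of
integration. -/
def laxVh (n k : ℕ) : S.Jet → 𝔸 := S.Dinv (S.adVar (S.laxVm n k))

/-- `U(λ) = λ A + Q`. -/
def laxU (l : ℝ) : S.Jet → 𝔸 := fun u => l • S.A + (u 0 : 𝔸)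

/-- `V(λ) = λⁿ A + ∑_{k<n} λᵏ (V⁽ᵏ⁾_𝔪 + V⁽ᵏ⁾_𝔥)`. -/
def laxV (n : ℕ) (l : ℝ) : S.Jet → 𝔸 := fun u =>
  l ^ n • S.A + ∑ k ∈ Finset.range n, l ^ k • (S.laxVm n k u + S.laxVh n k u)

/-- The zero-curvature equation `U_t - V_s + [U, V] = 0` for all `λ`. -/
def ZeroCurvature (n : ℕ) (I : Set ℝ) (Q : ℝ → ℝ → S.𝔪) : Prop :=
  ∀ s, ∀ t ∈ I, ∀ l : ℝ,
    deriv (fun τ => S.laxU l (S.jet (fun y => Q y τ) s)) t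
      - deriv (fun σ => S.laxV n l (S.jet (fun y => Q y t) σ)) s
      + ⁅S.laxU l (S.jet (fun y => Q y t) s), S.laxV n l (S.jet (fun y => Q y t) s)⁆ = 0

/-- `φ(s,t,λ) ∈ G` is a smooth solution of the linear system `φ_s = U φ`, `φ_t = V φ`. -/
structure IsSpectralFunction (n : ℕ) (I : Set ℝ) (Q : ℝ → ℝ → S.𝔪) (φ : ℝ → ℝ → ℝ → 𝔸ˣ) :
    Prop where
  mem_G : ∀ s, ∀ t ∈ I, ∀ l, φ s t l ∈ S.G
  smooth : ContDiffOn ℝ ∞ (fun p : ℝ × ℝ × ℝ => (φ p.1 p.2.1 p.2.2 : 𝔸))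
    (Set.univ ×ˢ (I ×ˢ Set.univ))
  deriv_s : ∀ s, ∀ t ∈ I, ∀ l, deriv (fun σ => (φ σ t l : 𝔸)) s =
    S.laxU l (S.jet (fun y => Q y t) s) * (φ s t l : 𝔸)
  deriv_t : ∀ s, ∀ t ∈ I, ∀ l, deriv (fun τ => (φ s τ l : 𝔸)) t =
    S.laxV n l (S.jet (fun y => Q y t) s) * (φ s t l : 𝔸)

/-- The Sym–Pohlmeyer curve `φ⁻¹ φ_λ` at `λ = 0`. -/
def symPohlmeyer (φ : ℝ → ℝ → ℝ → 𝔸ˣ) (s t : ℝ) : 𝔸 :=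
  ((φ s t 0)⁻¹ : 𝔸ˣ) * deriv (fun l => (φ s t l : 𝔸)) 0

/-! ### The non-stretching curve flow determined by the `+n` flow, `n ≥ 2`

`h^⊥` is `-ℛⁿ⁻²(J q)`, so that the frame structure equations, which give `χ⁻¹ q_t = -ℛ²(h^⊥)`, yield
the `+n` flow. -/

/-- `h^⊥ = -ℛⁿ⁻²(J q)`. -/
def hUp (n : ℕ) : S.Jet → 𝔸 := -S.hier (n - 2)

/-- `h_⊥ = χ^{1/2} J⁻¹ h^⊥`, i.e. `h^⊥ = χ^{-1/2} [A, h_⊥]`. -/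
def hPerp (n : ℕ) : S.Jet → 𝔸 := √S.χ • S.Jinv (S.hUp n)

/-- `h_∥ = χ^{1/2} D⁻¹ [q, J h^⊥]`. -/
def hPar (n : ℕ) : S.Jet → 𝔸 := √S.χ • S.Dinv (S.adVar (S.J (S.hUp n)))

/-- `w_⊥ = χ 𝒥(h^⊥)`. -/
def wPerp (n : ℕ) : S.Jet → 𝔸 := S.χ • S.Jop (S.hUp n)

/-- `w_∥ = -D⁻¹ [q, w_⊥]`. -/
def wPar (n : ℕ) : S.Jet → 𝔸 := -S.Dinv (S.adVar (S.wPerp n))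

/-- `γ(x,t)` is a non-stretching curve flow (`x` being arclength) in the affine symmetric space
`(G ⋉ 𝔤)/G`, which is identified with the Euclidean space `𝔤` with the metric `-⟨·,·⟩`, framed by
`ψ(x,t) ∈ G` through the coframe `e = Ad(ψ⁻¹)` and the connection `ω = ψ⁻¹ dψ`. The frame is
`G`-parallel with `e_x = χ^{-1/2} A` and `ω_x = q ∈ 𝔪`, and the flow is the one determined by the
`+n` flow on `q`: `e_t = h_⊥ + h_∥` and `ω_t = w_⊥ + w_∥`. -/
structure IsCurveFlow (n : ℕ) (I : Set ℝ) (q : ℝ → ℝ → S.𝔪) (ψ : ℝ → ℝ → 𝔸ˣ)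
    (γ : ℝ → ℝ → S.𝔤) : Prop where
  flow : S.MergedFlow n I q
  mem_G : ∀ x, ∀ t ∈ I, ψ x t ∈ S.G
  smooth_frame : ContDiffOn ℝ ∞ (fun p : ℝ × ℝ => (ψ p.1 p.2 : 𝔸)) (Set.univ ×ˢ I)
  smooth_curve : ContDiffOn ℝ ∞ (fun p : ℝ × ℝ => γ p.1 p.2) (Set.univ ×ˢ I)
  arclength : ∀ x, ∀ t ∈ I,
    -(killingForm ℝ S.𝔤 (deriv (fun y => γ y t) x) (deriv (fun y => γ y t) x)) = 1
  e_x : ∀ x, ∀ t ∈ I, ((ψ x t)⁻¹ : 𝔸ˣ) * (deriv (fun y => γ y t) x : 𝔸) * (ψ x t : 𝔸) =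
    (√S.χ)⁻¹ • S.A
  ω_x : ∀ x, ∀ t ∈ I, ((ψ x t)⁻¹ : 𝔸ˣ) * deriv (fun y => (ψ y t : 𝔸)) x = q x t
  e_t : ∀ x, ∀ t ∈ I, ((ψ x t)⁻¹ : 𝔸ˣ) * (deriv (fun τ => γ x τ) t : 𝔸) * (ψ x t : 𝔸) =
    S.hPerp n (S.jet (fun y => q y t) x) + S.hPar n (S.jet (fun y => q y t) x)
  ω_t : ∀ x, ∀ t ∈ I, ((ψ x t)⁻¹ : 𝔸ˣ) * deriv (fun τ => (ψ x τ : 𝔸)) t =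
    S.wPerp n (S.jet (fun y => q y t) x) + S.wPar n (S.jet (fun y => q y t) x)

/-! ### The transformation -/

/-- The factor `κ = χ^{n/2-1}` between the two time variables of the `+n` flow (`κ = 1` for
`n = 2`). -/
def κ (n : ℕ) : ℝ := S.χ ^ ((n : ℝ) / 2 - 1)

/-- `q(x, κ t) = -χ^{-1/2} Q(s, t)` where `x = χ^{1/2} s`. -/
def Corresponds (n : ℕ) (q Q : ℝ → ℝ → S.𝔪) : Prop :=
  ∀ s t, q (√S.χ * s) (S.κ n * t) = -((√S.χ)⁻¹ • Q s t)

/-- The interval of isospectral times `t` with `κ t ∈ I`. -/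
def isoTimes (n : ℕ) (I : Set ℝ) : Set ℝ := {t | S.κ n * t ∈ I}

end HermitianSymmetric

end

/-! Everything rests on one locality statement (`isGoodCoeff`): for every k the bracket of u with
(ℛ*)ᵏ(u) is a total derivative. Call (ℛ*)ᵏ(u) = `coeffM k` and its primitive `coeffH k`. In the
generating series V = A + Σ λ^(-k-1) (`coeffM k` + `coeffH k`), the 𝔪- and 𝔥-components of the
equation D V = [λA + u, V] are the recursion for `coeffM` and the defining equation of `coeffH`.

The equation determines the 𝔥-part of a coefficient only through its derivative, so a further
algebraic condition is needed to make it local. On 𝔤 the operator ad A has eigenvalues 0 and ±i, so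
its cube is -ad A. Passing to the adjoint representation, one requires V³ = -V as well. The operator
λ⁻¹(D - ad u) - ad A is a derivation, hence it also controls V³ + V; comparing coefficients shows
that the part of the next coefficient commuting with A is a polynomial in the earlier ones
(`exists_next_coeff`), and that its derivative is the required bracket. Semisimplicity makes the
adjoint representation faithful, which brings this primitive back to 𝔤. Primitives with zero
constant are unique because the kernel of D consists of constants
(`IsDiffFun.eq_of_totalD_eq_zero`).

Given locality, the Lax matrix is the polynomial part of λⁿV, and D V - [U, V] equals the right-hand
side of the +n flow, independently of λ (`totalD_laxV`). The coefficients are homogeneous under u_k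
↦ c rᵏ u_k with c² = r² (`coeff_scale`). Taking r = χ^(-1/2) and c = -r matches the two hierarchies,
and the same weights match the frame motion with V⁽¹⁾ and V⁽⁰⁾ (`Corresponds.lax_eq`). Short
computations with the first coefficients give NLS and mKdV.

For the curves, differentiating the linear system in λ at 0 gives Γ_s = φ⁻¹Aφ and Γ_t = φ⁻¹V⁽¹⁾φ,
which are the frame equations with ψ = φ⁻¹. Conversely, ψφ is constant along any such curve flow,
and then so is γ - gΓg⁻¹. -/

noncomputable section

/-! ### Differential functions with values in a normed space -/

section JetCalculus

variable {M W W₁ W₂ W₃ : Type*} [NormedAddCommGroup M] [NormedSpace ℝ M]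
  [NormedAddCommGroup W] [NormedSpace ℝ W] [NormedAddCommGroup W₁] [NormedSpace ℝ W₁]
  [NormedAddCommGroup W₂] [NormedSpace ℝ W₂] [NormedAddCommGroup W₃] [NormedSpace ℝ W₃]

/-- `F` is a smooth function of finitely many of the jet variables. -/
def IsDiffFun (F : (ℕ → M) → W) : Prop :=
  ∃ (N : ℕ) (f : (Fin N → M) → W), ContDiff ℝ ∞ f ∧ ∀ u, F u = f (fun i => u i)

/-- The total derivative. -/
def totalD (F : (ℕ → M) → W) : (ℕ → M) → W := fun u =>
  deriv (fun ε : ℝ => F (fun k => u k + ε • u (k + 1))) 0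

theorem IsDiffFun.exists_le {F : (ℕ → M) → W} (hF : IsDiffFun F) : ∃ N : ℕ, ∀ N', N ≤ N' →
    ∃ f : (Fin N' → M) → W, ContDiff ℝ ∞ f ∧ ∀ u, F u = f (fun i => u i) := by
  obtain ⟨N, f, hf, h⟩ := hF
  refine ⟨N, fun N' hN => ⟨fun v => f (fun i => v (Fin.castLE hN i)), ?_, fun u => by simp [h]⟩⟩
  exact hf.comp (contDiff_pi.2 fun i => contDiff_apply ℝ M _)

theorem IsDiffFun.of_apply (k : ℕ) : IsDiffFun (fun u : ℕ → M => u k) :=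
  ⟨k + 1, fun v => v (Fin.last k), contDiff_apply ℝ M _, fun u => by simp⟩

theorem IsDiffFun.const (c : W) : IsDiffFun (fun _ : ℕ → M => c) :=
  ⟨0, fun _ => c, contDiff_const, fun _ => rfl⟩

theorem IsDiffFun.comp {F : (ℕ → M) → W₁} (hF : IsDiffFun F) {Φ : W₁ → W}
    (hΦ : ContDiff ℝ ∞ Φ) : IsDiffFun (fun u => Φ (F u)) := by
  obtain ⟨N, f, hf, h⟩ := hF
  exact ⟨N, fun v => Φ (f v), hΦ.comp hf, fun u => by simp only [h]⟩

theorem IsDiffFun.comp₂ {F₁ : (ℕ → M) → W₁} {F₂ : (ℕ → M) → W₂} (h₁ : IsDiffFun F₁)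
    (h₂ : IsDiffFun F₂) {Φ : W₁ × W₂ → W} (hΦ : ContDiff ℝ ∞ Φ) :
    IsDiffFun (fun u => Φ (F₁ u, F₂ u)) := by
  obtain ⟨N₁, h₁⟩ := h₁.exists_le
  obtain ⟨N₂, h₂⟩ := h₂.exists_le
  obtain ⟨f₁, hf₁, h₁⟩ := h₁ (max N₁ N₂) (le_max_left _ _)
  obtain ⟨f₂, hf₂, h₂⟩ := h₂ (max N₁ N₂) (le_max_right _ _)
  exact ⟨max N₁ N₂, fun v => Φ (f₁ v, f₂ v), hΦ.comp (hf₁.prodMk hf₂),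
    fun u => by simp only [h₁, h₂]⟩

theorem IsDiffFun.add {F G : (ℕ → M) → W} (hF : IsDiffFun F) (hG : IsDiffFun G) :
    IsDiffFun (fun u => F u + G u) :=
  hF.comp₂ hG (Φ := fun p => p.1 + p.2) (contDiff_fst.add contDiff_snd)

theorem IsDiffFun.clm {F : (ℕ → M) → W₁} (hF : IsDiffFun F) (L : W₁ →L[ℝ] W) :
    IsDiffFun (fun u => L (F u)) :=
  hF.comp L.contDiff

theorem IsDiffFun.neg {F : (ℕ → M) → W} (hF : IsDiffFun F) : IsDiffFun (fun u => -F u) :=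
  hF.comp contDiff_neg

theorem IsDiffFun.smul {F : (ℕ → M) → W} (hF : IsDiffFun F) (c : ℝ) :
    IsDiffFun (fun u => c • F u) :=
  hF.comp (contDiff_const_smul c)

theorem IsDiffFun.sub {F G : (ℕ → M) → W} (hF : IsDiffFun F) (hG : IsDiffFun G) :
    IsDiffFun (fun u => F u - G u) :=
  hF.comp₂ hG (Φ := fun p => p.1 - p.2) (contDiff_fst.sub contDiff_snd)

theorem hasDerivAt_restrict_shift (N : ℕ) (u : ℕ → M) (ε : ℝ) :
    HasDerivAt (fun ε : ℝ => fun i : Fin N => u i + ε • u (i + 1)) (fun i => u (i + 1)) ε := by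
  refine hasDerivAt_pi.2 fun i => ?_
  simpa using ((hasDerivAt_id ε).smul_const (u (i + 1))).const_add (u i)

theorem IsDiffFun.hasDerivAt {F : (ℕ → M) → W} (hF : IsDiffFun F) (u : ℕ → M) :
    HasDerivAt (fun ε : ℝ => F (fun k => u k + ε • u (k + 1))) (totalD F u) 0 := by
  refine DifferentiableAt.hasDerivAt ?_
  obtain ⟨N, f, hf, h⟩ := hF
  simp only [h]
  exact DifferentiableAt.comp (g := f) 0 ((hf.differentiable (by simp)).differentiableAt)
    (hasDerivAt_restrict_shift N u 0).differentiableAt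

theorem totalD_eq_fderiv {N : ℕ} {f : (Fin N → M) → W} (hf : ContDiff ℝ ∞ f)
    {F : (ℕ → M) → W} (h : ∀ u, F u = f (fun i => u i)) (u : ℕ → M) :
    totalD F u = fderiv ℝ f (fun i => u i) (fun i => u (i + 1)) := by
  have h1 : HasFDerivAt f (fderiv ℝ f (fun i => u i)) (fun i : Fin N => u i + (0 : ℝ) • u (i + 1)) := by
    simpa using ((hf.differentiable (by simp)).differentiableAt).hasFDerivAt
  have := h1.comp_hasDerivAt (0 : ℝ) (hasDerivAt_restrict_shift N u 0)
  rw [totalD, ← this.deriv]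
  simp only [h]
  rfl

theorem IsDiffFun.isDiffFun_totalD {F : (ℕ → M) → W} (hF : IsDiffFun F) : IsDiffFun (totalD F) := by
  obtain ⟨N, f, hf, h⟩ := hF
  refine ⟨N + 1, fun v => fderiv ℝ f (fun i => v i.castSucc) (fun i => v i.succ), ?_, fun u => ?_⟩
  · refine ContDiff.clm_apply (ContDiff.comp (hf.fderiv_right (m := ∞) (by simp)) ?_) ?_ <;>
      exact contDiff_pi.2 fun i => contDiff_apply ℝ M _
  · rw [totalD_eq_fderiv hf h]
    simp

theorem totalD_const (c : W) : totalD (fun _ : ℕ → M => c) = 0 := by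
  funext u; simp [totalD]

theorem totalD_apply (k : ℕ) : totalD (fun u : ℕ → M => u k) = fun u => u (k + 1) := by
  funext u
  have : HasDerivAt (fun ε : ℝ => u k + ε • u (k + 1)) (u (k + 1)) 0 := by
    simpa using ((hasDerivAt_id (0 : ℝ)).smul_const (u (k + 1))).const_add (u k)
  exact this.deriv

theorem totalD_add {F G : (ℕ → M) → W} (hF : IsDiffFun F) (hG : IsDiffFun G) :
    totalD (fun u => F u + G u) = fun u => totalD F u + totalD G u := by
  funext u; exact ((hF.hasDerivAt u).add (hG.hasDerivAt u)).deriv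

theorem totalD_sub {F G : (ℕ → M) → W} (hF : IsDiffFun F) (hG : IsDiffFun G) :
    totalD (fun u => F u - G u) = fun u => totalD F u - totalD G u := by
  funext u; exact ((hF.hasDerivAt u).sub (hG.hasDerivAt u)).deriv

theorem totalD_neg (F : (ℕ → M) → W) :
    totalD (fun u => -F u) = fun u => -totalD F u := by
  funext u; exact deriv.fun_neg

theorem totalD_smul {F : (ℕ → M) → W} (hF : IsDiffFun F) (c : ℝ) :
    totalD (fun u => c • F u) = fun u => c • totalD F u := by
  funext u; exact ((hF.hasDerivAt u).const_smul c).deriv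

theorem totalD_clm {F : (ℕ → M) → W₁} (hF : IsDiffFun F) (L : W₁ →L[ℝ] W) :
    totalD (fun u => L (F u)) = fun u => L (totalD F u) := by
  funext u; exact (L.hasFDerivAt.comp_hasDerivAt (0 : ℝ) (hF.hasDerivAt u)).deriv

theorem totalD_mul {E : Type*} [NormedRing E] [NormedAlgebra ℝ E] {F G : (ℕ → M) → E}
    (hF : IsDiffFun F) (hG : IsDiffFun G) :
    totalD (fun u => F u * G u) = fun u => totalD F u * G u + F u * totalD G u := by
  funext u
  have := ((hF.hasDerivAt u).mul (hG.hasDerivAt u)).deriv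
  simp only [zero_smul, add_zero] at this
  exact this

theorem IsDiffFun.mul {E : Type*} [NormedRing E] [NormedAlgebra ℝ E] {F G : (ℕ → M) → E}
    (hF : IsDiffFun F) (hG : IsDiffFun G) : IsDiffFun (fun u => F u * G u) :=
  hF.comp₂ hG (Φ := fun p => p.1 * p.2) (contDiff_fst.mul contDiff_snd)

theorem IsDiffFun.lie {E : Type*} [NormedRing E] [NormedAlgebra ℝ E] {F G : (ℕ → M) → E}
    (hF : IsDiffFun F) (hG : IsDiffFun G) : IsDiffFun (fun u => ⁅F u, G u⁆) :=
  (hF.mul hG).sub (hG.mul hF)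

theorem totalD_lie {E : Type*} [NormedRing E] [NormedAlgebra ℝ E] {F G : (ℕ → M) → E}
    (hF : IsDiffFun F) (hG : IsDiffFun G) :
    totalD (fun u => ⁅F u, G u⁆) = fun u => ⁅totalD F u, G u⁆ + ⁅F u, totalD G u⁆ := by
  have := totalD_sub (hF.mul hG) (hG.mul hF)
  rw [totalD_mul hF hG, totalD_mul hG hF] at this
  simp only [LieRing.of_associative_ring_bracket]
  rw [this]
  funext u
  dsimp only
  abel

theorem IsDiffFun.comp_scale {F : (ℕ → M) → W} (hF : IsDiffFun F) (a : ℕ → ℝ) :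
    IsDiffFun (fun v => F (fun k => a k • v k)) := by
  obtain ⟨N, f, hf, h⟩ := hF
  refine ⟨N, fun v => f (fun i => a i • v i), hf.comp (contDiff_pi.2 fun i => ?_),
    fun u => by simp only [h]⟩
  exact (contDiff_apply ℝ M i).const_smul _

/-- The rescaled shifted jet has entries c rᵏ u_(k+1), while shifting the rescaled jet gives c
r^(k+1) u_(k+1); the factor r is this mismatch. -/
theorem IsDiffFun.totalD_scale {F : (ℕ → M) → W} (hF : IsDiffFun F) (c r : ℝ) (u : ℕ → M) :
    totalD F (fun k => (c * r ^ k) • u k) =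
      r • totalD (fun v => F (fun k => (c * r ^ k) • v k)) u := by
  obtain ⟨N, f, hf, h⟩ := hF
  rw [totalD_eq_fderiv hf h]
  have h1 : HasFDerivAt f (fderiv ℝ f (fun i => (c * r ^ (i : ℕ)) • u i))
      (fun i : Fin N => (c * r ^ (i : ℕ)) • (u i + (0 : ℝ) • u (i + 1))) := by
    simpa using ((hf.differentiable (by simp)).differentiableAt).hasFDerivAt
  have h2 : HasDerivAt (fun ε : ℝ => fun i : Fin N => (c * r ^ (i : ℕ)) • (u i + ε • u (i + 1)))
      (fun i => (c * r ^ (i : ℕ)) • u (i + 1)) 0 := by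
    refine hasDerivAt_pi.2 fun i => HasDerivAt.const_smul _ ?_
    exact hasDerivAt_pi.1 (hasDerivAt_restrict_shift N u 0) i
  have h3 := (h1.comp_hasDerivAt (0 : ℝ) h2).deriv
  have h4 : totalD (fun v => F (fun k => (c * r ^ k) • v k)) u =
      fderiv ℝ f (fun i => (c * r ^ (i : ℕ)) • u i) (fun i => (c * r ^ (i : ℕ)) • u (i + 1)) := by
    rw [← h3]
    simp only [totalD, h]
    rfl
  rw [h4, ← map_smul]
  congr 1
  funext i
  simp only [Pi.smul_apply, smul_smul]
  congr 1
  ring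

/-- The derivative of a differential function along the jets of a smooth function. -/
theorem IsDiffFun.hasDerivAt_jet {F : (ℕ → M) → W} (hF : IsDiffFun F) {f : ℝ → M}
    (hf : ContDiff ℝ ∞ f) (x : ℝ) :
    HasDerivAt (fun y => F (fun k => iteratedDeriv k f y))
      (totalD F (fun k => iteratedDeriv k f x)) x := by
  obtain ⟨N, g, hg, h⟩ := hF
  rw [totalD_eq_fderiv hg h]
  simp only [h]
  refine HasFDerivAt.comp_hasDerivAt (l := g) x
    ((hg.differentiable (by simp)).differentiableAt).hasFDerivAt (hasDerivAt_pi.2 fun i => ?_)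
  rw [iteratedDeriv_succ]
  exact ((hf.differentiable_iteratedDeriv i (by exact_mod_cast ENat.natCast_lt_top _)) x).hasDerivAt

/-- Every finite jet is the jet at the origin of a smooth function. -/
theorem exists_contDiff_iteratedDeriv_eq [CompleteSpace M] (N : ℕ) : ∀ u : ℕ → M,
    ∃ p : ℝ → M, ContDiff ℝ ∞ p ∧ ∀ i < N, iteratedDeriv i p 0 = u i := by
  induction N with
  | zero => exact fun u => ⟨0, contDiff_const, by simp⟩
  | succ N ih =>
    intro u
    obtain ⟨p, hp, h⟩ := ih (fun k => u (k + 1))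
    have hd : ∀ x, HasDerivAt (fun x => u 0 + ∫ y in (0 : ℝ)..x, p y) (p x) x := fun x =>
      (hp.continuous.integral_hasStrictDerivAt 0 x).hasDerivAt.const_add _
    have hd' : deriv (fun x => u 0 + ∫ y in (0 : ℝ)..x, p y) = p := funext fun x => (hd x).deriv
    refine ⟨_, contDiff_infty_iff_deriv.2 ⟨fun x => (hd x).differentiableAt, ?_⟩, ?_⟩
    · rwa [hd']
    · rintro (_ | i) hi
      · simp
      · rw [iteratedDeriv_succ', hd']
        exact h i (by omega)

/-- Along the jets of any smooth function such an F is constant, and some smooth function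
interpolates between the relevant finite part of u and the zero jet. -/
theorem IsDiffFun.eq_of_totalD_eq_zero [CompleteSpace M] {F : (ℕ → M) → W} (hF : IsDiffFun F)
    (h0 : totalD F = 0) (u : ℕ → M) : F u = F 0 := by
  obtain ⟨N, g, -, h⟩ := id hF
  obtain ⟨p, hp, hpu⟩ := exists_contDiff_iteratedDeriv_eq N u
  -- The cut-off is 1 near 0 and 0 near 1, so the product has the prescribed jet at 0 and the zero
  -- jet at 1.
  let b : ContDiffBump (0 : ℝ) := ⟨1 / 4, 1 / 2, by norm_num, by norm_num⟩
  set f : ℝ → M := fun x => b x • p x with hfdef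
  have hf : ContDiff ℝ ∞ f := b.contDiff.smul hp
  have hconst := is_const_of_deriv_eq_zero (f := fun y => F (fun k => iteratedDeriv k f y))
    (fun y => (hF.hasDerivAt_jet hf y).differentiableAt)
    (fun y => by rw [(hF.hasDerivAt_jet hf y).deriv, h0]; rfl) 0 1
  have e0 : F (fun k => iteratedDeriv k f 0) = F u := by
    rw [h, h]
    congr 1
    funext i
    rw [← hpu i i.2]
    refine Filter.EventuallyEq.iteratedDeriv_eq _ ?_
    filter_upwards [b.eventuallyEq_one] with x hx
    simp [hfdef, hx]
  have e1 : F (fun k => iteratedDeriv k f 1) = F 0 := by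
    rw [h, h]
    congr 1
    funext i
    have : f =ᶠ[nhds 1] fun _ => 0 := by
      filter_upwards [Metric.ball_mem_nhds (1 : ℝ) (show (0 : ℝ) < 1 / 2 by norm_num)] with x hx
      have : b x = 0 := b.zero_of_le_dist (by
        rw [Metric.mem_ball, Real.dist_eq, abs_lt] at hx
        rw [Real.dist_eq]
        exact le_trans (by show (1 / 2 : ℝ) ≤ x - 0; linarith) (le_abs_self _))
      simp [hfdef, this]
    rw [Filter.EventuallyEq.iteratedDeriv_eq _ this]
    simp
  rw [← e0, ← e1, hconst]

end JetCalculus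

/-! ### Formal solutions of `D V = [λ a + Q, V]` with `V³ = -V`, `V = a + O(λ⁻¹)` -/

section FormalResolvent

open PowerSeries

variable {R R' : Type*} [Ring R] [Ring R']

/-- The commutator `x ↦ a x - x a` as an additive map. -/
def commAdd (a : R) : R →+ R := AddMonoidHom.mulLeft a - AddMonoidHom.mulRight a

theorem commAdd_apply (a x : R) : commAdd a x = a * x - x * a := rfl

theorem commAdd_self_mul (a x : R) : commAdd a (a * x) = a * commAdd a x := by
  simp only [commAdd_apply]; noncomm_ring

theorem commAdd_mul_self (a x : R) : commAdd a (x * a) = commAdd a x * a := by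
  simp only [commAdd_apply]; noncomm_ring

theorem commAdd_mul_of_commute {a c : R} (hc : commAdd a c = 0) (x : R) :
    commAdd a (x * c) = commAdd a x * c := by
  have hc' : a * c = c * a := sub_eq_zero.1 hc
  simp only [commAdd_apply, sub_mul, mul_assoc, hc']

theorem commAdd_commute_mul {a c : R} (hc : commAdd a c = 0) (x : R) :
    commAdd a (c * x) = c * commAdd a x := by
  have hc' : a * c = c * a := sub_eq_zero.1 hc
  simp only [commAdd_apply, mul_sub, ← mul_assoc, hc']

/-- The derivative of `v ↦ v³ + v` at `a`. -/
def cubicDeriv (a x : R) : R := x * a * a + a * x * a + a * a * x + x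

theorem commAdd_cubicDeriv (a x : R) :
    commAdd a (cubicDeriv a x) = cubicDeriv a (commAdd a x) := by
  simp only [cubicDeriv, map_add, commAdd_self_mul, commAdd_mul_self, mul_assoc a a]

theorem cubicDeriv_of_commute [Algebra ℝ R] {a x : R} (hx : commAdd a x = 0) :
    cubicDeriv a x = (3 : ℝ) • (a * a * x) + x := by
  have h : a * x = x * a := sub_eq_zero.1 hx
  have e1 : x * a * a = a * a * x := by rw [← h, mul_assoc, ← h, mul_assoc]
  have e2 : a * x * a = a * a * x := by rw [mul_assoc, ← h, mul_assoc]
  have e3 : (3 : ℝ) • (a * a * x) = a * a * x + a * a * x + a * a * x := by module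
  rw [cubicDeriv, e1, e2, e3]

/-- The commutator T = [a, w] commutes with a, so expanding [a³, w] = -T gives 3a²T = -T.
Multiplying by a and using a³ = -a gives 2aT = 0, and then T = 0. Thus the kernel and the image of
ad a meet only in 0. -/
theorem commAdd_eq_zero_of_sq [Algebra ℝ R] {a w : R} (ha : a * a * a = -a)
    (hw : commAdd a (commAdd a w) = 0) : commAdd a w = 0 := by
  set T := commAdd a w with hT
  have hc : a * T = T * a := sub_eq_zero.1 hw
  have h1 : (3 : ℝ) • (a * a * T) = -T := by
    have e1 : a * T * a = a * a * T := by rw [mul_assoc, ← hc, mul_assoc]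
    have e2 : T * a * a = a * a * T := by rw [← hc, e1]
    have e3 : a * a * a * w - w * (a * a * a) = a * a * T + a * T * a + T * a * a := by
      rw [hT, commAdd_apply]; noncomm_ring
    have e4 : -T = a * a * a * w - w * (a * a * a) := by
      rw [ha, hT, commAdd_apply]; noncomm_ring
    rw [e4, e3, e1, e2]
    module
  have h2 : a * T = 0 := by
    have h3 := congrArg (fun x => a * x) h1
    simp only [mul_smul_comm, mul_neg, ← mul_assoc, ha, neg_mul] at h3
    have h4 : (2 : ℝ) • (a * T) = 0 := by
      have e : (2 : ℝ) • (a * T) = -((3 : ℝ) • -(a * T)) - a * T := by module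
      rw [e, h3]; simp
    exact (smul_eq_zero.1 h4).resolve_left (by norm_num)
  rw [mul_assoc, h2] at h1
  simpa using h1.symm

/-- The inverse of `cubicDeriv a` on the centralizer of `a`. -/
theorem smul_cubicDeriv_eq [Algebra ℝ R] {a x : R} (ha : a * a * a = -a) :
    ((3 : ℝ) • (a * a * x) + x) + (3 / 2 : ℝ) • (a * a * ((3 : ℝ) • (a * a * x) + x)) = x := by
  have e : a * a * (a * a * x) = -(a * a * x) := by
    rw [← mul_assoc, ← mul_assoc, ha]; noncomm_ring
  rw [mul_add, mul_smul_comm, e]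
  module

/-- This extracts the part of the equation `h` commuting with a. The terms in Q and y satisfy (ad
a)² = -1, so they lie in the image of ad a, as does the term in w. What remains both lies in that
image and commutes with a, hence vanishes. -/
theorem derivation_eq_of_commute [Algebra ℝ R] {D : R →+ R} (hD : ∀ x y, D (x * y) = D x * y + x * D y)
    {a Q c w y z : R} (ha : a * a * a = -a) (hDa : D a = 0)
    (hQ : commAdd a (commAdd a Q) = -Q) (hy : commAdd a (commAdd a y) = -y)
    (hc : commAdd a c = 0) (hz : commAdd a z = 0)
    (h : D c = commAdd Q c + commAdd a w + cubicDeriv a (y - z)) :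
    D c = -((3 : ℝ) • (a * a * z) + z) := by
  have hDc : commAdd a (D c) = 0 := by
    have := congrArg D hc
    rw [commAdd_apply, map_sub, hD, hD, hDa, map_zero] at this
    rw [commAdd_apply]
    simpa using this
  have h1 : commAdd a (commAdd a (commAdd Q c)) = -commAdd Q c := by
    rw [commAdd_apply Q c]
    simp only [map_sub, commAdd_mul_of_commute hc, commAdd_commute_mul hc, hQ]
    noncomm_ring
  have h2 : commAdd a (commAdd a (cubicDeriv a y)) = -cubicDeriv a y := by
    rw [commAdd_cubicDeriv, commAdd_cubicDeriv, hy]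
    simp only [cubicDeriv]; noncomm_ring
  have h3 : cubicDeriv a (y - z) = cubicDeriv a y - cubicDeriv a z := by
    simp only [cubicDeriv]; noncomm_ring
  have h4 : D c + cubicDeriv a z =
      commAdd a (w - commAdd a (commAdd Q c) - commAdd a (cubicDeriv a y)) := by
    rw [map_sub, map_sub, h1, h2, h, h3]; abel
  have h5 : commAdd a (D c + cubicDeriv a z) = 0 := by
    rw [map_add, hDc, commAdd_cubicDeriv, hz]; simp [cubicDeriv]
  rw [← cubicDeriv_of_commute hz, eq_neg_iff_add_eq_zero, h4]
  rw [h4] at h5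
  exact commAdd_eq_zero_of_sq ha h5

/-- In the Cauchy product, changes of order at least n reach order n only through the index pairs
(n, 0) and (0, n). -/
theorem PowerSeries.coeff_mul_sub_coeff_mul {F F' G G' : PowerSeries R} {n : ℕ}
    (hF : ∀ j < n, coeff j F = coeff j F') (hG : ∀ j < n, coeff j G = coeff j G') :
    coeff n (F * G) - coeff n (F' * G') =
      (coeff n F - coeff n F') * coeff 0 G + coeff 0 F' * (coeff n G - coeff n G') := by
  have key : ∀ p : ℕ × ℕ, coeff p.1 F * coeff p.2 G - coeff p.1 F' * coeff p.2 G' =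
      (coeff p.1 F - coeff p.1 F') * coeff p.2 G + coeff p.1 F' * (coeff p.2 G - coeff p.2 G') :=
    fun p => by noncomm_ring
  rw [coeff_mul, coeff_mul, ← Finset.sum_sub_distrib, Finset.sum_congr rfl fun p _ => key p,
    Finset.sum_add_distrib, Finset.sum_eq_single (n, 0), Finset.sum_eq_single (0, n)]
  · rintro ⟨i, j⟩ hij hne
    rw [Finset.HasAntidiagonal.mem_antidiagonal] at hij
    have : j < n := by
      rcases Nat.eq_zero_or_pos i with rfl | hi
      · exact absurd (by simpa using hij) (by simpa using hne)
      · dsimp only at hij; omega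
    simp [hG j this]
  · simp
  · rintro ⟨i, j⟩ hij hne
    rw [Finset.HasAntidiagonal.mem_antidiagonal] at hij
    have : i < n := by
      rcases Nat.eq_zero_or_pos j with rfl | hi
      · exact absurd (by simpa using hij) (by simpa using hne)
      · dsimp only at hij; omega
    simp [hF i this]
  · simp

/-- `F³ + F`. -/
def cubic (F : PowerSeries R) : PowerSeries R := F * F * F + F

/-- Changing a series at order n changes its cubic at order n only to first order, hence by the
linearization at the constant term a. -/
theorem coeff_cubic_sub {F G : PowerSeries R} {n : ℕ} {a : R} (hF0 : coeff 0 F = a)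
    (hG0 : coeff 0 G = a) (h : ∀ j < n, coeff j G = coeff j F) :
    coeff n (cubic G) - coeff n (cubic F) = cubicDeriv a (coeff n G - coeff n F) := by
  have h2 : ∀ j < n, coeff j (G * G) = coeff j (F * F) := fun j hj => by
    have := PowerSeries.coeff_mul_sub_coeff_mul (n := j) (fun i hi => h i (hi.trans hj))
      (fun i hi => h i (hi.trans hj))
    rw [h j hj, sub_self] at this
    simpa [sub_eq_zero] using this
  have e1 := PowerSeries.coeff_mul_sub_coeff_mul h h
  have e2 := PowerSeries.coeff_mul_sub_coeff_mul h2 h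
  have e3 : coeff 0 (F * F) = a * a := by
    rw [coeff_zero_eq_constantCoeff] at hF0 ⊢
    rw [map_mul, hF0]
  rw [e1, e3, hG0, hF0] at e2
  rw [cubic, cubic, map_add, map_add, cubicDeriv, add_sub_add_comm, e2]
  noncomm_ring

/-- The derivation `λ⁻¹ (D - ad Q) - ad a`, with `X = λ⁻¹`. -/
def resolventOp (D : R →+ R) (a Q : R) (F : PowerSeries R) : PowerSeries R :=
  X * (PowerSeries.mk (fun n => D (coeff n F)) - (C Q * F - F * C Q)) - (C a * F - F * C a)

theorem coeff_zero_resolventOp (D : R →+ R) (a Q : R) (F : PowerSeries R) :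
    coeff 0 (resolventOp D a Q F) = -commAdd a (coeff 0 F) := by
  simp [resolventOp, commAdd_apply]

theorem coeff_succ_resolventOp (D : R →+ R) (a Q : R) (F : PowerSeries R) (n : ℕ) :
    coeff (n + 1) (resolventOp D a Q F) =
      D (coeff n F) - commAdd Q (coeff n F) - commAdd a (coeff (n + 1) F) := by
  simp [resolventOp, commAdd_apply, coeff_succ_X_mul, coeff_C_mul, coeff_mul_C]

theorem resolventOp_add (D : R →+ R) (a Q : R) (F G : PowerSeries R) :
    resolventOp D a Q (F + G) = resolventOp D a Q F + resolventOp D a Q G := by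
  ext n
  cases n with
  | zero => simp only [map_add, coeff_zero_resolventOp]; abel
  | succ n => simp only [map_add, coeff_succ_resolventOp]; abel

/-- Coefficientwise D and the two commutators are derivations, and X is central. This is what lets
the linear equation pass from V to V³ + V. -/
theorem resolventOp_mul {D : R →+ R} (hD : ∀ x y, D (x * y) = D x * y + x * D y) (a Q : R)
    (F G : PowerSeries R) :
    resolventOp D a Q (F * G) = resolventOp D a Q F * G + F * resolventOp D a Q G := by
  have h1 : PowerSeries.mk (fun n => D (coeff n (F * G))) =
      PowerSeries.mk (fun n => D (coeff n F)) * G + F * PowerSeries.mk (fun n => D (coeff n G)) := by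
    ext n
    simp only [coeff_mk, coeff_mul, map_add, map_sum, hD, Finset.sum_add_distrib]
  have h2 : ∀ K, F * (X * K) = X * (F * K) := fun K => by
    rw [← mul_assoc, (commute_X F).eq, mul_assoc]
  simp only [resolventOp, h1, mul_sub, h2, sub_mul, mul_assoc, mul_add]
  abel

theorem resolventOp_cubic {D : R →+ R} (hD : ∀ x y, D (x * y) = D x * y + x * D y) (a Q : R)
    (F : PowerSeries R) :
    resolventOp D a Q (cubic F) = resolventOp D a Q F * (F * F) + F * resolventOp D a Q F * F +
      F * F * resolventOp D a Q F + resolventOp D a Q F := by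
  rw [cubic, resolventOp_add, resolventOp_mul hD, resolventOp_mul hD]
  noncomm_ring

theorem coeff_resolventOp_cubic {D : R →+ R} (hD : ∀ x y, D (x * y) = D x * y + x * D y)
    {a Q : R} {F : PowerSeries R} (hF0 : coeff 0 F = a) {n : ℕ}
    (h : ∀ j < n, coeff j (resolventOp D a Q F) = 0) :
    coeff n (resolventOp D a Q (cubic F)) = cubicDeriv a (coeff n (resolventOp D a Q F)) := by
  set P := resolventOp D a Q F with hP
  have hF0' : constantCoeff F = a := by simpa using hF0
  have hP0 : ∀ j < n, coeff j P = coeff j (0 : PowerSeries R) := by simpa using h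
  have e1 : coeff n (P * (F * F)) = coeff n P * (a * a) := by
    simpa [hF0'] using PowerSeries.coeff_mul_sub_coeff_mul hP0 (fun j _ => rfl (a := coeff j (F * F)))
  have e2 : ∀ m ≤ n, coeff m (F * P) = a * coeff m P := fun m hm => by
    simpa [hF0'] using PowerSeries.coeff_mul_sub_coeff_mul (n := m) (fun j _ => rfl (a := coeff j F))
      (fun j hj => hP0 j (hj.trans_le hm))
  have e3 : coeff n (F * P * F) = a * coeff n P * a := by
    have := PowerSeries.coeff_mul_sub_coeff_mul (F := F * P) (F' := 0) (n := n)
      (fun j hj => by rw [e2 j hj.le, h j hj]; simp) (fun j _ => rfl (a := coeff j F))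
    simpa [hF0', e2 n le_rfl] using this
  have e4 : coeff n (F * F * P) = a * a * coeff n P := by
    simpa [hF0'] using PowerSeries.coeff_mul_sub_coeff_mul (fun j _ => rfl (a := coeff j (F * F))) hP0
  rw [resolventOp_cubic hD, map_add, map_add, map_add, e1, e3, e4, cubicDeriv]
  noncomm_ring

/-- The inductive step of the construction of the formal solution `V`: the part of the next
coefficient which commutes with `a` is a local expression `h`, because of `V³ = -V`. -/
theorem exists_next_coeff [Algebra ℝ R] {D : R →+ R} (hD : ∀ x y, D (x * y) = D x * y + x * D y)
    (hDr : ∀ (r : ℝ) x, D (r • x) = r • D x)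
    (ev : R →+* R') {a Q y : R} (ha : a * a * a = -a) (hDa : D a = 0)
    (hQ : commAdd a (commAdd a Q) = -Q) {k : ℕ} {F : PowerSeries R} (hF0 : coeff 0 F = a)
    (hFk : ∀ j, k < j → coeff j F = 0)
    (hrec : ∀ j < k, D (coeff j F) - commAdd Q (coeff j F) = commAdd a (coeff (j + 1) F))
    (hcub : ∀ j ≤ k, coeff j (cubic F) = 0)
    (hev : ∀ j, 1 ≤ j → ev (coeff j F) = 0) (hevy : ev y = 0)
    (hDy : commAdd a (commAdd a (D y)) = -D y)
    (hay : commAdd a y = D (coeff k F) - commAdd Q (coeff k F))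
    (hz : commAdd a (commAdd Q y) = 0) :
    ∃ h : R, commAdd a h = 0 ∧ D h = commAdd Q y ∧ ev h = 0 ∧
      ∀ j ≤ k + 1, coeff j (cubic (F + monomial (k + 1) (y + h))) = 0 := by
  set Y : PowerSeries R := F + monomial (k + 1) y with hY
  have hYj : ∀ j, j ≠ k + 1 → coeff j Y = coeff j F := fun j hj => by
    simp [hY, coeff_monomial, hj]
  have hYk : coeff (k + 1) Y = y := by simp [hY, hFk]
  have hY0 : coeff 0 Y = a := by rw [hYj 0 (by omega), hF0]
  have hYcub : ∀ j ≤ k, coeff j (cubic Y) = 0 := fun j hj => by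
    have := coeff_cubic_sub (n := j) hF0 hY0 (fun i hi => hYj i (by omega))
    rw [hYj j (by omega), sub_self, hcub j hj, sub_zero] at this
    simpa [cubicDeriv] using this
  set c := coeff (k + 1) (cubic Y) with hc
  have hPY : ∀ j ≤ k + 1, coeff j (resolventOp D a Q Y) = 0 := by
    rintro (_ | j) hj
    · rw [coeff_zero_resolventOp, hY0, commAdd_apply]; simp
    · rw [coeff_succ_resolventOp, hYj j (by omega)]
      rcases (show j < k ∨ j = k by omega) with h | rfl
      · rw [hYj (j + 1) (by omega), hrec j h, sub_self]
      · rw [hYk, hay, sub_self]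
  -- The derivation is applied to the cubic of Y at order k + 1, where everything except the
  -- commutator of a with c vanishes.
  have hca : commAdd a c = 0 := by
    have h1 := coeff_resolventOp_cubic hD hY0 (n := k + 1) (fun j hj => hPY j hj.le)
    rw [coeff_succ_resolventOp, hYcub k le_rfl, hPY (k + 1) le_rfl] at h1
    simpa [cubicDeriv] using h1
  -- One order higher, the coefficient of the derivation on Y is its first defect D y - [Q, y]. The
  -- part of the resulting identity commuting with a is D c = -(3a² + 1)[Q, y].
  have hDc : D c = -((3 : ℝ) • (a * a * commAdd Q y) + commAdd Q y) := by
    have h1 := coeff_resolventOp_cubic hD hY0 (n := k + 2) (fun j hj => hPY j (by omega))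
    rw [coeff_succ_resolventOp, coeff_succ_resolventOp, hYk, hYj (k + 2) (by omega),
      hFk (k + 2) (by omega), map_zero, sub_zero, ← hc] at h1
    refine derivation_eq_of_commute hD ha hDa hQ hDy hca hz
      (w := coeff (k + 2) (cubic Y)) ?_
    rw [← h1]
    abel
  -- At the zero jet the series reduces to the constant a, whose cubic is a³ + a = 0. This is what
  -- produces the zero constant of integration.
  have hevc : ev c = 0 := by
    have h1 : PowerSeries.map ev Y = C (ev a) := by
      ext j
      rw [coeff_map, coeff_C]
      rcases Nat.eq_zero_or_pos j with rfl | hj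
      · simp [← hY0]
      · rw [if_neg hj.ne']
        by_cases h : j = k + 1
        · rw [h, hYk, hevy]
        · rw [hYj j h, hev j hj]
    have h2 : PowerSeries.map ev (cubic Y) = 0 := by
      rw [cubic, map_add, map_mul, map_mul, h1, ← map_mul, ← map_mul, ← map_add, ← map_mul,
        ← map_mul, ← map_add, ha]
      simp
    rw [hc, ← coeff_map, h2, map_zero]
  -- The witness solves (1 + 3a²)h = -c, the condition for the cubic to vanish at order k + 1. Since
  -- a⁴ = -a², the inverse of 1 + 3a² acting by left multiplication is 1 + (3/2)a². The same
  -- inversion turns the formula for D c into D h = [Q, y].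
  refine ⟨-(c + (3 / 2 : ℝ) • (a * a * c)), ?_, ?_, ?_, ?_⟩
  · have : commAdd a ((3 / 2 : ℝ) • (a * a * c)) = 0 := by
      have e : commAdd a (a * a * c) = 0 := by
        rw [mul_assoc, commAdd_self_mul, commAdd_self_mul, hca]; simp
      rw [commAdd_apply] at e ⊢
      rw [mul_smul_comm, smul_mul_assoc, ← smul_sub, e, smul_zero]
    rw [map_neg, map_add, hca, this]; simp
  · have e : D (a * a * c) = a * a * D c := by
      rw [hD, hD, hDa]; simp
    rw [map_neg, map_add, hDr, e, hDc]
    have := smul_cubicDeriv_eq (x := commAdd Q y) ha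
    rw [mul_neg, smul_neg, ← neg_add, neg_neg, this]
  · have e : ev ((3 / 2 : ℝ) • (a * a * c)) = 0 := by
      rw [← mul_smul_comm]
      have : (3 / 2 : ℝ) • c = algebraMap ℝ R (3 / 2) * c := Algebra.smul_def _ _
      rw [this, map_mul, map_mul ev (algebraMap ℝ R _), hevc]; simp
    rw [map_neg, map_add, hevc, e]; simp
  · set h := -(c + (3 / 2 : ℝ) • (a * a * c)) with hh
    have hha : commAdd a h = 0 := by
      have e : commAdd a (a * a * c) = 0 := by
        rw [mul_assoc, commAdd_self_mul, commAdd_self_mul, hca]; simp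
      have : commAdd a ((3 / 2 : ℝ) • (a * a * c)) = 0 := by
        rw [commAdd_apply] at e ⊢
        rw [mul_smul_comm, smul_mul_assoc, ← smul_sub, e, smul_zero]
      rw [hh, map_neg, map_add, hca, this]; simp
    have hG : F + monomial (k + 1) (y + h) = Y + monomial (k + 1) h := by
      rw [hY, map_add, add_assoc]
    have hGj : ∀ j, j ≠ k + 1 → coeff j (Y + monomial (k + 1) h) = coeff j Y := fun j hj => by
      simp [coeff_monomial, hj]
    rw [hG]
    intro j hj
    have h1 := coeff_cubic_sub (n := j) hY0 (G := Y + monomial (k + 1) h)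
      (by rw [hGj 0 (by omega), hY0]) (fun i hi => hGj i (by omega))
    rcases (show j ≤ k ∨ j = k + 1 by omega) with h2 | rfl
    · rw [hGj j (by omega), hYcub j h2, sub_self, sub_zero] at h1
      simpa [cubicDeriv] using h1
    · have h3 : coeff (k + 1) (Y + monomial (k + 1) h) - coeff (k + 1) Y = h := by simp
      rw [h3, cubicDeriv_of_commute hha, ← hc, sub_eq_iff_eq_add] at h1
      have h4 := smul_cubicDeriv_eq (x := c) ha
      have h5 : (3 : ℝ) • (a * a * h) + h = -c := by
        rw [hh]
        conv_rhs => rw [← h4]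
        simp only [mul_neg, mul_add, mul_smul_comm]
        module
      rw [h1, h5, neg_add_cancel]

end FormalResolvent

/-! ### The algebra of differential functions -/

section DiffAlgebra

variable (M E : Type*) [NormedAddCommGroup M] [NormedSpace ℝ M] [NormedRing E] [NormedAlgebra ℝ E]

/-- The algebra of differential functions with values in `E`. -/
def diffAlg : Subalgebra ℝ ((ℕ → M) → E) where
  carrier := {F | IsDiffFun F}
  mul_mem' hF hG := IsDiffFun.mul hF hG
  add_mem' hF hG := IsDiffFun.add hF hG
  algebraMap_mem' r := IsDiffFun.const (algebraMap ℝ E r)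

/-- The total derivative on the algebra of differential functions. -/
def diffAlgD : diffAlg M E →+ diffAlg M E where
  toFun F := ⟨totalD F.1, IsDiffFun.isDiffFun_totalD F.2⟩
  map_zero' := Subtype.ext (totalD_const (0 : E))
  map_add' F G := Subtype.ext (totalD_add F.2 G.2)

/-- Evaluation at the zero jet. -/
def diffAlgEv : diffAlg M E →+* E where
  toFun F := F.1 0
  map_zero' := rfl
  map_one' := rfl
  map_add' _ _ := rfl
  map_mul' _ _ := rfl

theorem diffAlgD_mul (F G : diffAlg M E) :
    diffAlgD M E (F * G) = diffAlgD M E F * G + F * diffAlgD M E G :=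
  Subtype.ext (totalD_mul F.2 G.2)

theorem diffAlgD_smul (r : ℝ) (F : diffAlg M E) :
    diffAlgD M E (r • F) = r • diffAlgD M E F :=
  Subtype.ext (totalD_smul F.2 r)

variable {M E}

/-- A linear projection onto K fixes F, and total derivatives commute with linear maps. -/
theorem totalD_mem [FiniteDimensional ℝ E] {F : (ℕ → M) → E} (hF : IsDiffFun F)
    {K : Submodule ℝ E} (h : ∀ u, F u ∈ K) (u : ℕ → M) : totalD F u ∈ K := by
  obtain ⟨p, hp⟩ := K.subtype.exists_leftInverse_of_injective K.ker_subtype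
  have hp' : ∀ x (hx : x ∈ K), (p x : E) = x := fun x hx => by
    have := LinearMap.congr_fun hp ⟨x, hx⟩
    exact congrArg Subtype.val this
  have h1 := totalD_clm hF (LinearMap.toContinuousLinearMap (K.subtype ∘ₗ p))
  have h2 : (fun u => (LinearMap.toContinuousLinearMap (K.subtype ∘ₗ p)) (F u)) = F :=
    funext fun u => hp' _ (h u)
  rw [h2] at h1
  rw [h1]
  exact (p (totalD F u)).2

theorem IsDiffFun.eq_of_totalD_eq [CompleteSpace M] {W : Type*} [NormedAddCommGroup W]
    [NormedSpace ℝ W] {F G : (ℕ → M) → W}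
    (hF : IsDiffFun F) (hG : IsDiffFun G) (h : totalD F = totalD G) (h0 : F 0 = G 0) : F = G := by
  funext u
  have := (hF.sub hG).eq_of_totalD_eq_zero (by rw [totalD_sub hF hG, h]; funext u; simp) u
  rw [h0, sub_self] at this
  exact sub_eq_zero.1 this

/-- F and its projection to K have the same total derivative and the same value at the zero jet, so
they agree. -/
theorem IsDiffFun.mem_of_totalD_mem [CompleteSpace M] [FiniteDimensional ℝ E]
    {F : (ℕ → M) → E} (hF : IsDiffFun F)
    {K : Submodule ℝ E} (h : ∀ u, totalD F u ∈ K) (h0 : F 0 ∈ K) (u : ℕ → M) : F u ∈ K := by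
  obtain ⟨p, hp⟩ := K.subtype.exists_leftInverse_of_injective K.ker_subtype
  have hp' : ∀ x (hx : x ∈ K), (p x : E) = x := fun x hx => by
    have := LinearMap.congr_fun hp ⟨x, hx⟩
    exact congrArg Subtype.val this
  set L := LinearMap.toContinuousLinearMap (K.subtype ∘ₗ p)
  have h1 : (fun u => L (F u)) = F := by
    refine (hF.clm L).eq_of_totalD_eq hF ?_ (hp' _ h0)
    rw [totalD_clm hF L]
    exact funext fun u => hp' _ (h u)
  rw [← h1]
  exact (p (F u)).2

end DiffAlgebra

namespace HermitianSymmetric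

variable {𝔸 : Type*} [NormedRing 𝔸] [NormedAlgebra ℝ 𝔸] (S : HermitianSymmetric 𝔸)

/-! ### Algebra of the symmetric Lie algebra -/

variable {S} in
theorem mem_𝔤_of_mem_𝔥 {X : 𝔸} (hX : X ∈ S.𝔥) : X ∈ S.𝔤 := by
  have h : X ∈ S.𝔤.toSubmodule := S.sup_eq ▸ Submodule.mem_sup_left hX
  exact h

variable {S} in
theorem mem_𝔤_of_mem_𝔪 {X : 𝔸} (hX : X ∈ S.𝔪) : X ∈ S.𝔤 := by
  have h : X ∈ S.𝔤.toSubmodule := S.sup_eq ▸ Submodule.mem_sup_right hX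
  exact h

variable {S} in
theorem exists_add_eq {X : 𝔸} (hX : X ∈ S.𝔤) : ∃ Y ∈ S.𝔥, ∃ Z ∈ S.𝔪, Y + Z = X := by
  have h : X ∈ S.𝔤.toSubmodule := hX
  rw [← S.sup_eq] at h
  exact Submodule.mem_sup.1 h

variable {S} in
theorem lie_A_of_mem_𝔥 {X : 𝔸} (hX : X ∈ S.𝔥) : ⁅S.A, X⁆ = 0 :=
  (S.centralizer_A X (mem_𝔤_of_mem_𝔥 hX)).2 hX

variable {S} in
theorem lie_A_mem_𝔪 {X : 𝔸} (hX : X ∈ S.𝔪) : ⁅S.A, X⁆ ∈ S.𝔪 := S.lie_𝔥_𝔪 _ S.A_mem _ hX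

variable {S} in
theorem lie_𝔪_𝔥 {X Y : 𝔸} (hX : X ∈ S.𝔪) (hY : Y ∈ S.𝔥) : ⁅X, Y⁆ ∈ S.𝔪 := by
  rw [← lie_skew]; exact S.𝔪.neg_mem (S.lie_𝔥_𝔪 _ hY _ hX)

variable {S} in
theorem mem_𝔪_of_ad_A_sq {X : 𝔸} (hX : X ∈ S.𝔤) (h : ⁅S.A, ⁅S.A, X⁆⁆ = -X) : X ∈ S.𝔪 := by
  obtain ⟨Y, hY, Z, hZ, rfl⟩ := exists_add_eq hX
  rw [lie_add, lie_A_of_mem_𝔥 hY, zero_add, S.ad_A_sq Z hZ] at h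
  have : Y = 0 := by simpa using h
  rw [this, zero_add]
  exact hZ

variable {S} in
-- The bracket of X and Y lies in 𝔥 and is therefore killed by ad A; the Leibniz rule makes J skew
-- with respect to the bracket on 𝔪.
theorem lie_lie_A_eq_neg {X Y : 𝔸} (hX : X ∈ S.𝔪) (hY : Y ∈ S.𝔪) :
    ⁅X, ⁅S.A, Y⁆⁆ = -⁅⁅S.A, X⁆, Y⁆ := by
  have h := lie_A_of_mem_𝔥 (S.lie_𝔪_𝔪 X hX Y hY)
  rw [leibniz_lie] at h
  exact eq_neg_of_add_eq_zero_right h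

variable {S} in
theorem ad_A_cube {X : 𝔸} (hX : X ∈ S.𝔤) : ⁅S.A, ⁅S.A, ⁅S.A, X⁆⁆⁆ = -⁅S.A, X⁆ := by
  obtain ⟨Y, hY, Z, hZ, rfl⟩ := exists_add_eq hX
  rw [lie_add, lie_A_of_mem_𝔥 hY, zero_add, S.ad_A_sq Z hZ, lie_neg]

theorem lie_eq_zero_of_mem {X : 𝔸} (hX : X ∈ S.𝔤) (h : ∀ Y ∈ S.𝔤, ⁅X, Y⁆ = 0) : X = 0 := by
  have := S.isSemisimple
  have h1 : (⟨X, hX⟩ : S.𝔤) ∈ LieAlgebra.center ℝ S.𝔤 := by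
    rw [LieModule.mem_maxTrivSubmodule]
    intro Y
    rw [← lie_skew, neg_eq_zero]
    exact Subtype.ext (h Y Y.2)
  rw [LieAlgebra.center_eq_bot] at h1
  exact congrArg Subtype.val ((LieSubmodule.mem_bot _).1 h1)

/-! ### The adjoint representation: faithfulness and the cubic identity for A -/

section Finite

variable [FiniteDimensional ℝ 𝔸]

theorem exists_proj : ∃ p : 𝔸 →L[ℝ] S.𝔤, ∀ X : S.𝔤, p X = X := by
  obtain ⟨p, hp⟩ := (S.𝔤.incl : S.𝔤 →ₗ[ℝ] 𝔸).exists_leftInverse_of_injective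
    (LinearMap.ker_eq_bot.2 Subtype.val_injective)
  exact ⟨LinearMap.toContinuousLinearMap p, fun X => LinearMap.congr_fun hp X⟩

/-- A projection of `𝔸` onto `𝔤`. -/
def proj : 𝔸 →L[ℝ] S.𝔤 := S.exists_proj.choose

theorem proj_coe (X : S.𝔤) : S.proj X = X := S.exists_proj.choose_spec X

theorem coe_proj {X : 𝔸} (hX : X ∈ S.𝔤) : (S.proj X : 𝔸) = X := by
  have := S.proj_coe ⟨X, hX⟩
  exact congrArg Subtype.val this

/-- The adjoint representation, extended to a linear map on `𝔸`. -/
def adRepLinear : 𝔸 →ₗ[ℝ] (S.𝔤 →L[ℝ] S.𝔤) where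
  toFun X := LinearMap.toContinuousLinearMap
    (S.proj.toLinearMap ∘ₗ (LinearMap.mulLeft ℝ X - LinearMap.mulRight ℝ X) ∘ₗ
      (S.𝔤.incl : S.𝔤 →ₗ[ℝ] 𝔸))
  map_add' X X' := by
    ext Y
    simp [add_mul, mul_add, sub_eq_add_neg]
    abel
  map_smul' r X := by
    ext Y
    simp [smul_sub]

/-- The adjoint representation, extended to a continuous linear map on `𝔸`. -/
def adRep : 𝔸 →L[ℝ] (S.𝔤 →L[ℝ] S.𝔤) :=
  ⟨S.adRepLinear, LinearMap.continuous_of_finiteDimensional _⟩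

theorem coe_adRep {X : 𝔸} (hX : X ∈ S.𝔤) (Y : S.𝔤) : (S.adRep X Y : 𝔸) = ⁅X, (Y : 𝔸)⁆ :=
  S.coe_proj (S.𝔤.lie_mem hX Y.2)

theorem adRep_lie {X X' : 𝔸} (hX : X ∈ S.𝔤) (hX' : X' ∈ S.𝔤) :
    S.adRep ⁅X, X'⁆ = S.adRep X * S.adRep X' - S.adRep X' * S.adRep X := by
  ext Y
  have h1 : ((S.adRep X * S.adRep X' - S.adRep X' * S.adRep X) Y : 𝔸) =
      (S.adRep X (S.adRep X' Y) : 𝔸) - S.adRep X' (S.adRep X Y) := rfl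
  simp only [h1, S.coe_adRep (S.𝔤.lie_mem hX hX'), S.coe_adRep hX, S.coe_adRep hX', lie_lie]

/-- Semisimplicity gives 𝔤 trivial center, so ad is injective. The left inverse transports
primitives found among operator-valued functions back to 𝔸. -/
theorem exists_adRep_inv : ∃ L : (S.𝔤 →L[ℝ] S.𝔤) →L[ℝ] 𝔸, ∀ X ∈ S.𝔤, L (S.adRep X) = X := by
  obtain ⟨p, hp⟩ := (S.adRepLinear ∘ₗ (S.𝔤.incl : S.𝔤 →ₗ[ℝ] 𝔸)).exists_leftInverse_of_injective (by
    rw [LinearMap.ker_eq_bot']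
    rintro ⟨X, hX⟩ h
    refine Subtype.ext (S.lie_eq_zero_of_mem hX fun Y hY => ?_)
    rw [← S.coe_adRep hX ⟨Y, hY⟩]
    have : S.adRep X = 0 := h
    rw [this]
    rfl)
  refine ⟨LinearMap.toContinuousLinearMap ((S.𝔤.incl : S.𝔤 →ₗ[ℝ] 𝔸) ∘ₗ p), fun X hX => ?_⟩
  exact congrArg Subtype.val (LinearMap.congr_fun hp ⟨X, hX⟩)

/-- The construction takes place in the adjoint representation for the sake of this identity;
nothing similar is assumed of A as an element of 𝔸. -/
theorem adRep_A_cube : S.adRep S.A * S.adRep S.A * S.adRep S.A = -S.adRep S.A := by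
  ext Y
  have h1 : ((S.adRep S.A * S.adRep S.A * S.adRep S.A) Y : 𝔸) =
      (S.adRep S.A (S.adRep S.A (S.adRep S.A Y)) : 𝔸) := rfl
  have h2 : ((-S.adRep S.A) Y : 𝔸) = -(S.adRep S.A Y : 𝔸) := rfl
  rw [h1, h2]
  simp only [S.coe_adRep S.A_mem_𝔤]
  exact ad_A_cube Y.2

end Finite

/-! ### Differential functions transported by a representation -/

section Representation

variable {E : Type*} [NormedRing E] [NormedAlgebra ℝ E]

/-- A linear map applied to differential functions. -/
def mapDiff (ρ : 𝔸 →L[ℝ] E) {F : S.Jet → 𝔸} (hF : IsDiffFun F) : diffAlg S.𝔪 E :=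
  ⟨fun u => ρ (F u), hF.clm ρ⟩

theorem diffAlgD_mapDiff (ρ : 𝔸 →L[ℝ] E) {F : S.Jet → 𝔸} (hF : IsDiffFun F) :
    diffAlgD S.𝔪 E (S.mapDiff ρ hF) = S.mapDiff ρ hF.isDiffFun_totalD :=
  Subtype.ext (totalD_clm hF ρ)

theorem commAdd_mapDiff {ρ : 𝔸 →L[ℝ] E}
    (hρ : ∀ X ∈ S.𝔤, ∀ Y ∈ S.𝔤, ρ ⁅X, Y⁆ = ρ X * ρ Y - ρ Y * ρ X)
    {F G : S.Jet → 𝔸} (hF : IsDiffFun F) (hG : IsDiffFun G)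
    (hFg : ∀ u, F u ∈ S.𝔤) (hGg : ∀ u, G u ∈ S.𝔤) :
    commAdd (S.mapDiff ρ hF) (S.mapDiff ρ hG) = S.mapDiff ρ (hF.lie hG) :=
  Subtype.ext (funext fun u => (hρ _ (hFg u) _ (hGg u)).symm)

end Representation

end HermitianSymmetric

namespace HermitianSymmetric

variable {𝔸 : Type*} [NormedRing 𝔸] [NormedAlgebra ℝ 𝔸] (S : HermitianSymmetric 𝔸)

/-! ### Primitives -/

variable {S} in
theorem IsPrimitive.unique [FiniteDimensional ℝ 𝔸] {p p' f : S.Jet → 𝔸} (h : S.IsPrimitive p f) (h' : S.IsPrimitive p' f) :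
    p = p' :=
  IsDiffFun.eq_of_totalD_eq h.1 h'.1 (h.2.1.trans h'.2.1.symm) (h.2.2.trans h'.2.2.symm)

variable {S} in
theorem IsPrimitive.dinv_eq [FiniteDimensional ℝ 𝔸] {p f : S.Jet → 𝔸} (h : S.IsPrimitive p f) : S.Dinv f = p := by
  have hex : ∃ p, S.IsPrimitive p f := ⟨p, h⟩
  rw [Dinv, dif_pos hex]
  exact hex.choose_spec.unique h

theorem isDiffFun_var : IsDiffFun S.var := (IsDiffFun.of_apply 0).clm S.𝔪.subtypeL

theorem var_mem (u : S.Jet) : S.var u ∈ S.𝔪 := (u 0).2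

/-- The `𝔪`-part `(ℛ*)ᵏ(u)` of the `k`-th coefficient of the formal solution. -/
def coeffM (k : ℕ) : S.Jet → 𝔸 := S.RopAdj^[k] S.var

/-- The `𝔥`-part of the `k`-th coefficient of the formal solution. -/
def coeffH (k : ℕ) : S.Jet → 𝔸 := S.Dinv (S.adVar (S.coeffM k))

/-- The properties of the `k`-th coefficient of the formal solution. -/
structure IsGoodCoeff (k : ℕ) : Prop where
  diffM : IsDiffFun (S.coeffM k)
  memM : ∀ u, S.coeffM k u ∈ S.𝔪
  zeroM : S.coeffM k 0 = 0
  primitive : S.IsPrimitive (S.coeffH k) (S.adVar (S.coeffM k))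
  memH : ∀ u, S.coeffH k u ∈ S.𝔥

theorem coeffM_succ (k : ℕ) : S.coeffM (k + 1) = S.RopAdj (S.coeffM k) :=
  Function.iterate_succ_apply' _ _ _

theorem hop_coeffM_apply (k : ℕ) (u : S.Jet) :
    S.Hop (S.coeffM k) u = totalD (S.coeffM k) u - ⁅(u 0 : 𝔸), S.coeffH k u⁆ := rfl

variable {S}

theorem IsGoodCoeff.diffH {k : ℕ} (h : S.IsGoodCoeff k) : IsDiffFun (S.coeffH k) := h.primitive.1

theorem IsGoodCoeff.totalD_coeffH {k : ℕ} (h : S.IsGoodCoeff k) (u : S.Jet) :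
    totalD (S.coeffH k) u = ⁅(u 0 : 𝔸), S.coeffM k u⁆ := congrFun h.primitive.2.1 u

theorem IsGoodCoeff.zeroH {k : ℕ} (h : S.IsGoodCoeff k) : S.coeffH k 0 = 0 := h.primitive.2.2

theorem totalD_zero_jet {M W : Type*} [NormedAddCommGroup M] [NormedSpace ℝ M]
    [NormedAddCommGroup W] [NormedSpace ℝ W] (F : (ℕ → M) → W) : totalD F 0 = 0 := by
  simp [totalD]

theorem IsGoodCoeff.isDiffFun_hop {k : ℕ} (h : S.IsGoodCoeff k) : IsDiffFun (S.Hop (S.coeffM k)) :=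
  h.diffM.isDiffFun_totalD.sub ((S.isDiffFun_var).lie h.diffH)

variable [FiniteDimensional ℝ 𝔸]

theorem IsGoodCoeff.hop_mem {k : ℕ} (h : S.IsGoodCoeff k) (u : S.Jet) :
    S.Hop (S.coeffM k) u ∈ S.𝔪 :=
  S.𝔪.sub_mem (totalD_mem h.diffM h.memM u) (lie_𝔪_𝔥 (u 0).2 (h.memH u))

/-- This is the 𝔪-component of D V = [λA + u, V] at one power of λ; it uses J J⁻¹ = 1, valid because
ℋ maps this coefficient into 𝔪. -/
theorem IsGoodCoeff.lie_A_coeffM_succ {k : ℕ} (h : S.IsGoodCoeff k) (u : S.Jet) :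
    ⁅S.A, S.coeffM (k + 1) u⁆ = S.Hop (S.coeffM k) u := by
  rw [coeffM_succ, RopAdj, Jinv, lie_neg, S.ad_A_sq _ (h.hop_mem u), neg_neg]

theorem IsGoodCoeff.coeffM_succ_props {k : ℕ} (h : S.IsGoodCoeff k) :
    IsDiffFun (S.coeffM (k + 1)) ∧ (∀ u, S.coeffM (k + 1) u ∈ S.𝔪) ∧ S.coeffM (k + 1) 0 = 0 := by
  rw [coeffM_succ]
  refine ⟨((IsDiffFun.const S.A).lie h.isDiffFun_hop).neg,
    fun u => S.𝔪.neg_mem (lie_A_mem_𝔪 (h.hop_mem u)), ?_⟩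
  rw [RopAdj, Jinv, hop_coeffM_apply, totalD_zero_jet, h.zeroH]
  simp

variable (S)

theorem coeffM_props_of_forall_lt {k : ℕ} (h : ∀ i < k, S.IsGoodCoeff i) :
    IsDiffFun (S.coeffM k) ∧ (∀ u, S.coeffM k u ∈ S.𝔪) ∧ S.coeffM k 0 = 0 := by
  cases k with
  | zero => exact ⟨S.isDiffFun_var, S.var_mem, rfl⟩
  | succ k => exact (h k (by omega)).coeffM_succ_props

open PowerSeries in
-- Regularity of the first k coefficients must be proved together with the truncated series F, since
-- the cubic identity for F is what yields the next primitive. Indices are shifted by one: the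
-- constant term of F is A, and index i + 1 holds the i-th coefficient.
theorem isGoodCoeff_induction {E : Type*} [NormedRing E] [NormedAlgebra ℝ E]
    {ρ : 𝔸 →L[ℝ] E} {L : E →L[ℝ] 𝔸} (hL : ∀ X ∈ S.𝔤, L (ρ X) = X)
    (hρ : ∀ X ∈ S.𝔤, ∀ Y ∈ S.𝔤, ρ ⁅X, Y⁆ = ρ X * ρ Y - ρ Y * ρ X)
    (hA : ρ S.A * ρ S.A * ρ S.A = -ρ S.A) (k : ℕ) :
    ∃ hg : ∀ i < k, S.IsGoodCoeff i, ∃ F : PowerSeries (diffAlg S.𝔪 E),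
      coeff 0 F = S.mapDiff ρ (IsDiffFun.const S.A) ∧ (∀ j, k < j → coeff j F = 0) ∧
      (∀ i (hi : i < k),
        coeff (i + 1) F = S.mapDiff ρ ((hg i hi).diffM.add (hg i hi).diffH)) ∧
      ∀ j ≤ k, coeff j (cubic F) = 0 := by
  set a := S.mapDiff ρ (IsDiffFun.const S.A) with ha_def
  have ha : a * a * a = -a := Subtype.ext (funext fun _ => hA)
  have hAg : ∀ u : S.Jet, (fun _ : S.Jet => S.A) u ∈ S.𝔤 := fun _ => S.A_mem_𝔤
  have hDa : diffAlgD S.𝔪 E a = 0 := Subtype.ext (totalD_const (ρ S.A))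
  have hodd : ∀ {G : S.Jet → 𝔸} (hG : IsDiffFun G), (∀ u, G u ∈ S.𝔪) →
      commAdd a (commAdd a (S.mapDiff ρ hG)) = -S.mapDiff ρ hG := fun {G} hG hm => by
    rw [ha_def, S.commAdd_mapDiff hρ _ _ hAg (fun u => mem_𝔤_of_mem_𝔪 (hm u)),
      S.commAdd_mapDiff hρ _ _ hAg (fun u => mem_𝔤_of_mem_𝔪 (lie_A_mem_𝔪 (hm u)))]
    refine Subtype.ext (funext fun u => ?_)
    have : ρ ⁅S.A, ⁅S.A, G u⁆⁆ = -ρ (G u) := by rw [S.ad_A_sq _ (hm u), map_neg]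
    exact this
  set Q := S.mapDiff ρ S.isDiffFun_var with hQ_def
  have hQ : commAdd a (commAdd a Q) = -Q := hodd _ S.var_mem
  induction k with
  | zero =>
    refine ⟨fun i hi => absurd hi (by omega), C a, by simp, fun j hj => ?_,
      fun i hi => absurd hi (by omega), fun j _ => ?_⟩
    · rw [coeff_C, if_neg (by omega)]
    · rw [cubic, ← map_mul, ← map_mul, ← map_add, ha]
      simp
  | succ k ih =>
    obtain ⟨hg, F, hF0, hFk, hFi, hcub⟩ := ih
    obtain ⟨hd, hm, h0⟩ := S.coeffM_props_of_forall_lt hg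
    have hvar : ∀ u, S.var u ∈ S.𝔤 := fun u => mem_𝔤_of_mem_𝔪 (S.var_mem u)
    have hz' : ∀ u, ⁅S.var u, S.coeffM k u⁆ ∈ S.𝔥 := fun u => S.lie_𝔪_𝔪 _ (S.var_mem u) _ (hm u)
    have hz : commAdd Q (S.mapDiff ρ hd) = S.mapDiff ρ (S.isDiffFun_var.lie hd) :=
      S.commAdd_mapDiff hρ _ _ hvar fun u => mem_𝔤_of_mem_𝔪 (hm u)
    have hrec : ∀ i (hi : i < k),
        diffAlgD S.𝔪 E (coeff (i + 1) F) - commAdd Q (coeff (i + 1) F) =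
          commAdd a (S.mapDiff ρ (S.coeffM_props_of_forall_lt (k := i + 1)
            fun j hj => hg j (by omega)).1) := by
      intro i hi
      have hgi := hg i hi
      rw [hFi i hi, diffAlgD_mapDiff, hQ_def, S.commAdd_mapDiff hρ _ _ hvar (fun u => S.𝔤.add_mem
          (mem_𝔤_of_mem_𝔪 (hgi.memM u)) (mem_𝔤_of_mem_𝔥 (hgi.memH u))), ha_def,
        S.commAdd_mapDiff hρ _ _ hAg (fun u => mem_𝔤_of_mem_𝔪 (hgi.coeffM_succ_props.2.1 u))]
      refine Subtype.ext (funext fun u => ?_)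
      have e1 : totalD (fun u => S.coeffM i u + S.coeffH i u) u =
          totalD (S.coeffM i) u + ⁅(u 0 : 𝔸), S.coeffM i u⁆ := by
        rw [totalD_add hgi.diffM hgi.diffH]
        exact congrArg (totalD (S.coeffM i) u + ·) (hgi.totalD_coeffH u)
      have e2 : ρ (totalD (fun u => S.coeffM i u + S.coeffH i u) u) -
          ρ ⁅(u 0 : 𝔸), S.coeffM i u + S.coeffH i u⁆ = ρ ⁅S.A, S.coeffM (i + 1) u⁆ := by
        rw [e1, hgi.lie_A_coeffM_succ, hop_coeffM_apply, ← map_sub, lie_add]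
        congr 1
        abel
      exact e2
    -- The 𝔪-part y of the new coefficient is already known from the recursion. The 𝔥-parts of the
    -- coefficients commute with A and so drop out of the recursion that has to be supplied here.
    obtain ⟨h, hha, hDh, hevh, hcub'⟩ := exists_next_coeff (diffAlgD_mul S.𝔪 E)
      (diffAlgD_smul S.𝔪 E) (diffAlgEv S.𝔪 E) (y := S.mapDiff ρ hd) ha hDa hQ hF0 hFk
      (by
        rintro (_ | j) hj
        · rw [hF0, hDa, hFi 0 hj, zero_sub]
          have e : S.mapDiff ρ ((hg 0 hj).diffM.add (hg 0 hj).diffH) =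
              Q + S.mapDiff ρ (hg 0 hj).diffH :=
            Subtype.ext (funext fun u => map_add ρ (S.coeffM 0 u) (S.coeffH 0 u))
          rw [e, map_add, ha_def, S.commAdd_mapDiff hρ _ (hg 0 hj).diffH hAg
            (fun u => mem_𝔤_of_mem_𝔥 ((hg 0 hj).memH u))]
          have e2 : S.mapDiff ρ ((IsDiffFun.const S.A).lie (hg 0 hj).diffH) = 0 := by
            refine Subtype.ext (funext fun u => ?_)
            have : ρ ⁅S.A, S.coeffH 0 u⁆ = 0 := by
              rw [lie_A_of_mem_𝔥 ((hg 0 hj).memH u), map_zero]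
            exact this
          rw [e2, add_zero]
          simp only [commAdd_apply, neg_sub]
        · rw [hrec j (by omega), hFi (j + 1) hj]
          have e : S.mapDiff ρ ((hg (j + 1) hj).diffM.add (hg (j + 1) hj).diffH) =
              S.mapDiff ρ (hg (j + 1) hj).diffM + S.mapDiff ρ (hg (j + 1) hj).diffH :=
            Subtype.ext (funext fun u => map_add ρ (S.coeffM (j + 1) u) (S.coeffH (j + 1) u))
          rw [e, map_add, ha_def, S.commAdd_mapDiff hρ _ (hg (j + 1) hj).diffH hAg
            (fun u => mem_𝔤_of_mem_𝔥 ((hg (j + 1) hj).memH u))]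
          have e2 : S.mapDiff ρ ((IsDiffFun.const S.A).lie (hg (j + 1) hj).diffH) = 0 := by
            refine Subtype.ext (funext fun u => ?_)
            have : ρ ⁅S.A, S.coeffH (j + 1) u⁆ = 0 := by
              rw [lie_A_of_mem_𝔥 ((hg (j + 1) hj).memH u), map_zero]
            exact this
          rw [e2, add_zero])
      hcub
      (by
        intro j hj
        rcases le_or_gt j k with h | h
        · obtain ⟨i, rfl⟩ : ∃ i, j = i + 1 := ⟨j - 1, by omega⟩
          rw [hFi i h]
          have : ρ (S.coeffM i 0 + S.coeffH i 0) = 0 := by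
            rw [(hg i h).zeroM, (hg i h).zeroH, add_zero, map_zero]
          exact this
        · rw [hFk j h, map_zero])
      (by
        have : ρ (S.coeffM k 0) = 0 := by rw [h0, map_zero]
        exact this)
      (by rw [diffAlgD_mapDiff]; exact hodd _ (totalD_mem hd hm))
      (by
        rcases k with _ | k
        · rw [hF0, hDa, zero_sub]
          have : S.mapDiff ρ hd = Q := rfl
          rw [this]
          simp only [commAdd_apply, neg_sub]
        · rw [hrec k (by omega)])
      (by
        rw [hz, ha_def, S.commAdd_mapDiff hρ _ _ hAg (fun u => mem_𝔤_of_mem_𝔥 (hz' u))]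
        refine Subtype.ext (funext fun u => ?_)
        have : ρ ⁅S.A, ⁅S.var u, S.coeffM k u⁆⁆ = 0 := by
          rw [lie_A_of_mem_𝔥 (hz' u), map_zero]
        exact this)
    -- A priori h is only operator-valued, not known to lie in the image of ρ; its image under L is
    -- nevertheless a primitive in 𝔸.
    have hprim : S.IsPrimitive (fun u => L (h.1 u)) (S.adVar (S.coeffM k)) := by
      refine ⟨IsDiffFun.clm h.2 L, ?_, ?_⟩
      · have e1 : S.D (fun u => L (h.1 u)) = fun u => L (totalD h.1 u) := totalD_clm h.2 L
        have e2 : totalD h.1 = fun u => ρ ⁅S.var u, S.coeffM k u⁆ :=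
          congrArg Subtype.val (hDh.trans hz)
        rw [e1, e2]
        exact funext fun u => hL _ (mem_𝔤_of_mem_𝔥 (hz' u))
      · have e : h.1 0 = 0 := hevh
        exact (congrArg L e).trans (map_zero L)
    have hprim' : S.IsPrimitive (S.coeffH k) (S.adVar (S.coeffM k)) := by
      rw [coeffH, hprim.dinv_eq]; exact hprim
    have hgk : S.IsGoodCoeff k := by
      refine ⟨hd, hm, h0, hprim', IsDiffFun.mem_of_totalD_mem hprim'.1 (fun u => ?_) ?_⟩
      · have := congrFun hprim'.2.1 u
        have e : totalD (S.coeffH k) u = S.adVar (S.coeffM k) u := this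
        rw [e]
        exact hz' u
      · rw [hprim'.2.2]; exact S.𝔥.zero_mem
    -- Uniqueness of primitives with zero constant now shows that h does come from the Lie algebra,
    -- so the series keeps the form required by the induction.
    have hh : h = S.mapDiff ρ hgk.diffH := by
      refine Subtype.ext (IsDiffFun.eq_of_totalD_eq h.2 (hgk.diffH.clm ρ) ?_ ?_)
      · have e2 : totalD h.1 = fun u => ρ ⁅S.var u, S.coeffM k u⁆ :=
          congrArg Subtype.val (hDh.trans hz)
        rw [e2]
        refine Eq.trans ?_ (totalD_clm hgk.diffH ρ).symm
        exact funext fun u => congrArg ρ (hgk.totalD_coeffH u).symm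
      · have e : h.1 0 = 0 := hevh
        rw [e]
        exact ((congrArg ρ hgk.zeroH).trans (map_zero ρ)).symm
    have hg' : ∀ i < k + 1, S.IsGoodCoeff i := fun i hi => by
      rcases (show i < k ∨ i = k by omega) with h1 | rfl
      · exact hg i h1
      · exact hgk
    refine ⟨hg', F + monomial (k + 1) (S.mapDiff ρ hd + h), ?_, fun j hj => ?_, fun i hi => ?_,
      hcub'⟩
    · rw [map_add, hF0, coeff_monomial, if_neg (by omega), add_zero]
    · rw [map_add, hFk j (by omega), coeff_monomial, if_neg (by omega), add_zero]
    · rcases (show i < k ∨ i = k by omega) with h1 | rfl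
      · rw [map_add, hFi i h1, coeff_monomial, if_neg (by omega), add_zero]
      · rw [map_add, hFk (i + 1) (by omega), coeff_monomial, if_pos rfl, zero_add, hh]
        exact Subtype.ext (funext fun u => (map_add ρ (S.coeffM i u) (S.coeffH i u)).symm)

theorem isGoodCoeff (k : ℕ) : S.IsGoodCoeff k := by
  obtain ⟨L, hL⟩ := S.exists_adRep_inv
  obtain ⟨h, -⟩ := S.isGoodCoeff_induction (E := S.𝔤 →L[ℝ] S.𝔤) hL
    (fun X hX Y hY => S.adRep_lie hX hY) S.adRep_A_cube (k + 1)
  exact h k (by omega)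

end HermitianSymmetric

/-! ### Lax polynomials, jets along solutions, and the flows of the hierarchy -/

namespace HermitianSymmetric

variable {𝔸 : Type*} [NormedRing 𝔸] [NormedAlgebra ℝ 𝔸] (S : HermitianSymmetric 𝔸)

theorem laxV_zero (l : ℝ) : S.laxV 0 l = fun _ => S.A := by
  funext u; simp [laxV]

/-- The Lax matrices are successive polynomial truncations of one series: raising n multiplies by λ
and appends a new constant coefficient. -/
theorem laxV_succ (n : ℕ) (l : ℝ) :
    S.laxV (n + 1) l = fun u => l • S.laxV n l u + (S.coeffM n u + S.coeffH n u) := by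
  funext u
  have hs := Finset.smul_sum (r := l) (s := Finset.range n)
    (f := fun k => l ^ k • (S.laxVm n k u + S.laxVh n k u))
  rw [laxV, laxV, Finset.sum_range_succ', smul_add l, hs, smul_smul, ← pow_succ', ← add_assoc]
  congr 2
  · refine Finset.sum_congr rfl fun k _ => ?_
    rw [smul_smul, ← pow_succ']
    have e1 : S.laxVm (n + 1) (k + 1) = S.laxVm n k := by
      rw [laxVm, laxVm, show n + 1 - 1 - (k + 1) = n - 1 - k by omega]
    have e2 : S.laxVh (n + 1) (k + 1) = S.laxVh n k := by rw [laxVh, laxVh, e1]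
    rw [e1, e2]
  · rw [pow_zero, one_smul]
    rfl

theorem totalD_var (u : S.Jet) : totalD S.var u = (u 1 : 𝔸) := by
  have h := totalD_clm (IsDiffFun.of_apply (M := S.𝔪) 0) S.𝔪.subtypeL
  rw [totalD_apply] at h
  exact congrFun h u

theorem totalD_coe_apply (k : ℕ) :
    totalD (fun u : S.Jet => (u k : 𝔸)) = fun u => (u (k + 1) : 𝔸) := by
  have h := totalD_clm (IsDiffFun.of_apply (M := S.𝔪) k) S.𝔪.subtypeL
  rw [totalD_apply] at h
  exact h

theorem isDiffFun_coe_apply (k : ℕ) : IsDiffFun (fun u : S.Jet => (u k : 𝔸)) :=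
  (IsDiffFun.of_apply k).clm S.𝔪.subtypeL

/-- The cubic term of the mKdV equation. -/
def cubicTerm (u : S.Jet) : 𝔸 := ⁅⁅S.A, (u 0 : 𝔸)⁆, ⁅⁅S.A, (u 0 : 𝔸)⁆, (u 0 : 𝔸)⁆⁆

theorem isDiffFun_cubicTerm : IsDiffFun S.cubicTerm := by
  have hA : IsDiffFun (fun u : S.Jet => ⁅S.A, (u 0 : 𝔸)⁆) :=
    (IsDiffFun.const S.A).lie (S.isDiffFun_coe_apply 0)
  exact hA.lie (hA.lie (S.isDiffFun_coe_apply 0))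

variable {S}

theorem SmoothOn.contDiff_space {I : Set ℝ} {Q : ℝ → ℝ → S.𝔪} (h : S.SmoothOn I Q) {t : ℝ}
    (ht : t ∈ I) : ContDiff ℝ ∞ (fun y => Q y t) := by
  rw [← contDiffOn_univ]
  exact ContDiffOn.comp (g := fun p : ℝ × ℝ => Q p.1 p.2) (f := fun y => (y, t)) h
    (contDiff_id.prodMk contDiff_const).contDiffOn (fun y _ => ⟨trivial, ht⟩)

theorem hasDerivAt_coe {f : ℝ → S.𝔪} {f' : S.𝔪} {x : ℝ} (h : HasDerivAt f f' x) :
    HasDerivAt (fun y => (f y : 𝔸)) (f' : 𝔸) x :=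
  S.𝔪.subtypeL.hasFDerivAt.comp_hasDerivAt x h

theorem iteratedDeriv_coe {f : ℝ → S.𝔪} (hf : ContDiff ℝ ∞ f) (k : ℕ) :
    iteratedDeriv k (fun y => (f y : 𝔸)) = fun y => ((S.jet f y k : S.𝔪) : 𝔸) := by
  induction k with
  | zero => simp [jet]
  | succ k ih =>
    rw [iteratedDeriv_succ, ih]
    funext y
    have h1 : HasDerivAt (fun y => S.jet f y k) (S.jet f y (k + 1)) y := by
      simp only [jet]
      rw [iteratedDeriv_succ]
      exact ((hf.differentiable_iteratedDeriv k
        (by exact_mod_cast ENat.natCast_lt_top _)) y).hasDerivAt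
    exact (hasDerivAt_coe h1).deriv

theorem SmoothOn.hasDerivAt_time {I : Set ℝ} {Q : ℝ → ℝ → S.𝔪} (h : S.SmoothOn I Q)
    (hI : IsOpen I) {t : ℝ} (ht : t ∈ I) (s : ℝ) :
    HasDerivAt (fun τ => (Q s τ : 𝔸)) (deriv (fun τ => (Q s τ : 𝔸)) t) t := by
  have h1 : DifferentiableOn ℝ (fun τ => Q s τ) I :=
    (ContDiffOn.comp (g := fun p : ℝ × ℝ => Q p.1 p.2) (f := fun τ => (s, τ)) h
      (contDiff_const.prodMk contDiff_id).contDiffOn (fun y hy => ⟨trivial, hy⟩)).differentiableOn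
      (by simp)
  have h2 := hasDerivAt_coe (h1.differentiableAt (hI.mem_nhds ht)).hasDerivAt
  exact h2.differentiableAt.hasDerivAt

theorem jet_zero (f : ℝ → S.𝔪) (x : ℝ) : S.jet f x 0 = f x := by
  simp [jet]

theorem isospectral_iff (n : ℕ) (I : Set ℝ) (Q : ℝ → ℝ → S.𝔪) :
    S.IsospectralFlow n I Q ↔ (S.SmoothOn I Q ∧ ∀ x, ∀ t ∈ I,
      (1 : ℝ)⁻¹ • (deriv (fun τ => Q x τ) t : 𝔸) = S.hier n (S.jet (fun y => Q y t) x)) := by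
  simp only [inv_one, one_smul]
  rfl

variable (S)

section Hierarchy

variable [FiniteDimensional ℝ 𝔸]

/-- The intertwining ℛJ = Jℛ* is applied repeatedly; it is available because all the coefficients
are 𝔪-valued, where J⁻¹J = 1. -/
theorem hier_eq (n : ℕ) : S.hier n = S.J (S.coeffM n) := by
  induction n with
  | zero => rfl
  | succ n ih =>
    have h : S.hier (n + 1) = S.Rop (S.hier n) := Function.iterate_succ_apply' _ _ _
    have h2 : S.Jinv (S.J (S.coeffM n)) = S.coeffM n := funext fun u => by
      rw [Jinv, J, S.ad_A_sq _ ((S.isGoodCoeff n).memM u), neg_neg]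
    rw [h, ih, Rop, h2]
    exact funext fun u => ((S.isGoodCoeff n).lie_A_coeffM_succ u).symm

theorem hier_apply (n : ℕ) (u : S.Jet) : S.hier n u = ⁅S.A, S.coeffM n u⁆ :=
  congrFun (S.hier_eq n) u

theorem hier_succ (n : ℕ) : S.hier (n + 1) = S.Hop (S.coeffM n) := by
  rw [hier_eq]
  exact funext fun u => (S.isGoodCoeff n).lie_A_coeffM_succ u

theorem jinv_hier (n : ℕ) : S.Jinv (S.hier n) = S.coeffM n := by
  rw [hier_eq]
  exact funext fun u => by rw [Jinv, J, S.ad_A_sq _ ((S.isGoodCoeff n).memM u), neg_neg]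

theorem isDiffFun_hier (n : ℕ) : IsDiffFun (S.hier n) := by
  rw [hier_eq]; exact (IsDiffFun.const S.A).lie (S.isGoodCoeff n).diffM

theorem hier_mem (n : ℕ) (u : S.Jet) : S.hier n u ∈ S.𝔪 := by
  rw [hier_apply]; exact lie_A_mem_𝔪 ((S.isGoodCoeff n).memM u)

theorem hier_wellDefined (n : ℕ) : S.IsDifferential (S.hier n) ∧ (∀ u, S.hier n u ∈ S.𝔪) ∧
    ∃! p, S.IsPrimitive p (S.adVar (S.Jinv (S.hier n))) := by
  refine ⟨S.isDiffFun_hier n, S.hier_mem n, S.coeffH n, ?_, fun p hp => ?_⟩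
  · rw [jinv_hier]; exact (S.isGoodCoeff n).primitive
  · rw [jinv_hier] at hp; exact hp.unique (S.isGoodCoeff n).primitive

/-! ### The Lax pair -/

theorem isDiffFun_laxV (n : ℕ) (l : ℝ) : IsDiffFun (S.laxV n l) := by
  induction n with
  | zero => rw [laxV_zero]; exact IsDiffFun.const S.A
  | succ n ih =>
    rw [laxV_succ]
    exact (ih.smul l).add ((S.isGoodCoeff n).diffM.add (S.isGoodCoeff n).diffH)

/-- The zero-curvature identity on the jet space. -/
theorem totalD_laxV (n : ℕ) (l : ℝ) (u : S.Jet) :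
    totalD (S.laxV n l) u - ⁅S.laxU l u, S.laxV n l u⁆ = S.hier n u := by
  induction n with
  | zero =>
    rw [laxV_zero, totalD_const, laxU, hier_apply, add_lie, smul_lie, lie_self]
    simp only [Pi.zero_apply, smul_zero, zero_add, zero_sub, lie_skew]
    rfl
  | succ n ih =>
    have hg := S.isGoodCoeff n
    rw [laxV_succ, totalD_add ((S.isDiffFun_laxV n l).smul l) (hg.diffM.add hg.diffH),
      totalD_smul (S.isDiffFun_laxV n l), totalD_add hg.diffM hg.diffH, hier_succ,
      hop_coeffM_apply]
    dsimp only
    have e1 : ⁅S.laxU l u, S.coeffM n u + S.coeffH n u⁆ =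
        l • ⁅S.A, S.coeffM n u⁆ + ⁅(u 0 : 𝔸), S.coeffM n u⁆ + ⁅(u 0 : 𝔸), S.coeffH n u⁆ := by
      rw [laxU, add_lie, smul_lie, lie_add, lie_add, lie_A_of_mem_𝔥 (hg.memH u), add_zero, add_assoc]
    rw [lie_add, lie_smul, e1, hg.totalD_coeffH, ← hier_apply, ← ih, smul_sub]
    abel

variable {S}

theorem SmoothOn.zeroCurvature_iff {n : ℕ} {I : Set ℝ} {Q : ℝ → ℝ → S.𝔪} (h : S.SmoothOn I Q)
    (hI : IsOpen I) : S.ZeroCurvature n I Q ↔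
      ∀ s, ∀ t ∈ I, (deriv (fun τ => Q s τ) t : 𝔸) = S.hier n (S.jet (fun y => Q y t) s) := by
  have key : ∀ s, ∀ t ∈ I, ∀ l : ℝ,
      deriv (fun τ => S.laxU l (S.jet (fun y => Q y τ) s)) t
        - deriv (fun σ => S.laxV n l (S.jet (fun y => Q y t) σ)) s
        + ⁅S.laxU l (S.jet (fun y => Q y t) s), S.laxV n l (S.jet (fun y => Q y t) s)⁆ =
      (deriv (fun τ => Q s τ) t : 𝔸) - S.hier n (S.jet (fun y => Q y t) s) := by
    intro s t ht l
    have h1 : deriv (fun τ => S.laxU l (S.jet (fun y => Q y τ) s)) t =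
        (deriv (fun τ => Q s τ) t : 𝔸) := by
      simp only [laxU, jet_zero]
      exact ((h.hasDerivAt_time hI ht s).const_add (l • S.A)).deriv
    have h2 := ((S.isDiffFun_laxV n l).hasDerivAt_jet (h.contDiff_space ht) s).deriv
    have h3 : deriv (fun σ => S.laxV n l (S.jet (fun y => Q y t) σ)) s =
        totalD (S.laxV n l) (S.jet (fun y => Q y t) s) := h2
    rw [h1, h3, ← S.totalD_laxV n l]
    abel
  constructor
  · intro hz s t ht
    -- By `key` the curvature does not depend on λ, so any single value suffices.
    have := hz s t ht 0
    rwa [key s t ht, sub_eq_zero] at this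
  · intro hz s t ht l
    rw [key s t ht, hz s t ht, sub_self]

theorem isospectralFlow_iff {n : ℕ} {I : Set ℝ} {Q : ℝ → ℝ → S.𝔪} (hI : IsOpen I) :
    S.IsospectralFlow n I Q ↔ S.SmoothOn I Q ∧ S.ZeroCurvature n I Q :=
  and_congr_right fun h => (h.zeroCurvature_iff hI).symm

/-! ### Scaling -/

variable (S)

/-- The action `uₖ ↦ c rᵏ uₖ` on jets. -/
def scale (c r : ℝ) (u : S.Jet) : S.Jet := fun k => (c * r ^ k) • u k

/-- Each D contributes a factor r and each ad(u) a factor c. The factors ad(u) occur in pairs in ℛ*,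
so only c² = r² is needed and the sign of c stays free. Uniqueness of primitives carries the weight
from the 𝔪-part to the 𝔥-part. -/
theorem coeff_scale {c r : ℝ} (hc : c ^ 2 = r ^ 2) (hr : r ≠ 0) (k : ℕ) :
    (∀ u, S.coeffM k (S.scale c r u) = (c * r ^ k) • S.coeffM k u) ∧
    (∀ u, S.coeffH k (S.scale c r u) = r ^ (k + 1) • S.coeffH k u) := by
  have hM : ∀ k, (∀ u, S.coeffM k (S.scale c r u) = (c * r ^ k) • S.coeffM k u) →
      ∀ u, S.coeffH k (S.scale c r u) = r ^ (k + 1) • S.coeffH k u := by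
    intro k hk
    have hg := S.isGoodCoeff k
    have hd : IsDiffFun (fun u => S.coeffH k (S.scale c r u)) := hg.diffH.comp_scale _
    refine congrFun (hd.eq_of_totalD_eq (hg.diffH.smul (r ^ (k + 1))) ?_ ?_)
    · rw [totalD_smul hg.diffH]
      funext u
      have h1 := hg.diffH.totalD_scale c r u
      have h2 : totalD (S.coeffH k) (S.scale c r u) =
          r • totalD (fun u => S.coeffH k (S.scale c r u)) u := h1
      rw [hg.totalD_coeffH, hk] at h2
      have h3 : ((S.scale c r u 0 : S.𝔪) : 𝔸) = c • (u 0 : 𝔸) := by simp [scale]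
      rw [h3, smul_lie, lie_smul, smul_smul, ← hg.totalD_coeffH] at h2
      have h4 : c * (c * r ^ k) = r * r ^ (k + 1) := by
        rw [← mul_assoc, ← sq, hc]; ring
      rw [h4, mul_smul] at h2
      exact (smul_right_injective 𝔸 hr h2).symm
    · have : S.scale c r 0 = 0 := by funext k; simp [scale]
      rw [this, hg.zeroH, smul_zero]
  induction k with
  | zero =>
    have h0 : ∀ u, S.coeffM 0 (S.scale c r u) = (c * r ^ 0) • S.coeffM 0 u := fun u => by
      simp [coeffM, var, scale]
    exact ⟨h0, hM 0 h0⟩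
  | succ k ih =>
    have hg := S.isGoodCoeff k
    have h1 : ∀ u, S.coeffM (k + 1) (S.scale c r u) = (c * r ^ (k + 1)) • S.coeffM (k + 1) u := by
      intro u
      have h2 : totalD (S.coeffM k) (S.scale c r u) = (c * r ^ (k + 1)) • totalD (S.coeffM k) u := by
        have h3 : totalD (S.coeffM k) (S.scale c r u) =
            r • totalD (fun u => S.coeffM k (S.scale c r u)) u := hg.diffM.totalD_scale c r u
        have h4 : (fun u => S.coeffM k (S.scale c r u)) = fun u => (c * r ^ k) • S.coeffM k u :=
          funext ih.1
        rw [h3, h4, totalD_smul hg.diffM, smul_smul]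
        congr 1
        ring
      have h3 : ((S.scale c r u 0 : S.𝔪) : 𝔸) = c • (u 0 : 𝔸) := by simp [scale]
      rw [coeffM_succ, RopAdj, Jinv, Jinv, hop_coeffM_apply, hop_coeffM_apply, h2, ih.2, h3,
        smul_lie, lie_smul, smul_smul, ← smul_sub, lie_smul, smul_neg]
    exact ⟨h1, hM _ h1⟩

theorem hier_scale {c r : ℝ} (hc : c ^ 2 = r ^ 2) (hr : r ≠ 0) (n : ℕ) (u : S.Jet) :
    S.hier n (S.scale c r u) = (c * r ^ n) • S.hier n u := by
  rw [hier_apply, (S.coeff_scale hc hr n).1, lie_smul, hier_apply]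

/-! ### The second and the third flow -/

theorem coeffH_zero : S.coeffH 0 = 0 := by
  refine IsPrimitive.dinv_eq ⟨IsDiffFun.const 0, ?_, rfl⟩
  have h1 : S.D (0 : S.Jet → 𝔸) = 0 := totalD_const 0
  rw [h1]
  exact funext fun u => (lie_self (u 0 : 𝔸)).symm

theorem coeffM_one (u : S.Jet) : S.coeffM 1 u = -⁅S.A, (u 1 : 𝔸)⁆ := by
  rw [coeffM_succ, RopAdj, Jinv, hop_coeffM_apply, coeffH_zero]
  have : totalD (S.coeffM 0) u = u 1 := S.totalD_var u
  rw [this, Pi.zero_apply, lie_zero, sub_zero]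

theorem coeffH_one (u : S.Jet) : S.coeffH 1 u = -((1 / 2 : ℝ) • ⁅(u 0 : 𝔸), ⁅S.A, (u 0 : 𝔸)⁆⁆) := by
  have hA : IsDiffFun (fun u : S.Jet => ⁅S.A, (u 0 : 𝔸)⁆) :=
    (IsDiffFun.const S.A).lie (S.isDiffFun_coe_apply 0)
  have hd := (S.isDiffFun_coe_apply 0).lie hA
  refine congrFun (IsPrimitive.dinv_eq (S := S) (p := fun u => -((1 / 2 : ℝ) • ⁅(u 0 : 𝔸), ⁅S.A, (u 0 : 𝔸)⁆⁆))
    ⟨(hd.smul _).neg, ?_, by simp⟩) u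
  have h1 : S.D (fun u => -((1 / 2 : ℝ) • ⁅(u 0 : 𝔸), ⁅S.A, (u 0 : 𝔸)⁆⁆)) =
      fun u => -totalD (fun u : S.Jet => (1 / 2 : ℝ) • ⁅(u 0 : 𝔸), ⁅S.A, (u 0 : 𝔸)⁆⁆) u :=
    totalD_neg (fun u : S.Jet => (1 / 2 : ℝ) • ⁅(u 0 : 𝔸), ⁅S.A, (u 0 : 𝔸)⁆⁆)
  rw [h1, totalD_smul hd, totalD_lie (S.isDiffFun_coe_apply 0) hA,
    totalD_lie (IsDiffFun.const S.A) (S.isDiffFun_coe_apply 0), totalD_coe_apply, totalD_const]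
  funext u
  have h2 : S.adVar (S.coeffM 1) u = ⁅(u 0 : 𝔸), -⁅S.A, (u 1 : 𝔸)⁆⁆ := by
    rw [adVar, coeffM_one]
  -- The form (X, Y) ↦ [X, JY] is symmetric on 𝔪, so the derivative of its diagonal value has two
  -- equal terms; hence the factor 1/2.
  have h3 : ⁅(u 1 : 𝔸), ⁅S.A, (u 0 : 𝔸)⁆⁆ = ⁅(u 0 : 𝔸), ⁅S.A, (u 1 : 𝔸)⁆⁆ := by
    rw [lie_lie_A_eq_neg (u 1).2 (u 0).2, lie_skew]
  rw [h2, lie_neg]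
  simp only [Pi.zero_apply, zero_lie, zero_add, h3]
  module

theorem totalD_coeffM_one (u : S.Jet) : totalD (S.coeffM 1) u = -⁅S.A, (u 2 : 𝔸)⁆ := by
  rw [show S.coeffM 1 = _ from funext S.coeffM_one, totalD_neg,
    totalD_lie (IsDiffFun.const S.A) (S.isDiffFun_coe_apply 1), totalD_coe_apply, totalD_const]
  simp

theorem hier_two (u : S.Jet) : S.hier 2 u =
    -⁅S.A, (u 2 : 𝔸)⁆ + (1 / 2 : ℝ) • ⁅(u 0 : 𝔸), ⁅(u 0 : 𝔸), ⁅S.A, (u 0 : 𝔸)⁆⁆⁆ := by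
  rw [hier_succ, hop_coeffM_apply, totalD_coeffM_one, coeffH_one, lie_neg, lie_smul, sub_neg_eq_add]

theorem coeffM_two (u : S.Jet) : S.coeffM 2 u =
    -(u 2 : 𝔸) + (1 / 2 : ℝ) • ⁅⁅S.A, (u 0 : 𝔸)⁆, ⁅⁅S.A, (u 0 : 𝔸)⁆, (u 0 : 𝔸)⁆⁆ := by
  have h0 : ⁅S.A, ⁅(u 0 : 𝔸), ⁅S.A, (u 0 : 𝔸)⁆⁆⁆ = 0 :=
    lie_A_of_mem_𝔥 (S.lie_𝔪_𝔪 _ (u 0).2 _ (lie_A_mem_𝔪 (u 0).2))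
  rw [← jinv_hier, Jinv, hier_two, lie_add, lie_neg, lie_smul, S.ad_A_sq _ (u 2).2,
    leibniz_lie S.A (u 0 : 𝔸), h0, lie_zero, add_zero, ← lie_skew ⁅S.A, (u 0 : 𝔸)⁆ (u 0 : 𝔸),
    lie_neg]
  module

/-- The cubic part drops out. With K = [JX, X], the Jacobi identity gives [X, [JX, K]] = [JX, [X,
K]], while skewness of J gives the same equality with a minus sign, so both sides vanish. -/
theorem lie_coeffM_two (u : S.Jet) :
    ⁅(u 0 : 𝔸), S.coeffM 2 u⁆ = -⁅(u 0 : 𝔸), (u 2 : 𝔸)⁆ := by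
  rw [coeffM_two, lie_add, lie_neg, lie_smul]
  set X := (u 0 : 𝔸) with hX
  have hXm : X ∈ S.𝔪 := (u 0).2
  set K := ⁅⁅S.A, X⁆, X⁆ with hK
  have hKh : K ∈ S.𝔥 := S.lie_𝔪_𝔪 _ (lie_A_mem_𝔪 hXm) _ hXm
  have hJ : ⁅S.A, ⁅X, K⁆⁆ = ⁅⁅S.A, X⁆, K⁆ := by
    rw [leibniz_lie, lie_A_of_mem_𝔥 hKh, lie_zero, add_zero]
  have h1 : ⁅X, ⁅⁅S.A, X⁆, K⁆⁆ = ⁅⁅S.A, X⁆, ⁅X, K⁆⁆ := by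
    have e : ⁅X, ⁅S.A, X⁆⁆ = -K := by rw [hK, lie_skew]
    rw [leibniz_lie, e, neg_lie, lie_self, neg_zero, zero_add]
  have h2 := lie_lie_A_eq_neg hXm (lie_𝔪_𝔥 hXm hKh)
  rw [hJ, h1] at h2
  have h3 : ⁅⁅S.A, X⁆, ⁅X, K⁆⁆ = 0 := by
    have h4 : (2 : ℝ) • ⁅⁅S.A, X⁆, ⁅X, K⁆⁆ = 0 := by
      rw [two_smul]; nth_rewrite 1 [h2]; exact neg_add_cancel _
    exact (smul_eq_zero.1 h4).resolve_left (by norm_num)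
  rw [h1, h3, smul_zero, add_zero]

theorem coeffH_two (u : S.Jet) : S.coeffH 2 u = -⁅(u 0 : 𝔸), (u 1 : 𝔸)⁆ := by
  have hd := (S.isDiffFun_coe_apply 0).lie (S.isDiffFun_coe_apply 1)
  refine congrFun (IsPrimitive.dinv_eq (S := S) (p := fun u => -⁅(u 0 : 𝔸), (u 1 : 𝔸)⁆)
    ⟨hd.neg, ?_, by simp⟩) u
  have h1 : S.D (fun u => -⁅(u 0 : 𝔸), (u 1 : 𝔸)⁆) =
      fun u => -totalD (fun u : S.Jet => ⁅(u 0 : 𝔸), (u 1 : 𝔸)⁆) u :=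
    totalD_neg (fun u : S.Jet => ⁅(u 0 : 𝔸), (u 1 : 𝔸)⁆)
  rw [h1, totalD_lie (S.isDiffFun_coe_apply 0) (S.isDiffFun_coe_apply 1), totalD_coe_apply,
    totalD_coe_apply]
  funext u
  have h2 : S.adVar (S.coeffM 2) u = -⁅(u 0 : 𝔸), (u 2 : 𝔸)⁆ := S.lie_coeffM_two u
  rw [h2]
  simp

theorem hier_three (u : S.Jet) : S.hier 3 u =
    -(u 3 : 𝔸) + ⁅(u 0 : 𝔸), ⁅(u 0 : 𝔸), (u 1 : 𝔸)⁆⁆ + (1 / 2 : ℝ) • totalD S.cubicTerm u := by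
  have h1 : S.coeffM 2 = fun u => -(u 2 : 𝔸) + (1 / 2 : ℝ) • S.cubicTerm u := funext S.coeffM_two
  rw [hier_succ, hop_coeffM_apply, coeffH_two, h1,
    totalD_add (S.isDiffFun_coe_apply 2).neg (S.isDiffFun_cubicTerm.smul _), totalD_neg,
    totalD_coe_apply, totalD_smul S.isDiffFun_cubicTerm, lie_neg, sub_neg_eq_add]
  exact add_right_comm _ _ _

variable {S}

theorem merged_iff_nls (c : ℝ) (I : Set ℝ) (q : ℝ → ℝ → S.𝔪) :
    (S.SmoothOn I q ∧ ∀ x, ∀ t ∈ I,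
      c⁻¹ • (deriv (fun τ => q x τ) t : 𝔸) = S.hier 2 (S.jet (fun y => q y t) x)) ↔
      S.NLS c I q := by
  refine and_congr_right fun h => forall_congr' fun x => forall₂_congr fun t ht => ?_
  rw [hier_two, jet_zero, iteratedDeriv_coe (h.contDiff_space ht)]

theorem merged_iff_mkdv (c : ℝ) (I : Set ℝ) (q : ℝ → ℝ → S.𝔪) :
    (S.SmoothOn I q ∧ ∀ x, ∀ t ∈ I,
      c⁻¹ • (deriv (fun τ => q x τ) t : 𝔸) = S.hier 3 (S.jet (fun y => q y t) x)) ↔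
      S.MKdV c I q := by
  refine and_congr_right fun h => forall_congr' fun x => forall₂_congr fun t ht => ?_
  have h1 : deriv (fun y => ⁅⁅S.A, (q y t : 𝔸)⁆, ⁅⁅S.A, (q y t : 𝔸)⁆, (q y t : 𝔸)⁆⁆) x =
      totalD S.cubicTerm (S.jet (fun y => q y t) x) := by
    have := (S.isDiffFun_cubicTerm.hasDerivAt_jet (h.contDiff_space ht) x).deriv
    simp only [cubicTerm, iteratedDeriv_zero] at this
    exact this
  have h2 : ((S.jet (fun y => q y t) x 1 : S.𝔪) : 𝔸) = deriv (fun y => (q y t : 𝔸)) x := by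
    rw [← iteratedDeriv_one, iteratedDeriv_coe (h.contDiff_space ht)]
  rw [hier_three, jet_zero, h1, h2, iteratedDeriv_coe (h.contDiff_space ht)]

end Hierarchy

end HermitianSymmetric

theorem iteratedDeriv_clm_comp {W W₁ : Type*} [NormedAddCommGroup W] [NormedSpace ℝ W]
    [NormedAddCommGroup W₁] [NormedSpace ℝ W₁] (L : W →L[ℝ] W₁) {f : ℝ → W}
    (hf : ContDiff ℝ ∞ f) (k : ℕ) :
    iteratedDeriv k (fun y => L (f y)) = fun y => L (iteratedDeriv k f y) := by
  induction k with
  | zero => simp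
  | succ k ih =>
    rw [iteratedDeriv_succ, ih, iteratedDeriv_succ]
    funext y
    exact (L.hasFDerivAt.comp_hasDerivAt y ((hf.differentiable_iteratedDeriv k
      (by exact_mod_cast ENat.natCast_lt_top _)) y).hasDerivAt).deriv

/-! ### Conjugation by units -/

namespace HermitianSymmetric

variable {𝔸 : Type*} [NormedRing 𝔸] [NormedAlgebra ℝ 𝔸] (S : HermitianSymmetric 𝔸)

/-- `X ↦ g X g⁻¹`. -/
def conjL (g : 𝔸ˣ) : 𝔸 →L[ℝ] 𝔸 :=
  (ContinuousLinearMap.mul ℝ 𝔸).flip ((g⁻¹ : 𝔸ˣ) : 𝔸) ∘L ContinuousLinearMap.mul ℝ 𝔸 (g : 𝔸)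

theorem conjL_apply (g : 𝔸ˣ) (X : 𝔸) : conjL g X = g * X * ((g⁻¹ : 𝔸ˣ) : 𝔸) := rfl

theorem conjL_mul (g : 𝔸ˣ) (X Y : 𝔸) : conjL g (X * Y) = conjL g X * conjL g Y := by
  simp only [conjL_apply, mul_assoc, Units.inv_mul_cancel_left]

theorem conjL_lie (g : 𝔸ˣ) (X Y : 𝔸) : conjL g ⁅X, Y⁆ = ⁅conjL g X, conjL g Y⁆ := by
  simp only [LieRing.of_associative_ring_bracket, map_sub, conjL_mul]

theorem conjL_inv_apply (g : 𝔸ˣ) (X : 𝔸) : conjL g⁻¹ (conjL g X) = X := by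
  simp [conjL_apply, mul_assoc]

variable {S} in
theorem isOpen_isoTimes (n : ℕ) {I : Set ℝ} (hI : IsOpen I) : IsOpen (S.isoTimes n I) :=
  hI.preimage (continuous_const.mul continuous_id)

variable [FiniteDimensional ℝ 𝔸]

/-! ### The constants `χ` and `κ` -/

/-- The operator -(ad A)² is a projection of 𝔤 onto 𝔪, so χ, its trace, is the dimension of 𝔪. -/
theorem χ_pos : 0 < S.χ := by
  set a : S.𝔤 := ⟨S.A, S.A_mem_𝔤⟩ with ha
  set f : S.𝔤 →ₗ[ℝ] S.𝔤 := -(LieAlgebra.ad ℝ S.𝔤 a ∘ₗ LieAlgebra.ad ℝ S.𝔤 a) with hf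
  set p : Submodule ℝ S.𝔤 := S.𝔪.comap (S.𝔤.incl : S.𝔤 →ₗ[ℝ] 𝔸) with hp
  have hfX : ∀ X : S.𝔤, (f X : 𝔸) = -⁅S.A, ⁅S.A, (X : 𝔸)⁆⁆ := fun X => rfl
  have hproj : LinearMap.IsProj p f := by
    constructor
    · intro X
      show (f X : 𝔸) ∈ S.𝔪
      obtain ⟨Y, hY, Z, hZ, h⟩ := exists_add_eq X.2
      rw [hfX, ← h, lie_add, lie_A_of_mem_𝔥 hY, zero_add, S.ad_A_sq Z hZ, neg_neg]
      exact hZ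
    · intro X hX
      have hX' : (X : 𝔸) ∈ S.𝔪 := hX
      refine Subtype.ext ?_
      rw [hfX, S.ad_A_sq _ hX', neg_neg]
  have htr : S.χ = (Module.finrank ℝ p : ℝ) := by
    rw [← hproj.trace, hf, map_neg, χ, killingForm_apply_apply]
  obtain ⟨X, hX, hX0⟩ := S.𝔪.exists_mem_ne_zero_of_ne_bot S.𝔪_ne_bot
  have : Nontrivial p := by
    refine ⟨⟨⟨X, mem_𝔤_of_mem_𝔪 hX⟩, hX⟩, 0, fun h => hX0 ?_⟩
    exact congrArg (fun Y : p => ((Y : S.𝔤) : 𝔸)) h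
  rw [htr]
  exact_mod_cast Module.finrank_pos

theorem sqrt_χ_pos : 0 < √S.χ := Real.sqrt_pos.2 S.χ_pos

theorem inv_sqrt_χ_sq : (√S.χ)⁻¹ ^ 2 = S.χ⁻¹ := by
  rw [inv_pow, Real.sq_sqrt S.χ_pos.le]

theorem κ_pos (n : ℕ) : 0 < S.κ n := Real.rpow_pos_of_pos S.χ_pos _

theorem κ_eq (n : ℕ) : S.κ n = √S.χ ^ n * S.χ⁻¹ := by
  rw [κ, Real.rpow_sub_one S.χ_pos.ne', Real.sqrt_eq_rpow, ← Real.rpow_natCast,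
    ← Real.rpow_mul S.χ_pos.le, div_eq_mul_inv]
  congr 2
  ring

theorem inv_κ_mul (n : ℕ) : (S.κ n)⁻¹ * S.χ⁻¹ = (√S.χ)⁻¹ ^ n := by
  have := S.χ_pos.ne'
  rw [κ_eq, mul_inv, inv_inv, inv_pow]
  field_simp

/-! ### The transformation between the two hierarchies -/

variable {S}

theorem Corresponds.eq_neg {n : ℕ} {q Q : ℝ → ℝ → S.𝔪} (h : S.Corresponds n q Q) (x τ : ℝ) :
    q x τ = -((√S.χ)⁻¹ • Q ((√S.χ)⁻¹ * x) ((S.κ n)⁻¹ * τ)) := by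
  have := h ((√S.χ)⁻¹ * x) ((S.κ n)⁻¹ * τ)
  rwa [mul_inv_cancel_left₀ S.sqrt_χ_pos.ne', mul_inv_cancel_left₀ (S.κ_pos n).ne'] at this

theorem Corresponds.eq_neg' {n : ℕ} {q Q : ℝ → ℝ → S.𝔪} (h : S.Corresponds n q Q) (s t : ℝ) :
    Q s t = -(√S.χ • q (√S.χ * s) (S.κ n * t)) := by
  rw [h s t, smul_neg, neg_neg, smul_smul, mul_inv_cancel₀ S.sqrt_χ_pos.ne', one_smul]

theorem Corresponds.smoothOn_iff {n : ℕ} {I : Set ℝ} {q Q : ℝ → ℝ → S.𝔪}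
    (h : S.Corresponds n q Q) : S.SmoothOn I q ↔ S.SmoothOn (S.isoTimes n I) Q := by
  constructor
  · intro hq
    have h1 : ContDiffOn ℝ ∞ (fun p : ℝ × ℝ => q (√S.χ * p.1) (S.κ n * p.2))
        (Set.univ ×ˢ S.isoTimes n I) :=
      ContDiffOn.comp (g := fun p : ℝ × ℝ => q p.1 p.2)
        (f := fun p : ℝ × ℝ => (√S.χ * p.1, S.κ n * p.2)) hq
        ((contDiff_const.mul contDiff_fst).prodMk
          (contDiff_const.mul contDiff_snd)).contDiffOn (fun p hp => ⟨trivial, hp.2⟩)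
    exact (h1.const_smul (√S.χ)).neg.congr fun p _ => h.eq_neg' p.1 p.2
  · intro hQ
    have h1 : ContDiffOn ℝ ∞ (fun p : ℝ × ℝ => Q ((√S.χ)⁻¹ * p.1) ((S.κ n)⁻¹ * p.2))
        (Set.univ ×ˢ I) :=
      ContDiffOn.comp (g := fun p : ℝ × ℝ => Q p.1 p.2)
        (f := fun p : ℝ × ℝ => ((√S.χ)⁻¹ * p.1, (S.κ n)⁻¹ * p.2)) hQ
        ((contDiff_const.mul contDiff_fst).prodMk
          (contDiff_const.mul contDiff_snd)).contDiffOn (fun p hp => ⟨trivial, by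
            show S.κ n * ((S.κ n)⁻¹ * p.2) ∈ I
            rw [mul_inv_cancel_left₀ (S.κ_pos n).ne']
            exact hp.2⟩)
    exact (h1.const_smul (√S.χ)⁻¹).neg.congr fun p _ => h.eq_neg p.1 p.2

theorem Corresponds.jet_eq {n : ℕ} {I : Set ℝ} {q Q : ℝ → ℝ → S.𝔪} (h : S.Corresponds n q Q)
    (hQ : S.SmoothOn (S.isoTimes n I) Q) {t : ℝ} (ht : t ∈ S.isoTimes n I) (s : ℝ) :
    S.jet (fun y => q y (S.κ n * t)) (√S.χ * s) =
      S.scale (-(√S.χ)⁻¹) (√S.χ)⁻¹ (S.jet (fun y => Q y t) s) := by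
  have h1 : (fun y => q y (S.κ n * t)) = fun y => (-(√S.χ)⁻¹) • Q ((√S.χ)⁻¹ * y) t := by
    funext y
    rw [h.eq_neg, inv_mul_cancel_left₀ (S.κ_pos n).ne', neg_smul]
  have hsm := hQ.contDiff_space ht
  funext k
  have hsm' : ContDiff ℝ k (fun y => Q y t) := hsm.of_le (by exact_mod_cast le_top)
  simp only [jet, scale]
  rw [h1, iteratedDeriv_fun_const_smul_field, iteratedDeriv_comp_const_smul hsm']
  dsimp only
  rw [inv_mul_cancel_left₀ S.sqrt_χ_pos.ne', smul_smul]

theorem Corresponds.deriv_eq {n : ℕ} {I : Set ℝ} {q Q : ℝ → ℝ → S.𝔪} (h : S.Corresponds n q Q)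
    (hI : IsOpen I) (hQ : S.SmoothOn (S.isoTimes n I) Q) {t : ℝ} (ht : t ∈ S.isoTimes n I)
    (s : ℝ) : deriv (fun τ => (q (√S.χ * s) τ : 𝔸)) (S.κ n * t) =
      (-(√S.χ)⁻¹ * (S.κ n)⁻¹) • deriv (fun τ => (Q s τ : 𝔸)) t := by
  have h1 : (fun τ => (q (√S.χ * s) τ : 𝔸)) = fun τ => (-(√S.χ)⁻¹) • (Q s ((S.κ n)⁻¹ * τ) : 𝔸) := by
    funext τ
    rw [h.eq_neg, inv_mul_cancel_left₀ S.sqrt_χ_pos.ne']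
    simp
  have h2 : HasDerivAt (fun τ => (Q s τ : 𝔸)) (deriv (fun τ => (Q s τ : 𝔸)) t)
      ((S.κ n)⁻¹ * (S.κ n * t)) := by
    rw [inv_mul_cancel_left₀ (S.κ_pos n).ne']
    exact hQ.hasDerivAt_time (isOpen_isoTimes n hI) ht s
  have h3 := ((h2.scomp (S.κ n * t) ((hasDerivAt_id (S.κ n * t)).const_mul (S.κ n)⁻¹)).const_smul
    (-(√S.χ)⁻¹)).deriv
  rw [h1]
  refine h3.trans ?_
  rw [smul_smul, mul_one]

theorem Corresponds.mergedFlow_iff {n : ℕ} {I : Set ℝ} {q Q : ℝ → ℝ → S.𝔪}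
    (h : S.Corresponds n q Q) (hI : IsOpen I) :
    S.MergedFlow n I q ↔ S.IsospectralFlow n (S.isoTimes n I) Q := by
  have hr : (√S.χ)⁻¹ ≠ 0 := inv_ne_zero S.sqrt_χ_pos.ne'
  rw [MergedFlow, IsospectralFlow, h.smoothOn_iff]
  refine and_congr_right fun hQ => ?_
  have key : ∀ s, ∀ t ∈ S.isoTimes n I,
      (S.χ⁻¹ • deriv (fun τ => (q (√S.χ * s) τ : 𝔸)) (S.κ n * t) =
        S.hier n (S.jet (fun y => q y (S.κ n * t)) (√S.χ * s)) ↔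
      deriv (fun τ => (Q s τ : 𝔸)) t = S.hier n (S.jet (fun y => Q y t) s)) := by
    intro s t ht
    rw [h.jet_eq hQ ht, S.hier_scale (neg_sq _) hr, h.deriv_eq hI hQ ht, smul_smul]
    -- The value of κ is the one for which the factor from the time derivative equals the weight of
    -- the n-th flow.
    have e : S.χ⁻¹ * (-(√S.χ)⁻¹ * (S.κ n)⁻¹) = -(√S.χ)⁻¹ * (√S.χ)⁻¹ ^ n := by
      rw [← inv_κ_mul]; ring
    rw [e]
    exact (smul_right_injective 𝔸 (mul_ne_zero (neg_ne_zero.2 hr) (pow_ne_zero n hr))).eq_iff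
  constructor
  · intro hm s t ht
    exact (key s t ht).1 (hm _ _ ht)
  · intro hi x τ hτ
    have ht : (S.κ n)⁻¹ * τ ∈ S.isoTimes n I := by
      show S.κ n * ((S.κ n)⁻¹ * τ) ∈ I
      rwa [mul_inv_cancel_left₀ (S.κ_pos n).ne']
    have := (key ((√S.χ)⁻¹ * x) _ ht).2 (hi _ _ ht)
    rwa [mul_inv_cancel_left₀ (S.κ_pos n).ne', mul_inv_cancel_left₀ S.sqrt_χ_pos.ne'] at this

/-! ### The adjoint action -/

variable (S)

/-- Conjugation commutes with the exponential, so the one-parameter subgroup of the conjugate stays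
in G. -/
theorem conjL_mem_𝔤 {g : 𝔸ˣ} (hg : g ∈ S.G) {X : 𝔸} (hX : X ∈ S.𝔤) : conjL g X ∈ S.𝔤 := by
  rw [S.mem_𝔤_iff] at hX ⊢
  intro r
  obtain ⟨k, hk, h⟩ := hX r
  refine ⟨g * k * g⁻¹, S.G.mul_mem (S.G.mul_mem hg hk) (S.G.inv_mem hg), ?_⟩
  have : CompleteSpace 𝔸 := FiniteDimensional.complete ℝ 𝔸
  let _ : NormedAlgebra ℚ 𝔸 := NormedAlgebra.restrictScalars ℚ ℝ 𝔸
  rw [← map_smul, conjL_apply, NormedSpace.exp_units_conj, Units.val_mul, Units.val_mul, h]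

/-- Conjugation by g respects brackets and fixes A, hence commutes with ad A, and 𝔪 is the subspace
of 𝔤 on which (ad A)² = -1. -/
theorem conjL_mem_𝔪 {g : 𝔸ˣ} (hg : g ∈ S.H) {X : 𝔸} (hX : X ∈ S.𝔪) : conjL g X ∈ S.𝔪 := by
  have hgA : conjL g S.A = S.A := by
    rw [conjL_apply, hg.2, mul_assoc, Units.mul_inv, mul_one]
  refine mem_𝔪_of_ad_A_sq (S.conjL_mem_𝔤 hg.1 (mem_𝔤_of_mem_𝔪 hX)) ?_
  have : conjL g ⁅S.A, ⁅S.A, X⁆⁆ = ⁅S.A, ⁅S.A, conjL g X⁆⁆ := by rw [conjL_lie, conjL_lie, hgA]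
  rw [← this, S.ad_A_sq X hX, map_neg]

theorem flows_invariant (c : ℝ) (I : Set ℝ) (Q : ℝ → ℝ → S.𝔪) (hI : IsOpen I) {g : 𝔸ˣ}
    (hg : g ∈ S.H) : ∃ Q' : ℝ → ℝ → S.𝔪,
      (∀ s t, (Q' s t : 𝔸) = (g : 𝔸) * (Q s t : 𝔸) * ((g⁻¹ : 𝔸ˣ) : 𝔸)) ∧
      (S.NLS c I Q → S.NLS c I Q') ∧ (S.MKdV c I Q → S.MKdV c I Q') := by
  set T := (conjL g : 𝔸 →L[ℝ] 𝔸)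
  have hgA : T S.A = S.A := by
    rw [conjL_apply, hg.2, mul_assoc, Units.mul_inv, mul_one]
  set L : S.𝔪 →L[ℝ] S.𝔪 := LinearMap.toContinuousLinearMap
    ((T : 𝔸 →ₗ[ℝ] 𝔸).restrict fun X hX => S.conjL_mem_𝔪 hg hX) with hL
  have hLT : ∀ X : S.𝔪, (L X : 𝔸) = T X := fun X => rfl
  have hsm : S.SmoothOn I Q → S.SmoothOn I (fun s t => L (Q s t)) := fun h =>
    L.contDiff.comp_contDiffOn h
  have ht : S.SmoothOn I Q → ∀ s, ∀ t ∈ I, deriv (fun τ => (L (Q s τ) : 𝔸)) t =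
      T (deriv (fun τ => (Q s τ : 𝔸)) t) := fun h s t ht =>
    (T.hasFDerivAt.comp_hasDerivAt t (h.hasDerivAt_time hI ht s)).deriv
  have hcoe : ∀ {f : ℝ → S.𝔪}, ContDiff ℝ ∞ f → ContDiff ℝ ∞ (fun y => (f y : 𝔸)) := fun hf =>
    S.𝔪.subtypeL.contDiff.comp hf
  have hs : S.SmoothOn I Q → ∀ k s, ∀ t ∈ I, iteratedDeriv k (fun y => (L (Q y t) : 𝔸)) s =
      T (iteratedDeriv k (fun y => (Q y t : 𝔸)) s) := fun h k s t ht =>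
    congrFun (iteratedDeriv_clm_comp T (hcoe (h.contDiff_space ht)) k) s
  refine ⟨fun s t => L (Q s t), fun s t => rfl, fun h => ⟨hsm h.1, fun s t htI => ?_⟩,
    fun h => ⟨hsm h.1, fun s t htI => ?_⟩⟩
  · rw [ht h.1 s t htI, hs h.1 2 s t htI, ← map_smul, h.2 s t htI, hLT, map_add, map_neg, map_smul]
    simp only [T, conjL_lie]
    simp only [← show T = conjL g from rfl, hgA]
  · have h1 := hs h.1 1 s t htI
    rw [iteratedDeriv_one, iteratedDeriv_one] at h1
    have h2 : (fun y => ⁅⁅S.A, (L (Q y t) : 𝔸)⁆, ⁅⁅S.A, (L (Q y t) : 𝔸)⁆, (L (Q y t) : 𝔸)⁆⁆) =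
        fun y => T ⁅⁅S.A, (Q y t : 𝔸)⁆, ⁅⁅S.A, (Q y t : 𝔸)⁆, (Q y t : 𝔸)⁆⁆ := by
      funext y
      simp only [hLT, T, conjL_lie]
      simp only [← show T = conjL g from rfl, hgA]
    have h3 : DifferentiableAt ℝ
        (fun y => ⁅⁅S.A, (Q y t : 𝔸)⁆, ⁅⁅S.A, (Q y t : 𝔸)⁆, (Q y t : 𝔸)⁆⁆) s := by
      have := (S.isDiffFun_cubicTerm.hasDerivAt_jet (h.1.contDiff_space htI) s).differentiableAt
      simp only [cubicTerm, iteratedDeriv_zero] at this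
      exact this
    have h4 := (T.hasFDerivAt.comp_hasDerivAt s h3.hasDerivAt).deriv
    have h5 : deriv (fun y => T ⁅⁅S.A, (Q y t : 𝔸)⁆, ⁅⁅S.A, (Q y t : 𝔸)⁆, (Q y t : 𝔸)⁆⁆) s =
      T (deriv (fun y => ⁅⁅S.A, (Q y t : 𝔸)⁆, ⁅⁅S.A, (Q y t : 𝔸)⁆, (Q y t : 𝔸)⁆⁆) s) := h4
    rw [ht h.1 s t htI, hs h.1 3 s t htI, h1, h2, h5, ← map_smul, h.2 s t htI, hLT, map_add, map_add,
      map_neg, map_smul]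
    simp only [T, conjL_lie]

end HermitianSymmetric

/-! ### Calculus lemmas -/

section Calculus

open Filter Topology

/-- Telescoping into terms x^i (x - y) y^j; the trailing power of y is carried along so that the
induction on m closes. -/
theorem norm_pow_sub_pow_mul_le {R : Type*} [NormedRing R] {x y : R} {B B' : ℝ}
    (N : ℕ) (hx : ∀ j ≤ N, ‖x ^ j‖ ≤ B) (hy : ∀ j ≤ N, ‖y ^ j‖ ≤ B') (m : ℕ) :
    ∀ j, m + j ≤ N → ‖(x ^ m - y ^ m) * y ^ j‖ ≤ m * (B * ‖x - y‖ * B') := by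
  have hB : 0 ≤ B := (norm_nonneg _).trans (hx 0 (Nat.zero_le _))
  induction m with
  | zero => intro j _; simp
  | succ m ih =>
    intro j hj
    have e : (x ^ (m + 1) - y ^ (m + 1)) * y ^ j =
        x ^ m * (x - y) * y ^ j + (x ^ m - y ^ m) * y ^ (j + 1) := by
      rw [pow_succ x m, pow_succ y m, pow_succ' y j]; noncomm_ring
    have h1 : ‖x ^ m * (x - y) * y ^ j‖ ≤ B * ‖x - y‖ * B' := by
      refine (norm_mul_le _ _).trans (mul_le_mul ((norm_mul_le _ _).trans
        (mul_le_mul_of_nonneg_right (hx m (by omega)) (norm_nonneg _))) (hy j (by omega))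
        (norm_nonneg _) (by positivity))
    rw [e]
    refine (norm_add_le _ _).trans ?_
    have h2 := ih (j + 1) (by omega)
    push_cast
    linarith

/-- A curve in a compact group of units starting at `1` has its velocity in the Lie algebra. -/
theorem exp_smul_mem_of_hasDerivAt {𝔸 : Type*} [NormedRing 𝔸] [NormedAlgebra ℝ 𝔸]
    [CompleteSpace 𝔸] {G : Subgroup 𝔸ˣ} (hG : IsCompact (G : Set 𝔸ˣ)) {g : ℝ → 𝔸ˣ}
    (hg : ∀ l, g l ∈ G) (h1 : g 0 = 1) {X : 𝔸} (hX : HasDerivAt (fun l => (g l : 𝔸)) X 0)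
    (r : ℝ) : ∃ k ∈ G, (k : 𝔸) = NormedSpace.exp (r • X) := by
  let _ : NormedAlgebra ℚ 𝔸 := NormedAlgebra.restrictScalars ℚ ℝ 𝔸
  have hK : IsCompact ((fun k : 𝔸ˣ => (k : 𝔸)) '' (G : Set 𝔸ˣ)) := hG.image Units.continuous_val
  obtain ⟨B, hB⟩ := hK.isBounded.exists_norm_le
  obtain ⟨B', hB'⟩ := (isCompact_Icc (a := (0 : ℝ)) (b := 1)).exists_bound_of_continuousOn
    (f := fun c : ℝ => NormedSpace.exp (c • (r • X)))
    (NormedSpace.exp_continuous.comp (continuous_id.smul continuous_const)).continuousOn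
  set f : ℝ → 𝔸 := fun l => (g (l * r) : 𝔸) - NormedSpace.exp (l • (r • X)) with hf
  have hf0 : f 0 = 0 := by simp [hf, h1, NormedSpace.exp_zero]
  have hfd : HasDerivAt f 0 0 := by
    have e1 : HasDerivAt (fun l : ℝ => (g (l * r) : 𝔸)) (r • X) 0 := by
      have h2 : HasDerivAt (fun l => (g l : 𝔸)) X ((0 : ℝ) * r) := by rwa [zero_mul]
      have := h2.scomp (0 : ℝ) ((hasDerivAt_id (0 : ℝ)).mul_const r)
      rw [one_mul] at this
      exact this
    have e2 : HasDerivAt (fun l : ℝ => NormedSpace.exp (l • (r • X))) (r • X) 0 := by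
      simpa [NormedSpace.exp_zero] using hasDerivAt_exp_smul_const (𝕂 := ℝ) (r • X) (0 : ℝ)
    have := e1.sub e2
    rw [sub_self] at this
    exact this
  set ε : ℕ → ℝ := fun k => ((k : ℝ) + 1)⁻¹ with hε
  have hεpos : ∀ k, 0 < ε k := fun k => by positivity
  have hε0 : Tendsto ε atTop (𝓝[≠] 0) := by
    refine tendsto_nhdsWithin_iff.2 ⟨?_, Eventually.of_forall fun k => (hεpos k).ne'⟩
    simpa [hε] using tendsto_one_div_add_atTop_nhds_zero_nat (𝕜 := ℝ)
  have hlim : Tendsto (fun k => (ε k)⁻¹ • f (ε k)) atTop (𝓝 0) := by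
    have := hfd.tendsto_slope_zero.comp hε0
    simpa [hf0, Function.comp_def] using this
  have hexp : ∀ k : ℕ, NormedSpace.exp (ε k • (r • X)) ^ (k + 1) = NormedSpace.exp (r • X) := by
    intro k
    rw [← NormedSpace.exp_nsmul, ← Nat.cast_smul_eq_nsmul ℝ, smul_smul]
    congr 1
    have : ((k + 1 : ℕ) : ℝ) * ε k = 1 := by
      rw [hε]; push_cast; exact mul_inv_cancel₀ (by positivity)
    rw [this, one_smul]
  -- With ε = 1/(k+1), the k + 1 telescoped errors add up to a difference quotient of f at 0, which
  -- tends to 0. Compactness of G bounds all powers of g uniformly, so g(εr)^(k+1) converges to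
  -- exp(rX).
  have hbound : ∀ k : ℕ, ‖((g (ε k * r) ^ (k + 1) : 𝔸ˣ) : 𝔸) - NormedSpace.exp (r • X)‖ ≤
      B * ‖(ε k)⁻¹ • f (ε k)‖ * B' := by
    intro k
    have hx : ∀ j ≤ k + 1, ‖(g (ε k * r) : 𝔸) ^ j‖ ≤ B := fun j _ => by
      rw [← Units.val_pow_eq_pow_val]
      exact hB _ ⟨_, G.pow_mem (hg _) j, rfl⟩
    have hy : ∀ j ≤ k + 1, ‖NormedSpace.exp (ε k • (r • X)) ^ j‖ ≤ B' := fun j hj => by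
      rw [← NormedSpace.exp_nsmul, ← Nat.cast_smul_eq_nsmul ℝ, smul_smul]
      refine hB' _ ⟨by have := hεpos k; positivity, ?_⟩
      rw [hε, mul_inv_le_iff₀ (by positivity), one_mul]
      exact_mod_cast hj
    have := norm_pow_sub_pow_mul_le (k + 1) hx hy (k + 1) 0 le_rfl
    rw [pow_zero, mul_one, hexp, ← Units.val_pow_eq_pow_val] at this
    refine this.trans (le_of_eq ?_)
    have e : ‖(ε k)⁻¹ • f (ε k)‖ = ((k + 1 : ℕ) : ℝ) * ‖f (ε k)‖ := by
      rw [norm_smul, hε, inv_inv, Real.norm_of_nonneg (by positivity)]; push_cast; rfl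
    rw [e]
    ring
  have htend : Tendsto (fun k : ℕ => ((g (ε k * r) ^ (k + 1) : 𝔸ˣ) : 𝔸)) atTop
      (𝓝 (NormedSpace.exp (r • X))) := by
    rw [tendsto_iff_norm_sub_tendsto_zero]
    refine squeeze_zero (fun _ => norm_nonneg _) hbound ?_
    simpa using ((hlim.norm).const_mul B).mul_const B'
  obtain ⟨k, hk, h⟩ := hK.isClosed.mem_of_tendsto htend
    (Eventually.of_forall fun k => ⟨_, G.pow_mem (hg _) (k + 1), rfl⟩)
  exact ⟨k, hk, h⟩

/-- Interchange of partial derivatives. -/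
theorem hasDerivAt_deriv_of_contDiffAt {W : Type*} [NormedAddCommGroup W] [NormedSpace ℝ W]
    {F : ℝ → ℝ → W} {a b : ℝ} (hF : ContDiffAt ℝ 2 (fun p : ℝ × ℝ => F p.1 p.2) (a, b))
    {G : ℝ → W} (hG : ∀ᶠ y in 𝓝 b, HasDerivAt (fun x => F x y) (G y) a) {G' : W}
    (hG' : HasDerivAt G G' b) : HasDerivAt (fun x => deriv (fun y => F x y) b) G' a := by
  set f : ℝ × ℝ → W := fun p => F p.1 p.2 with hf
  have hd : ∀ᶠ p in 𝓝 (a, b), DifferentiableAt ℝ f p :=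
    (hF.eventually (by simp)).mono fun p hp => hp.differentiableAt (by simp)
  have hd2 : HasFDerivAt (fderiv ℝ f) (fderiv ℝ (fderiv ℝ f) (a, b)) (a, b) :=
    ((hF.fderiv_right (m := 1) (by norm_num)).differentiableAt (by simp)).hasFDerivAt
  have hx : HasDerivAt (fun x : ℝ => (x, b)) ((1 : ℝ), (0 : ℝ)) a :=
    (hasDerivAt_id a).prodMk (hasDerivAt_const a b)
  have hy : HasDerivAt (fun y : ℝ => (a, y)) ((0 : ℝ), (1 : ℝ)) b :=
    (hasDerivAt_const b a).prodMk (hasDerivAt_id b)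
  have ex : (fun x => deriv (fun y => F x y) b) =ᶠ[𝓝 a] fun x => fderiv ℝ f (x, b) (0, 1) := by
    filter_upwards [hx.continuousAt.eventually hd] with x hdx
    have hy' : HasDerivAt (fun y : ℝ => (x, y)) ((0 : ℝ), (1 : ℝ)) b :=
      (hasDerivAt_const b x).prodMk (hasDerivAt_id b)
    exact (hdx.hasFDerivAt.comp_hasDerivAt b hy').deriv
  have ey : G =ᶠ[𝓝 b] fun y => fderiv ℝ f (a, y) (1, 0) := by
    filter_upwards [hy.continuousAt.eventually hd, hG] with y hdy hGy
    have hx' : HasDerivAt (fun x : ℝ => (x, y)) ((1 : ℝ), (0 : ℝ)) a :=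
      (hasDerivAt_id a).prodMk (hasDerivAt_const a y)
    have h0 := hdy.hasFDerivAt.comp_hasDerivAt (l := f) a hx'
    exact hGy.unique h0
  have h1 : HasDerivAt (fun y => fderiv ℝ f (a, y) (1, 0))
      (fderiv ℝ (fderiv ℝ f) (a, b) (0, 1) (1, 0)) b :=
    (ContinuousLinearMap.apply ℝ W ((1 : ℝ), (0 : ℝ))).hasFDerivAt.comp_hasDerivAt b
      (hd2.comp_hasDerivAt b hy)
  have h2 : HasDerivAt (fun x => fderiv ℝ f (x, b) (0, 1))
      (fderiv ℝ (fderiv ℝ f) (a, b) (1, 0) (0, 1)) a :=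
    (ContinuousLinearMap.apply ℝ W ((0 : ℝ), (1 : ℝ))).hasFDerivAt.comp_hasDerivAt a
      (hd2.comp_hasDerivAt a hx)
  have h3 := hF.isSymmSndFDerivAt (by simp) (1, 0) (0, 1)
  rw [hG'.unique (h1.congr_of_eventuallyEq ey), ← h3]
  exact h2.congr_of_eventuallyEq ex

theorem HasDerivAt.units_inv {R : Type*} [NormedRing R] [NormedAlgebra ℝ R]
    [HasSummableGeomSeries R] {g : ℝ → Rˣ} {x : ℝ} {g' : R}
    (h : HasDerivAt (fun y => (g y : R)) g' x) :
    HasDerivAt (fun y => (((g y)⁻¹ : Rˣ) : R))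
      (-(((g x)⁻¹ : Rˣ) * g' * ((g x)⁻¹ : Rˣ))) x := by
  have h1 := (hasFDerivAt_ringInverse (𝕜 := ℝ) (g x)).comp_hasDerivAt x h
  have h2 : (Ring.inverse ∘ fun y => (g y : R)) = fun y => (((g y)⁻¹ : Rˣ) : R) :=
    funext fun y => Ring.inverse_unit (g y)
  rw [h2] at h1
  simpa using h1

theorem ContDiffOn.units_inv {R V : Type*} [NormedRing R] [NormedAlgebra ℝ R]
    [HasSummableGeomSeries R] [NormedAddCommGroup V] [NormedSpace ℝ V] {g : V → Rˣ} {s : Set V}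
    {n : ℕ∞} (h : ContDiffOn ℝ n (fun y => (g y : R)) s) :
    ContDiffOn ℝ n (fun y => (((g y)⁻¹ : Rˣ) : R)) s := by
  have h1 : ContDiffOn ℝ n (fun y => Ring.inverse (g y : R)) s := fun y hy => by
    have h2 := (contDiffAt_ringInverse ℝ (g y)).comp_contDiffWithinAt (g := Ring.inverse)
      (f := fun y => (g y : R)) y (h y hy)
    exact h2
  exact h1.congr fun y _ => (Ring.inverse_unit (g y)).symm

theorem eq_of_hasDerivAt_eq_zero {W : Type*} [NormedAddCommGroup W] [NormedSpace ℝ W]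
    {F : ℝ → ℝ → W} {I : Set ℝ} (hI : IsOpen I) (hI' : IsPreconnected I)
    (hx : ∀ x, ∀ t ∈ I, HasDerivAt (fun y => F y t) 0 x)
    (ht : ∀ x, ∀ t ∈ I, HasDerivAt (fun τ => F x τ) 0 t) {t t' : ℝ} (h : t ∈ I) (h' : t' ∈ I)
    (x x' : ℝ) : F x t = F x' t' := by
  have h1 : F x t = F x' t := is_const_of_deriv_eq_zero (f := fun y => F y t)
    (fun y => (hx y t h).differentiableAt) (fun y => (hx y t h).deriv) x x'
  have h2 : F x' t = F x' t' := hI.is_const_of_deriv_eq_zero (f := fun τ => F x' τ) hI'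
    (fun τ hτ => (ht x' τ hτ).differentiableAt.differentiableWithinAt)
    (fun τ hτ => (ht x' τ hτ).deriv) h h'
  rw [h1, h2]

theorem hasDerivAt_comp_mul_left {W : Type*} [NormedAddCommGroup W] [NormedSpace ℝ W] {f : ℝ → W}
    {f' : W} {c x : ℝ} (h : HasDerivAt f f' (c * x)) :
    HasDerivAt (fun y => f (c * y)) (c • f') x := by
  have := h.scomp x ((hasDerivAt_id x).const_mul c)
  rw [mul_one] at this
  exact this

theorem differentiableAt_slices {W : Type*} [NormedAddCommGroup W] [NormedSpace ℝ W]
    {I : Set ℝ} {F : ℝ → ℝ → W}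
    (hF : ContDiffOn ℝ ∞ (fun p : ℝ × ℝ => F p.1 p.2) (Set.univ ×ˢ I)) (hI : IsOpen I) {t : ℝ} (ht : t ∈ I) (x : ℝ) :
    DifferentiableAt ℝ (fun y => F y t) x ∧ DifferentiableAt ℝ (fun τ => F x τ) t := by
  have h : DifferentiableAt ℝ (fun p : ℝ × ℝ => F p.1 p.2) (x, t) :=
    (hF.contDiffAt ((isOpen_univ.prod hI).mem_nhds ⟨trivial, ht⟩)).differentiableAt (by simp)
  exact ⟨h.comp (g := fun p : ℝ × ℝ => F p.1 p.2) (f := fun y : ℝ => (y, t)) x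
      (differentiableAt_id.prodMk (differentiableAt_const _)),
    h.comp (g := fun p : ℝ × ℝ => F p.1 p.2) (f := fun τ : ℝ => (x, τ)) t
      ((differentiableAt_const _).prodMk differentiableAt_id)⟩

end Calculus

/-! ### The Lax pair near λ = 0 and spectral functions -/

namespace HermitianSymmetric

variable {𝔸 : Type*} [NormedRing 𝔸] [NormedAlgebra ℝ 𝔸] (S : HermitianSymmetric 𝔸)

variable {S} in
theorem IsPrimitive.smul {p f : S.Jet → 𝔸} (h : S.IsPrimitive p f) (c : ℝ) :
    S.IsPrimitive (fun u => c • p u) (fun u => c • f u) := by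
  refine ⟨IsDiffFun.smul h.1 c, ?_, ?_⟩
  · have h1 : S.D (fun u => c • p u) = fun u => c • totalD p u := totalD_smul h.1 c
    rw [h1]
    exact funext fun u => congrArg (c • ·) (congrFun h.2.1 u)
  · exact (congrArg (c • ·) h.2.2).trans (smul_zero c)

/-- `V⁽¹⁾`, the coefficient of `λ` in the Lax matrix. -/
def laxV₁ (n : ℕ) (u : S.Jet) : 𝔸 := S.laxVm n 1 u + S.laxVh n 1 u

theorem laxV_at_zero (m : ℕ) (u : S.Jet) :
    S.laxV (m + 2) 0 u = S.laxVm (m + 2) 0 u + S.laxVh (m + 2) 0 u := by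
  rw [laxV_succ]
  dsimp only
  rw [zero_smul, zero_add]
  rfl

theorem hasDerivAt_laxV (m : ℕ) (u : S.Jet) :
    HasDerivAt (fun l => S.laxV (m + 2) l u) (S.laxV₁ (m + 2) u) 0 := by
  have hd : ∀ n, DifferentiableAt ℝ (fun l => S.laxV n l u) 0 := by
    intro n
    induction n with
    | zero => simp only [laxV_zero]; exact differentiableAt_const _
    | succ n ih => simp only [laxV_succ]; exact (differentiableAt_id.smul ih).add_const _
  have h1 := ((hasDerivAt_id (0 : ℝ)).smul (hd (m + 1)).hasDerivAt).add_const
    (S.coeffM (m + 1) u + S.coeffH (m + 1) u)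
  simp only [laxV_succ (n := m + 1)]
  refine h1.congr_deriv ?_
  simp only [id, zero_smul, zero_add, one_smul, laxV_succ]
  rfl

theorem hasDerivAt_laxU (l : ℝ) (u : S.Jet) : HasDerivAt (fun l => S.laxU l u) S.A l := by
  have := ((hasDerivAt_id l).smul_const S.A).add_const (u 0 : 𝔸)
  rw [one_smul] at this
  exact this

theorem laxU_zero (u : S.Jet) : S.laxU 0 u = u 0 := by simp [laxU]

variable {S}

section Spectral

variable {n : ℕ} {I : Set ℝ} {Q : ℝ → ℝ → S.𝔪} {φ : ℝ → ℝ → ℝ → 𝔸ˣ}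

theorem IsSpectralFunction.contDiffAt (h : S.IsSpectralFunction n I Q φ) (hI : IsOpen I) {t : ℝ}
    (ht : t ∈ I) (s l : ℝ) :
    ContDiffAt ℝ ∞ (fun p : ℝ × ℝ × ℝ => (φ p.1 p.2.1 p.2.2 : 𝔸)) (s, t, l) :=
  h.smooth.contDiffAt ((isOpen_univ.prod (hI.prod isOpen_univ)).mem_nhds ⟨trivial, ht, trivial⟩)

theorem IsSpectralFunction.hasDerivAt_s (h : S.IsSpectralFunction n I Q φ) (hI : IsOpen I) {t : ℝ}
    (ht : t ∈ I) (s l : ℝ) : HasDerivAt (fun σ => (φ σ t l : 𝔸))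
      (S.laxU l (S.jet (fun y => Q y t) s) * (φ s t l : 𝔸)) s := by
  rw [← h.deriv_s s t ht l]
  refine DifferentiableAt.hasDerivAt ?_
  exact (((h.contDiffAt hI ht s l).differentiableAt (by simp)).comp
    (g := fun p : ℝ × ℝ × ℝ => (φ p.1 p.2.1 p.2.2 : 𝔸)) (f := fun σ : ℝ => (σ, t, l)) s
    (differentiableAt_id.prodMk (differentiableAt_const _)))

theorem IsSpectralFunction.hasDerivAt_t (h : S.IsSpectralFunction n I Q φ) (hI : IsOpen I) {t : ℝ}
    (ht : t ∈ I) (s l : ℝ) : HasDerivAt (fun τ => (φ s τ l : 𝔸))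
      (S.laxV n l (S.jet (fun y => Q y t) s) * (φ s t l : 𝔸)) t := by
  rw [← h.deriv_t s t ht l]
  refine DifferentiableAt.hasDerivAt ?_
  exact (((h.contDiffAt hI ht s l).differentiableAt (by simp)).comp
    (g := fun p : ℝ × ℝ × ℝ => (φ p.1 p.2.1 p.2.2 : 𝔸)) (f := fun τ : ℝ => (s, τ, l)) t
    ((differentiableAt_const _).prodMk (differentiableAt_id.prodMk (differentiableAt_const _))))

theorem IsSpectralFunction.hasDerivAt_l (h : S.IsSpectralFunction n I Q φ) (hI : IsOpen I) {t : ℝ}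
    (ht : t ∈ I) (s l : ℝ) : HasDerivAt (fun l => (φ s t l : 𝔸))
      (deriv (fun l => (φ s t l : 𝔸)) l) l := by
  refine DifferentiableAt.hasDerivAt ?_
  exact (((h.contDiffAt hI ht s l).differentiableAt (by simp)).comp
    (g := fun p : ℝ × ℝ × ℝ => (φ p.1 p.2.1 p.2.2 : 𝔸)) (f := fun l : ℝ => (s, t, l)) l
    ((differentiableAt_const _).prodMk ((differentiableAt_const _).prodMk differentiableAt_id)))

/-- For f = φ_λ, B is the value of U or V at λ = 0 and C its λ-derivative. The B-terms cancel
against the derivative of the inverse, leaving C conjugated. -/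
theorem hasDerivAt_units_inv_mul {R : Type*} [NormedRing R] [NormedAlgebra ℝ R]
    [HasSummableGeomSeries R] {g : ℝ → Rˣ} {f : ℝ → R} {x : ℝ} {B C : R}
    (hg : HasDerivAt (fun y => (g y : R)) (B * g x) x)
    (hf : HasDerivAt f (C * g x + B * f x) x) :
    HasDerivAt (fun y => (((g y)⁻¹ : Rˣ) : R) * f y) (((g x)⁻¹ : Rˣ) * C * g x) x := by
  refine (hg.units_inv.mul hf).congr_deriv ?_
  simp only [mul_add, mul_assoc, neg_mul, Units.mul_inv_cancel_left]
  abel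

end Spectral

variable [FiniteDimensional ℝ 𝔸]

variable (S)

/-! ### The motion of the frame in terms of the Lax coefficients -/

theorem hPerp_eq (n : ℕ) (u : S.Jet) : S.hPerp n u = -(√S.χ • S.coeffM (n - 2) u) := by
  have h : S.hPerp n u = √S.χ • -⁅S.A, -S.hier (n - 2) u⁆ := rfl
  rw [h, ← jinv_hier, Jinv, lie_neg, neg_neg, smul_neg, neg_neg]

theorem hPar_eq (n : ℕ) (u : S.Jet) : S.hPar n u = √S.χ • S.coeffH (n - 2) u := by
  have h : S.J (S.hUp n) = S.coeffM (n - 2) := by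
    rw [← jinv_hier]
    funext u
    have : S.J (S.hUp n) u = ⁅S.A, -S.hier (n - 2) u⁆ := rfl
    rw [this, lie_neg, Jinv]
  have h2 : S.hPar n u = √S.χ • S.Dinv (S.adVar (S.J (S.hUp n))) u := rfl
  rw [h2, h]
  rfl

theorem wPerp_eq (m : ℕ) : S.wPerp (m + 2) = fun u => S.χ • S.coeffM (m + 1) u := by
  have hg := S.isGoodCoeff m
  have h1 : S.Jinv (S.hUp (m + 2)) = fun u => (-1 : ℝ) • S.coeffM m u := by
    rw [← jinv_hier]
    funext u
    have : S.Jinv (S.hUp (m + 2)) u = -⁅S.A, -S.hier m u⁆ := rfl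
    rw [this, Jinv, lie_neg, smul_neg, neg_one_smul, neg_neg]
  have h2 : S.Dinv (S.adVar (fun u => (-1 : ℝ) • S.coeffM m u)) =
      fun u => (-1 : ℝ) • S.coeffH m u := by
    have := (hg.primitive.smul (-1)).dinv_eq
    rw [← this]
    congr 1
    funext u
    exact lie_smul _ _ _
  have h3 : S.Hop (fun u => (-1 : ℝ) • S.coeffM m u) = fun u => (-1 : ℝ) • S.Hop (S.coeffM m) u := by
    funext u
    have e : S.Hop (fun u => (-1 : ℝ) • S.coeffM m u) u =
        totalD (fun u => (-1 : ℝ) • S.coeffM m u) u -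
          ⁅(u 0 : 𝔸), S.Dinv (S.adVar (fun u => (-1 : ℝ) • S.coeffM m u)) u⁆ := rfl
    rw [e, h2, totalD_smul hg.diffM, hop_coeffM_apply, lie_smul, smul_sub]
  funext u
  have h4 : S.wPerp (m + 2) u = S.χ • ⁅S.A, S.Hop (S.Jinv (S.hUp (m + 2))) u⁆ := rfl
  rw [h4, h1, h3, lie_smul, ← hg.lie_A_coeffM_succ, S.ad_A_sq _ (hg.coeffM_succ_props.2.1 u),
    neg_one_smul, neg_neg]

theorem wPar_eq (m : ℕ) (u : S.Jet) : S.wPar (m + 2) u = -(S.χ • S.coeffH (m + 1) u) := by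
  have h1 : S.Dinv (S.adVar (S.wPerp (m + 2))) = fun u => S.χ • S.coeffH (m + 1) u := by
    have := ((S.isGoodCoeff (m + 1)).primitive.smul S.χ).dinv_eq
    rw [← this, wPerp_eq]
    congr 1
    funext u
    exact lie_smul _ _ _
  exact congrArg Neg.neg (congrFun h1 u)

variable {S}

theorem Corresponds.lax_eq {n : ℕ} (hn : 2 ≤ n) {I : Set ℝ} {q Q : ℝ → ℝ → S.𝔪}
    (h : S.Corresponds n q Q) (hQ : S.SmoothOn (S.isoTimes n I) Q) {t : ℝ}
    (ht : t ∈ S.isoTimes n I) (s : ℝ) :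
    S.laxVm n 1 (S.jet (fun y => Q y t) s) =
      S.κ n • S.hPerp n (S.jet (fun y => q y (S.κ n * t)) (√S.χ * s)) ∧
    S.laxVh n 1 (S.jet (fun y => Q y t) s) =
      S.κ n • S.hPar n (S.jet (fun y => q y (S.κ n * t)) (√S.χ * s)) ∧
    S.laxVm n 0 (S.jet (fun y => Q y t) s) =
      -(S.κ n • S.wPerp n (S.jet (fun y => q y (S.κ n * t)) (√S.χ * s))) ∧
    S.laxVh n 0 (S.jet (fun y => Q y t) s) =
      -(S.κ n • S.wPar n (S.jet (fun y => q y (S.κ n * t)) (√S.χ * s))) := by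
  obtain ⟨m, rfl⟩ : ∃ m, n = m + 2 := ⟨n - 2, by omega⟩
  set u := S.jet (fun y => Q y t) s
  have hw := S.sqrt_χ_pos.ne'
  have hr : (√S.χ)⁻¹ ≠ 0 := inv_ne_zero hw
  have hχ : S.χ = √S.χ ^ 2 := (Real.sq_sqrt S.χ_pos.le).symm
  have hκ : S.κ (m + 2) = √S.χ ^ m := by
    rw [κ_eq]
    nth_rewrite 2 [hχ]
    field_simp
    ring
  have e1 : S.laxVm (m + 2) 1 = S.coeffM m := rfl
  have e2 : S.laxVh (m + 2) 1 = S.coeffH m := rfl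
  have e3 : S.laxVm (m + 2) 0 = S.coeffM (m + 1) := rfl
  have e4 : S.laxVh (m + 2) 0 = S.coeffH (m + 1) := rfl
  have s1 := S.coeff_scale (neg_sq (√S.χ)⁻¹) hr m
  have s2 := S.coeff_scale (neg_sq (√S.χ)⁻¹) hr (m + 1)
  rw [h.jet_eq hQ ht, e1, e2, e3, e4, hPerp_eq, hPar_eq, wPerp_eq, wPar_eq, hκ]
  simp only [Nat.add_sub_cancel]
  rw [s1.1, s1.2, s2.1, s2.2, hχ, Real.sqrt_sq (Real.sqrt_nonneg _)]
  simp only [smul_smul, ← neg_smul]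
  set w := √S.χ
  have hwr : w * w⁻¹ = 1 := mul_inv_cancel₀ hw
  have hm : w ^ m * w⁻¹ ^ m = 1 := by rw [← mul_pow, hwr, one_pow]
  generalize w⁻¹ = r at *
  -- In all four identities κ = wᵐ, the powers of w and the minus signs from the frame quantities
  -- cancel the scaling weights with r = w⁻¹ and c = -r.
  have p1 : w ^ m * -(w * (-r * r ^ m)) = 1 := by linear_combination (w * r) * hm + hwr
  have p2 : w ^ m * (w * r ^ (m + 1)) = 1 := by linear_combination (w * r) * hm + hwr
  have p3 : -(w ^ m * (w ^ 2 * (-r * r ^ (m + 1)))) = 1 := by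
    linear_combination (w * r) ^ 2 * hm + (w * r + 1) * hwr
  have p4 : -(w ^ m * -(w ^ 2 * r ^ (m + 1 + 1))) = 1 := by
    linear_combination (w * r) ^ 2 * hm + (w * r + 1) * hwr
  refine ⟨?_, ?_, ?_, ?_⟩
  · rw [p1, one_smul]
  · rw [p2, one_smul]
  · rw [p3, one_smul]
  · rw [p4, one_smul]

/-! ### The Sym–Pohlmeyer curve -/

variable {n : ℕ} {I : Set ℝ} {Q : ℝ → ℝ → S.𝔪} {φ : ℝ → ℝ → ℝ → 𝔸ˣ}

/-- Interchanging derivatives gives (φ_λ)_s = (Uφ)_λ = Aφ + Uφ_λ, because the λ-derivative of U is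
A. -/
theorem IsSpectralFunction.hasDerivAt_symPohlmeyer_s (h : S.IsSpectralFunction n I Q φ)
    (hI : IsOpen I) {t : ℝ} (ht : t ∈ I) (s : ℝ) :
    HasDerivAt (fun σ => symPohlmeyer φ σ t) (((φ s t 0)⁻¹ : 𝔸ˣ) * S.A * (φ s t 0 : 𝔸)) s := by
  have : CompleteSpace 𝔸 := FiniteDimensional.complete ℝ 𝔸
  refine hasDerivAt_units_inv_mul (h.hasDerivAt_s hI ht s 0) ?_
  have hF : ContDiffAt ℝ 2 (fun p : ℝ × ℝ => (φ p.1 t p.2 : 𝔸)) (s, 0) :=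
    ContDiffAt.comp (g := fun p : ℝ × ℝ × ℝ => (φ p.1 p.2.1 p.2.2 : 𝔸))
      (f := fun p : ℝ × ℝ => (p.1, t, p.2)) (s, 0)
      (contDiffAt_infty.1 (h.contDiffAt hI ht s 0) 2)
      (contDiff_fst.prodMk (contDiff_const.prodMk contDiff_snd)).contDiffAt
  refine hasDerivAt_deriv_of_contDiffAt (F := fun σ l => (φ σ t l : 𝔸)) hF
    (G := fun l => S.laxU l (S.jet (fun y => Q y t) s) * (φ s t l : 𝔸))
    (Filter.Eventually.of_forall fun l => h.hasDerivAt_s hI ht s l) ?_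
  exact (S.hasDerivAt_laxU 0 _).mul (h.hasDerivAt_l hI ht s 0)

theorem IsSpectralFunction.hasDerivAt_symPohlmeyer_t (hn : 2 ≤ n)
    (h : S.IsSpectralFunction n I Q φ) (hI : IsOpen I) {t : ℝ} (ht : t ∈ I) (s : ℝ) :
    HasDerivAt (fun τ => symPohlmeyer φ s τ)
      (((φ s t 0)⁻¹ : 𝔸ˣ) * S.laxV₁ n (S.jet (fun y => Q y t) s) * (φ s t 0 : 𝔸)) t := by
  have : CompleteSpace 𝔸 := FiniteDimensional.complete ℝ 𝔸
  obtain ⟨m, rfl⟩ : ∃ m, n = m + 2 := ⟨n - 2, by omega⟩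
  refine hasDerivAt_units_inv_mul (h.hasDerivAt_t hI ht s 0) ?_
  have hF : ContDiffAt ℝ 2 (fun p : ℝ × ℝ => (φ s p.1 p.2 : 𝔸)) (t, 0) :=
    ContDiffAt.comp (g := fun p : ℝ × ℝ × ℝ => (φ p.1 p.2.1 p.2.2 : 𝔸))
      (f := fun p : ℝ × ℝ => (s, p.1, p.2)) (t, 0)
      (contDiffAt_infty.1 (h.contDiffAt hI ht s 0) 2)
      (contDiff_const.prodMk (contDiff_fst.prodMk contDiff_snd)).contDiffAt
  refine hasDerivAt_deriv_of_contDiffAt (F := fun τ l => (φ s τ l : 𝔸)) hF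
    (G := fun l => S.laxV (m + 2) l (S.jet (fun y => Q y t) s) * (φ s t l : 𝔸))
    (Filter.Eventually.of_forall fun l => h.hasDerivAt_t hI ht s l) ?_
  exact (S.hasDerivAt_laxV m _).mul (h.hasDerivAt_l hI ht s 0)

/-- The Sym–Pohlmeyer point is the velocity at λ = 0 of the curve φ(0)⁻¹φ(λ) in G, which passes
through 1 there. -/
theorem IsSpectralFunction.symPohlmeyer_mem (h : S.IsSpectralFunction n I Q φ) (hI : IsOpen I)
    {t : ℝ} (ht : t ∈ I) (s : ℝ) : symPohlmeyer φ s t ∈ S.𝔤 := by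
  have : CompleteSpace 𝔸 := FiniteDimensional.complete ℝ 𝔸
  rw [S.mem_𝔤_iff]
  refine exp_smul_mem_of_hasDerivAt (g := fun l => (φ s t 0)⁻¹ * φ s t l) S.isCompact_G
    (fun l => S.G.mul_mem (S.G.inv_mem (h.mem_G s t ht 0)) (h.mem_G s t ht l)) (by simp) ?_
  simp only [Units.val_mul]
  exact (h.hasDerivAt_l hI ht s 0).const_mul _

theorem IsSpectralFunction.contDiffOn_inv (h : S.IsSpectralFunction n I Q φ) :
    ContDiffOn ℝ ∞ (fun p : ℝ × ℝ => (((φ p.1 p.2 0)⁻¹ : 𝔸ˣ) : 𝔸)) (Set.univ ×ˢ I) := by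
  have : CompleteSpace 𝔸 := FiniteDimensional.complete ℝ 𝔸
  exact ContDiffOn.units_inv (g := fun p : ℝ × ℝ => φ p.1 p.2 0) (ContDiffOn.comp
    (g := fun p : ℝ × ℝ × ℝ => (φ p.1 p.2.1 p.2.2 : 𝔸)) (f := fun p : ℝ × ℝ => (p.1, p.2, 0))
    h.smooth (contDiff_fst.prodMk (contDiff_snd.prodMk contDiff_const)).contDiffOn
    (fun p hp => ⟨trivial, hp.2, trivial⟩))

theorem IsSpectralFunction.contDiffOn_symPohlmeyer (h : S.IsSpectralFunction n I Q φ)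
    (hI : IsOpen I) :
    ContDiffOn ℝ ∞ (fun p : ℝ × ℝ => symPohlmeyer φ p.1 p.2) (Set.univ ×ˢ I) := by
  refine h.contDiffOn_inv.mul ?_
  have h1 := h.smooth.fderiv_of_isOpen (m := ∞) (isOpen_univ.prod (hI.prod isOpen_univ)) (by simp)
  have h2 : ContDiffOn ℝ ∞ (fun p : ℝ × ℝ => fderiv ℝ
      (fun p : ℝ × ℝ × ℝ => (φ p.1 p.2.1 p.2.2 : 𝔸)) (p.1, p.2, 0) (0, 0, 1)) (Set.univ ×ˢ I) :=
    (ContDiffOn.comp (f := fun p : ℝ × ℝ => (p.1, p.2, (0 : ℝ))) h1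
      (contDiff_fst.prodMk (contDiff_snd.prodMk contDiff_const)).contDiffOn
      (fun p hp => ⟨trivial, hp.2, trivial⟩)).clm_apply contDiffOn_const
  refine h2.congr fun p hp => ?_
  have h3 := ((h.contDiffAt hI hp.2 p.1 0).differentiableAt (by simp)).hasFDerivAt
  have h4 : HasDerivAt (fun l : ℝ => (p.1, p.2, l)) ((0 : ℝ), (0 : ℝ), (1 : ℝ)) 0 :=
    (hasDerivAt_const _ _).prodMk ((hasDerivAt_const _ _).prodMk (hasDerivAt_id _))
  exact (h3.comp_hasDerivAt (0 : ℝ) h4).deriv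

theorem IsSpectralFunction.hasDerivAt_inv_s (h : S.IsSpectralFunction n I Q φ) (hI : IsOpen I)
    {t : ℝ} (ht : t ∈ I) (s : ℝ) : HasDerivAt (fun σ => (((φ σ t 0)⁻¹ : 𝔸ˣ) : 𝔸))
      (-(((φ s t 0)⁻¹ : 𝔸ˣ) * (Q s t : 𝔸))) s := by
  have : CompleteSpace 𝔸 := FiniteDimensional.complete ℝ 𝔸
  refine (h.hasDerivAt_s hI ht s 0).units_inv.congr_deriv ?_
  rw [laxU_zero, jet_zero, mul_assoc, mul_assoc, Units.mul_inv, mul_one]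

theorem IsSpectralFunction.hasDerivAt_inv_t (hn : 2 ≤ n) (h : S.IsSpectralFunction n I Q φ)
    (hI : IsOpen I) {t : ℝ} (ht : t ∈ I) (s : ℝ) :
    HasDerivAt (fun τ => (((φ s τ 0)⁻¹ : 𝔸ˣ) : 𝔸))
      (-(((φ s t 0)⁻¹ : 𝔸ˣ) * (S.laxVm n 0 (S.jet (fun y => Q y t) s) +
        S.laxVh n 0 (S.jet (fun y => Q y t) s)))) t := by
  have : CompleteSpace 𝔸 := FiniteDimensional.complete ℝ 𝔸
  obtain ⟨m, rfl⟩ : ∃ m, n = m + 2 := ⟨n - 2, by omega⟩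
  refine (h.hasDerivAt_t hI ht s 0).units_inv.congr_deriv ?_
  rw [laxV_at_zero, mul_assoc, mul_assoc, Units.mul_inv, mul_one]

end HermitianSymmetric

namespace HermitianSymmetric

variable {𝔸 : Type*} [NormedRing 𝔸] [NormedAlgebra ℝ 𝔸] [FiniteDimensional ℝ 𝔸]
  {S : HermitianSymmetric 𝔸}

/-! ### Curve flows -/

/-- `Ad(g)` as an automorphism of the Lie algebra. -/
def adEquiv (S : HermitianSymmetric 𝔸) {g : 𝔸ˣ} (hg : g ∈ S.G) : S.𝔤 ≃ₗ⁅ℝ⁆ S.𝔤 where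
  toFun X := ⟨conjL g X, S.conjL_mem_𝔤 hg X.2⟩
  map_add' X Y := Subtype.ext (map_add (conjL g) (X : 𝔸) Y)
  map_smul' r X := Subtype.ext (map_smul (conjL g) r (X : 𝔸))
  map_lie' {X Y} := Subtype.ext (conjL_lie g (X : 𝔸) Y)
  invFun X := ⟨conjL g⁻¹ X, S.conjL_mem_𝔤 (S.G.inv_mem hg) X.2⟩
  left_inv X := Subtype.ext (conjL_inv_apply g (X : 𝔸))
  right_inv X := Subtype.ext (by
    have := conjL_inv_apply g⁻¹ (X : 𝔸)
    rwa [inv_inv] at this)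

variable {n : ℕ} {I : Set ℝ} {q Q : ℝ → ℝ → S.𝔪} {φ : ℝ → ℝ → ℝ → 𝔸ˣ}

theorem inv_κ_mul_mem {t : ℝ} (ht : t ∈ I) : (S.κ n)⁻¹ * t ∈ S.isoTimes n I := by
  show S.κ n * ((S.κ n)⁻¹ * t) ∈ I
  rwa [mul_inv_cancel_left₀ (S.κ_pos n).ne']

theorem coe_eq_of_corresponds (hc : S.Corresponds n q Q) (s t : ℝ) :
    (Q s t : 𝔸) = -(√S.χ • (q (√S.χ * s) (S.κ n * t) : 𝔸)) := by
  rw [hc.eq_neg' s t]; rfl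

theorem Corresponds.laxV₁_eq (hn : 2 ≤ n) (hc : S.Corresponds n q Q)
    (hQ : S.SmoothOn (S.isoTimes n I) Q) {t : ℝ} (ht : t ∈ S.isoTimes n I) (s : ℝ) :
    S.laxV₁ n (S.jet (fun y => Q y t) s) =
      S.κ n • (S.hPerp n (S.jet (fun y => q y (S.κ n * t)) (√S.χ * s)) +
        S.hPar n (S.jet (fun y => q y (S.κ n * t)) (√S.χ * s))) := by
  obtain ⟨h1, h2, -, -⟩ := hc.lax_eq hn hQ ht s
  rw [laxV₁, h1, h2, smul_add]

theorem Corresponds.laxV₀_eq (hn : 2 ≤ n) (hc : S.Corresponds n q Q)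
    (hQ : S.SmoothOn (S.isoTimes n I) Q) {t : ℝ} (ht : t ∈ S.isoTimes n I) (s : ℝ) :
    S.laxVm n 0 (S.jet (fun y => Q y t) s) + S.laxVh n 0 (S.jet (fun y => Q y t) s) =
      -(S.κ n • (S.wPerp n (S.jet (fun y => q y (S.κ n * t)) (√S.χ * s)) +
        S.wPar n (S.jet (fun y => q y (S.κ n * t)) (√S.χ * s)))) := by
  obtain ⟨-, -, h1, h2⟩ := hc.lax_eq hn hQ ht s
  rw [h1, h2, smul_add, neg_add]

theorem isCurveFlow_symPohlmeyer (hn : 2 ≤ n) (hI : IsOpen I) (hc : S.Corresponds n q Q)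
    (hQ : S.IsospectralFlow n (S.isoTimes n I) Q)
    (hφ : S.IsSpectralFunction n (S.isoTimes n I) Q φ) :
    S.IsCurveFlow n I q
      (fun x τ => (φ ((√S.χ)⁻¹ * x) ((S.κ n)⁻¹ * τ) 0)⁻¹)
      (fun x τ => S.proj (symPohlmeyer φ ((√S.χ)⁻¹ * x) ((S.κ n)⁻¹ * τ))) := by
  have hw := S.sqrt_χ_pos.ne'
  have hκ := (S.κ_pos n).ne'
  have hI' := isOpen_isoTimes (S := S) n hI
  have hmaps : Set.MapsTo (fun p : ℝ × ℝ => ((√S.χ)⁻¹ * p.1, (S.κ n)⁻¹ * p.2)) (Set.univ ×ˢ I)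
      (Set.univ ×ˢ S.isoTimes n I) := fun p hp => ⟨trivial, inv_κ_mul_mem hp.2⟩
  have hsm : ContDiffOn ℝ ∞ (fun p : ℝ × ℝ => ((√S.χ)⁻¹ * p.1, (S.κ n)⁻¹ * p.2))
      (Set.univ ×ˢ I) :=
    ((contDiff_const.mul contDiff_fst).prodMk (contDiff_const.mul contDiff_snd)).contDiffOn
  have hcoe : ∀ x, ∀ t ∈ I,
      (S.proj (symPohlmeyer φ ((√S.χ)⁻¹ * x) ((S.κ n)⁻¹ * t)) : 𝔸) =
        symPohlmeyer φ ((√S.χ)⁻¹ * x) ((S.κ n)⁻¹ * t) := fun x t ht =>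
    S.coe_proj (hφ.symPohlmeyer_mem hI' (inv_κ_mul_mem ht) _)
  have hγx : ∀ x, ∀ t ∈ I,
      HasDerivAt (fun y => symPohlmeyer φ ((√S.χ)⁻¹ * y) ((S.κ n)⁻¹ * t))
        ((√S.χ)⁻¹ • (((φ ((√S.χ)⁻¹ * x) ((S.κ n)⁻¹ * t) 0)⁻¹ : 𝔸ˣ) * S.A *
          (φ ((√S.χ)⁻¹ * x) ((S.κ n)⁻¹ * t) 0 : 𝔸))) x := fun x t ht =>
    hasDerivAt_comp_mul_left (f := fun s => symPohlmeyer φ s ((S.κ n)⁻¹ * t))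
      (hφ.hasDerivAt_symPohlmeyer_s hI' (inv_κ_mul_mem ht) _)
  refine
    { flow := (hc.mergedFlow_iff hI).2 hQ
      mem_G := fun x t ht => S.G.inv_mem (hφ.mem_G _ _ (inv_κ_mul_mem ht) 0)
      smooth_frame := ?_
      smooth_curve := ?_
      arclength := ?_
      e_x := ?_
      ω_x := ?_
      e_t := ?_
      ω_t := ?_ }
  · exact ContDiffOn.comp (g := fun p : ℝ × ℝ => (((φ p.1 p.2 0)⁻¹ : 𝔸ˣ) : 𝔸))
      hφ.contDiffOn_inv hsm hmaps
  · exact S.proj.contDiff.comp_contDiffOn (ContDiffOn.comp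
      (g := fun p : ℝ × ℝ => symPohlmeyer φ p.1 p.2) (hφ.contDiffOn_symPohlmeyer hI') hsm hmaps)
  · intro x t ht
    set g := φ ((√S.χ)⁻¹ * x) ((S.κ n)⁻¹ * t) 0 with hg
    have hgG : g⁻¹ ∈ S.G := S.G.inv_mem (hφ.mem_G _ _ (inv_κ_mul_mem ht) 0)
    have h1 := (S.proj.hasFDerivAt.comp_hasDerivAt x (hγx x t ht)).deriv
    have h2 : S.proj ((√S.χ)⁻¹ • (((g⁻¹ : 𝔸ˣ) : 𝔸) * S.A * (g : 𝔸))) =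
        (√S.χ)⁻¹ • S.adEquiv hgG ⟨S.A, S.A_mem_𝔤⟩ := by
      rw [map_smul]
      congr 1
      refine Subtype.ext ?_
      have h3 : (S.adEquiv hgG ⟨S.A, S.A_mem_𝔤⟩ : 𝔸) = ((g⁻¹ : 𝔸ˣ) : 𝔸) * S.A * (g : 𝔸) := by
        have : (S.adEquiv hgG ⟨S.A, S.A_mem_𝔤⟩ : 𝔸) = conjL g⁻¹ S.A := rfl
        rw [this, conjL_apply, inv_inv]
      rw [← h3, S.proj_coe]
    have h4 : deriv (fun y => S.proj (symPohlmeyer φ ((√S.χ)⁻¹ * y) ((S.κ n)⁻¹ * t))) x =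
        (√S.χ)⁻¹ • S.adEquiv hgG ⟨S.A, S.A_mem_𝔤⟩ := h1.trans h2
    -- The tangent is χ^(-1/2) Ad(φ⁻¹)A, and the Killing form is invariant under Lie algebra
    -- automorphisms, so its squared length is χ⁻¹χ = 1.
    rw [h4, map_smul, map_smul, LinearMap.smul_apply, LieAlgebra.killingForm_of_equiv_apply]
    have h5 : killingForm ℝ S.𝔤 ⟨S.A, S.A_mem_𝔤⟩ ⟨S.A, S.A_mem_𝔤⟩ = -S.χ := by
      rw [χ, neg_neg]
    rw [h5, smul_eq_mul, smul_eq_mul, ← mul_assoc, ← sq, inv_sqrt_χ_sq, mul_neg, neg_neg,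
      inv_mul_cancel₀ S.χ_pos.ne']
  · intro x t ht
    rw [funext fun y => hcoe y t ht, (hγx x t ht).deriv, inv_inv, mul_smul_comm, smul_mul_assoc]
    simp only [mul_assoc, Units.mul_inv_cancel_left, Units.mul_inv, mul_one]
  · intro x t ht
    have h1 := (hasDerivAt_comp_mul_left (f := fun s => (((φ s ((S.κ n)⁻¹ * t) 0)⁻¹ : 𝔸ˣ) : 𝔸))
      (hφ.hasDerivAt_inv_s hI' (inv_κ_mul_mem ht) ((√S.χ)⁻¹ * x))).deriv
    rw [h1, inv_inv, mul_smul_comm, mul_neg, Units.mul_inv_cancel_left, coe_eq_of_corresponds hc,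
      mul_inv_cancel_left₀ hw, mul_inv_cancel_left₀ hκ, neg_neg, smul_smul, inv_mul_cancel₀ hw,
      one_smul]
  · intro x t ht
    -- Membership in 𝔤, and with it the removal of the projection, is known only for times in I;
    -- openness of I makes that enough for the derivative.
    have h0 : (fun τ => (S.proj (symPohlmeyer φ ((√S.χ)⁻¹ * x) ((S.κ n)⁻¹ * τ)) : 𝔸)) =ᶠ[nhds t]
        fun τ => symPohlmeyer φ ((√S.χ)⁻¹ * x) ((S.κ n)⁻¹ * τ) := by
      filter_upwards [hI.mem_nhds ht] with τ hτ
      exact hcoe x τ hτ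
    have h1 := (hasDerivAt_comp_mul_left (f := fun τ => symPohlmeyer φ ((√S.χ)⁻¹ * x) τ)
      (hφ.hasDerivAt_symPohlmeyer_t hn hI' (inv_κ_mul_mem ht) ((√S.χ)⁻¹ * x))).deriv
    rw [h0.deriv_eq, h1, hc.laxV₁_eq hn hQ.1 (inv_κ_mul_mem ht), mul_inv_cancel_left₀ hw,
      mul_inv_cancel_left₀ hκ, inv_inv]
    simp only [mul_smul_comm, smul_mul_assoc, smul_smul, inv_mul_cancel₀ hκ, one_smul]
    simp only [mul_assoc, Units.mul_inv_cancel_left, Units.mul_inv, mul_one]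
  · intro x t ht
    have h1 := (hasDerivAt_comp_mul_left (f := fun τ => (((φ ((√S.χ)⁻¹ * x) τ 0)⁻¹ : 𝔸ˣ) : 𝔸))
      (hφ.hasDerivAt_inv_t hn hI' (inv_κ_mul_mem ht) ((√S.χ)⁻¹ * x))).deriv
    rw [h1, hc.laxV₀_eq hn hQ.1 (inv_κ_mul_mem ht), mul_inv_cancel_left₀ hw,
      mul_inv_cancel_left₀ hκ, inv_inv, mul_neg, neg_neg]
    simp only [mul_smul_comm, smul_smul, inv_mul_cancel₀ hκ, one_smul, Units.mul_inv_cancel_left]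

/-- The frame ψ and φ⁻¹ solve the same linear system in corresponding variables, so ψφ is a constant
g. The curves γ and gΓg⁻¹ then have equal partial derivatives and differ by a constant;
connectedness of the time interval makes these constants global. -/
theorem IsCurveFlow.eq_symPohlmeyer (hn : 2 ≤ n) (hI : IsOpen I) (hIc : I.OrdConnected)
    (hc : S.Corresponds n q Q) (hQ : S.IsospectralFlow n (S.isoTimes n I) Q)
    (hφ : S.IsSpectralFunction n (S.isoTimes n I) Q φ) {ψ : ℝ → ℝ → 𝔸ˣ} {γ : ℝ → ℝ → S.𝔤}
    (h : S.IsCurveFlow n I q ψ γ) :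
    ∃ g ∈ S.G, ∃ a ∈ S.𝔤, ∀ s, ∀ t ∈ S.isoTimes n I,
      (γ (√S.χ * s) (S.κ n * t) : 𝔸) =
        (g : 𝔸) * symPohlmeyer φ s t * ((g⁻¹ : 𝔸ˣ) : 𝔸) + a := by
  rcases (S.isoTimes n I).eq_empty_or_nonempty with hempty | ⟨t₀, ht₀⟩
  -- An empty time interval is allowed and offers no base point for reading off g, so arbitrary
  -- values are used.
  · exact ⟨1, S.G.one_mem, 0, S.𝔤.zero_mem, fun s t ht => by rw [hempty] at ht; exact ht.elim⟩
  have hw := S.sqrt_χ_pos.ne'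
  have hI' := isOpen_isoTimes (S := S) n hI
  have hIp : IsPreconnected (S.isoTimes n I) :=
    (hIc.preimage_mono (f := fun t => S.κ n * t)
      (fun a b hab => mul_le_mul_of_nonneg_left hab (S.κ_pos n).le)).isPreconnected
  have hψx : ∀ s, ∀ t ∈ S.isoTimes n I,
      HasDerivAt (fun σ => (ψ (√S.χ * σ) (S.κ n * t) : 𝔸))
        (√S.χ • ((ψ (√S.χ * s) (S.κ n * t) : 𝔸) * (q (√S.χ * s) (S.κ n * t) : 𝔸))) s := by
    intro s t ht
    rw [← h.ω_x (√S.χ * s) (S.κ n * t) ht, Units.mul_inv_cancel_left]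
    exact hasDerivAt_comp_mul_left
      (differentiableAt_slices (F := fun x t => (ψ x t : 𝔸)) h.smooth_frame hI ht
        (√S.χ * s)).1.hasDerivAt
  have hψt : ∀ s, ∀ t ∈ S.isoTimes n I,
      HasDerivAt (fun τ => (ψ (√S.χ * s) (S.κ n * τ) : 𝔸))
        (S.κ n • ((ψ (√S.χ * s) (S.κ n * t) : 𝔸) *
          (S.wPerp n (S.jet (fun y => q y (S.κ n * t)) (√S.χ * s)) +
            S.wPar n (S.jet (fun y => q y (S.κ n * t)) (√S.χ * s))))) t := by
    intro s t ht
    rw [← h.ω_t (√S.χ * s) (S.κ n * t) ht, Units.mul_inv_cancel_left]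
    exact hasDerivAt_comp_mul_left
      (differentiableAt_slices (F := fun x t => (ψ x t : 𝔸)) h.smooth_frame hI ht
        (√S.χ * s)).2.hasDerivAt
  set E : ℝ → ℝ → 𝔸ˣ := fun s t => ψ (√S.χ * s) (S.κ n * t) * φ s t 0 with hE
  set g := E 0 t₀ with hg
  have hgG : g ∈ S.G := S.G.mul_mem (h.mem_G _ _ ht₀) (hφ.mem_G _ _ ht₀ 0)
  have hconst : ∀ s, ∀ t ∈ S.isoTimes n I, E s t = g := by
    intro s t ht
    refine Units.ext (eq_of_hasDerivAt_eq_zero (F := fun s t => (E s t : 𝔸)) hI' hIp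
      (fun s t ht => ?_) (fun s t ht => ?_) ht ht₀ s 0)
    · have h1 := (hψx s t ht).mul (hφ.hasDerivAt_s hI' ht s 0)
      refine h1.congr_deriv ?_
      rw [laxU_zero, jet_zero, coe_eq_of_corresponds hc]
      simp only [smul_mul_assoc, neg_mul, mul_neg, mul_smul_comm, mul_assoc, add_neg_cancel]
    · obtain ⟨m, rfl⟩ : ∃ m, n = m + 2 := ⟨n - 2, by omega⟩
      have h1 := (hψt s t ht).mul (hφ.hasDerivAt_t hI' ht s 0)
      refine h1.congr_deriv ?_
      rw [laxV_at_zero, hc.laxV₀_eq hn hQ.1 ht]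
      simp only [smul_mul_assoc, neg_mul, mul_neg, mul_smul_comm, mul_assoc, add_neg_cancel]
  have hψ : ∀ s, ∀ t ∈ S.isoTimes n I, ψ (√S.χ * s) (S.κ n * t) = g * (φ s t 0)⁻¹ :=
    fun s t ht => by rw [← hconst s t ht, hE, mul_inv_cancel_right]
  clear_value g
  have hγcoe : ContDiffOn ℝ ∞ (fun p : ℝ × ℝ => (γ p.1 p.2 : 𝔸)) (Set.univ ×ˢ I) :=
    (LinearMap.toContinuousLinearMap (S.𝔤.incl : S.𝔤 →ₗ[ℝ] 𝔸)).contDiff.comp_contDiffOn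
      h.smooth_curve
  have hcancel : ∀ {k : 𝔸ˣ} {X Y : 𝔸}, ((k⁻¹ : 𝔸ˣ) : 𝔸) * X * (k : 𝔸) = Y →
      X = (k : 𝔸) * Y * ((k⁻¹ : 𝔸ˣ) : 𝔸) := fun {k X Y} hXY => by
    rw [← hXY]
    simp only [mul_assoc, Units.mul_inv_cancel_left, Units.mul_inv, mul_one]
  set F : ℝ → ℝ → 𝔸 := fun s t =>
    (γ (√S.χ * s) (S.κ n * t) : 𝔸) - (g : 𝔸) * symPohlmeyer φ s t * ((g⁻¹ : 𝔸ˣ) : 𝔸) with hF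
  have hFconst : ∀ s, ∀ t ∈ S.isoTimes n I, F s t = F 0 t₀ := by
    intro s t ht
    refine eq_of_hasDerivAt_eq_zero hI' hIp (fun s t ht => ?_) (fun s t ht => ?_) ht ht₀ s 0
    · have h1 := hasDerivAt_comp_mul_left
        (differentiableAt_slices (F := fun x t => (γ x t : 𝔸)) hγcoe hI ht
          (√S.χ * s)).1.hasDerivAt
      have h2 := ((hφ.hasDerivAt_symPohlmeyer_s hI' ht s).const_mul (g : 𝔸)).mul_const
        ((g⁻¹ : 𝔸ˣ) : 𝔸)
      refine (h1.sub h2).congr_deriv ?_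
      rw [hcancel (h.e_x (√S.χ * s) (S.κ n * t) ht), hψ s t ht, mul_inv_rev, inv_inv]
      simp only [Units.val_mul, mul_smul_comm, smul_mul_assoc, smul_smul, mul_inv_cancel₀ hw,
        one_smul, mul_assoc, sub_self]
    · have h1 := hasDerivAt_comp_mul_left
        (differentiableAt_slices (F := fun x t => (γ x t : 𝔸)) hγcoe hI ht
          (√S.χ * s)).2.hasDerivAt
      have h2 := ((hφ.hasDerivAt_symPohlmeyer_t hn hI' ht s).const_mul (g : 𝔸)).mul_const
        ((g⁻¹ : 𝔸ˣ) : 𝔸)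
      refine (h1.sub h2).congr_deriv ?_
      rw [hcancel (h.e_t (√S.χ * s) (S.κ n * t) ht), hc.laxV₁_eq hn hQ.1 ht, hψ s t ht, mul_inv_rev,
        inv_inv]
      simp only [Units.val_mul, mul_assoc, smul_mul_assoc, mul_smul_comm, sub_self]
  refine ⟨g, hgG, F 0 t₀, ?_, fun s t ht => ?_⟩
  · exact S.𝔤.sub_mem (γ _ _).2 (S.conjL_mem_𝔤 hgG (hφ.symPohlmeyer_mem hI' ht₀ 0))
  · rw [← hFconst s t ht, hF]
    simp only [add_sub_cancel]

end HermitianSymmetric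

end

theorem mainTheorem8 {𝔸 : Type*} [NormedRing 𝔸] [NormedAlgebra ℝ 𝔸] [FiniteDimensional ℝ 𝔸]
    (S : HermitianSymmetric 𝔸) :
    -- the members of the hierarchy are well-defined `𝔪`-valued differential functions
    (∀ n, S.IsDifferential (S.hier n) ∧ (∀ u, S.hier n u ∈ S.𝔪) ∧
      ∃! p, S.IsPrimitive p (S.adVar (S.Jinv (S.hier n)))) ∧
    -- the isospectral flows are given by the Lax pair
    (∀ (n : ℕ) (I : Set ℝ) (Q : ℝ → ℝ → S.𝔪), IsOpen I → I.OrdConnected →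
      (S.IsospectralFlow n I Q ↔ S.SmoothOn I Q ∧ S.ZeroCurvature n I Q)) ∧
    -- the two hierarchies coincide under the transformation
    (∀ (n : ℕ) (I : Set ℝ) (q Q : ℝ → ℝ → S.𝔪), IsOpen I → I.OrdConnected →
      S.Corresponds n q Q → (S.MergedFlow n I q ↔ S.IsospectralFlow n (S.isoTimes n I) Q)) ∧
    -- the `+2` and `+3` flows are the NLS and mKdV systems
    (∀ (I : Set ℝ) (q : ℝ → ℝ → S.𝔪), IsOpen I → I.OrdConnected →
      (S.MergedFlow 2 I q ↔ S.NLS S.χ I q) ∧ (S.IsospectralFlow 2 I q ↔ S.NLS 1 I q) ∧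
      (S.MergedFlow 3 I q ↔ S.MKdV S.χ I q) ∧ (S.IsospectralFlow 3 I q ↔ S.MKdV 1 I q)) ∧
    -- which are invariant under `Ad(H)`
    (∀ (c : ℝ) (I : Set ℝ) (Q : ℝ → ℝ → S.𝔪), IsOpen I → I.OrdConnected → ∀ g ∈ S.H,
      ∃ Q' : ℝ → ℝ → S.𝔪,
        (∀ s t, (Q' s t : 𝔸) = (g : 𝔸) * (Q s t : 𝔸) * ((g⁻¹ : 𝔸ˣ) : 𝔸)) ∧
        (S.NLS c I Q → S.NLS c I Q') ∧ (S.MKdV c I Q → S.MKdV c I Q')) ∧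
    -- the curve flows coincide for `n ≥ 2`
    (∀ (n : ℕ) (I : Set ℝ) (q Q : ℝ → ℝ → S.𝔪), 2 ≤ n → IsOpen I → I.OrdConnected →
      S.Corresponds n q Q → S.IsospectralFlow n (S.isoTimes n I) Q →
      -- the motion and the connection of the frame correspond to the Lax coefficients
      (∀ s, ∀ t ∈ S.isoTimes n I,
        S.laxVm n 1 (S.jet (fun y => Q y t) s) =
          S.κ n • S.hPerp n (S.jet (fun y => q y (S.κ n * t)) (√S.χ * s)) ∧
        S.laxVh n 1 (S.jet (fun y => Q y t) s) =
          S.κ n • S.hPar n (S.jet (fun y => q y (S.κ n * t)) (√S.χ * s)) ∧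
        S.laxVm n 0 (S.jet (fun y => Q y t) s) =
          -(S.κ n • S.wPerp n (S.jet (fun y => q y (S.κ n * t)) (√S.χ * s))) ∧
        S.laxVh n 0 (S.jet (fun y => Q y t) s) =
          -(S.κ n • S.wPar n (S.jet (fun y => q y (S.κ n * t)) (√S.χ * s)))) ∧
      ∀ φ : ℝ → ℝ → ℝ → 𝔸ˣ, S.IsSpectralFunction n (S.isoTimes n I) Q φ →
        -- every Sym–Pohlmeyer curve is a non-stretching curve flow determined by the `+n` flow
        (∃ (ψ : ℝ → ℝ → 𝔸ˣ) (γ : ℝ → ℝ → S.𝔤),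
          (∀ s, ∀ t ∈ S.isoTimes n I, ψ (√S.χ * s) (S.κ n * t) = (φ s t 0)⁻¹) ∧
          (∀ s, ∀ t ∈ S.isoTimes n I,
            (γ (√S.χ * s) (S.κ n * t) : 𝔸) = HermitianSymmetric.symPohlmeyer φ s t) ∧
          S.IsCurveFlow n I q ψ γ) ∧
        -- every such curve flow is the Sym–Pohlmeyer curve up to a rigid motion
        (∀ (ψ : ℝ → ℝ → 𝔸ˣ) (γ : ℝ → ℝ → S.𝔤), S.IsCurveFlow n I q ψ γ →
          ∃ g ∈ S.G, ∃ a ∈ S.𝔤, ∀ s, ∀ t ∈ S.isoTimes n I,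
            (γ (√S.χ * s) (S.κ n * t) : 𝔸) =
              (g : 𝔸) * HermitianSymmetric.symPohlmeyer φ s t * ((g⁻¹ : 𝔸ˣ) : 𝔸) + a)) := by
  refine ⟨S.hier_wellDefined, fun n I Q hI _ => HermitianSymmetric.isospectralFlow_iff hI,
    fun n I q Q hI _ hc => hc.mergedFlow_iff hI, fun I q _ _ =>
      ⟨HermitianSymmetric.merged_iff_nls S.χ I q,
        (HermitianSymmetric.isospectral_iff 2 I q).trans (HermitianSymmetric.merged_iff_nls 1 I q),
        HermitianSymmetric.merged_iff_mkdv S.χ I q,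
        (HermitianSymmetric.isospectral_iff 3 I q).trans
          (HermitianSymmetric.merged_iff_mkdv 1 I q)⟩,
    fun c I Q hI _ g hg => S.flows_invariant c I Q hI hg, ?_⟩
  intro n I q Q hn hI hIc hc hQ
  refine ⟨fun s t ht => hc.lax_eq hn hQ.1 ht s, fun φ hφ => ⟨⟨_, _, fun s t _ => ?_, fun s t ht => ?_,
    HermitianSymmetric.isCurveFlow_symPohlmeyer hn hI hc hQ hφ⟩,
    fun ψ γ h => h.eq_symPohlmeyer hn hI hIc hc hQ hφ⟩⟩
  · rw [inv_mul_cancel_left₀ S.sqrt_χ_pos.ne', inv_mul_cancel_left₀ (S.κ_pos n).ne']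
  · rw [inv_mul_cancel_left₀ S.sqrt_χ_pos.ne', inv_mul_cancel_left₀ (S.κ_pos n).ne']
    exact S.coe_proj (hφ.symPohlmeyer_mem (HermitianSymmetric.isOpen_isoTimes n hI) ht s)
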